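/- **Setting.** For $r\in\mathbb R$ let $H^r=H^r(\mathbb T)$ be the Sobolev space on $\mathbb T=\mathbb R/2\pi\mathbb Z$ with norm $\|f\|_{H^r}^2=\sum_{n\in\mathbb Z}\langle n\rangle^{2r}|f_n|^2$, where $f_n=\widehat f(n)$ and $\langle n\rangle=(1+n^2)^{1/2}$. For $N\in\mathbb N\cup\{\infty\}$ and $n\in\mathbb Z$ let $\phi(\bar n)=n_1^4-n_2^4+n_3^4-n^4$ and $$\Gamma_N(n)=\{(n_1,n_2,n_3)\in\mathbb Z^3:\ |n_j|\le N,\ n=n_1-n_2+n_3,\ n_1,n_3\ne n\},$$ with no restriction on $|n_j|$ if $N=\infty$. Consider the (truncated) renormalized cubic fourth order NLS in the interaction representation, $$\partial_t v_n=-i\sum_{\Gamma_N(n)}e^{-i\phi(\bar n)t}\,v_{n_1}\overline{v_{n_2}}v_{n_3}+i|v_n|^2v_n\quad(|n|\le N),\qquad v_n=0\quad(|n|>N).\tag{1}$$ A *classical solution* is a global solution of (1); if $N=\infty$ it is also required to lie in $C(\mathbb R;H^r)$ for some $r>\frac12$. For $\sigma<0$, a *solution* $v\in C(\mathbb R;H^\sigma)$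 of (1) is a limit, in $C([-T,T];H^\sigma)$ for every $T>0$, of classical solutions. (For finite $N$ the two notions agree.) **Proposition.** Let $\frac3{10}<s\le\frac12$. There is $\varepsilon_0=\varepsilon_0(s)>0$ such that for every $0<\varepsilon<\varepsilon_0$, with $\sigma=s-\frac12-\varepsilon$, there are positive constants $C_0(j),C_1(j),C_2(j)$, independent of $N$ and decaying faster than any exponential rate as $j\to\infty$, for which the following holds. For every $N\in\mathbb N\cup\{\infty\}$ there exist, for $j\ge2$ and $t\in\mathbb R$, real-valued $\mathbb R$-multilinear forms on $H^\sigma$, namely $2j$-linear forms $\mathsf N^{(j)}_{0,N}(t)$ and $(2j+2)$-linear forms $\mathsf N^{(j)}_{1,N}(t)$ and $\mathsf R^{(j)}_N(t)$, such that for all $j\ge2$ and all $f_k\in H^\sigma$ $$\sup_{t\in\mathbb R}|\mathsf N^{(j)}_{0,N}(t)(f_1,\dots,f_{2j})|\le C_0(j)\prod_{k=1}^{2j}\|f_k\|_{H^\sigma},$$ $$\sup_{t\in\mathbb R}|\mathsf N^{(j)}_{1,N}(t)(f_1,\dots,f_{2j+2})|\le C_1(j)\prod_{k=1}^{2j+2}\|f_k\|_{H^\sigma},$$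 $$\sup_{t\in\mathbb R}|\mathsf R^{(j)}_{N}(t)(f_1,\dots,f_{2j+2})|\le C_2(j)\prod_{k=1}^{2j+2}\|f_k\|_{H^\sigma}$$ (in particular the series below converge absolutely), and, writing $\mathsf N(t)(v)=\mathsf N(t)(v,\dots,v)$, $$\frac{d}{dt}\Big(\tfrac12\|v(t)\|_{H^s}^2\Big)=\frac{d}{dt}\Big(\sum_{j=2}^\infty\mathsf N^{(j)}_{0,N}(t)(v(t))\Big)+\sum_{j=2}^\infty\mathsf N^{(j)}_{1,N}(t)(v(t))+\sum_{j=2}^\infty\mathsf R^{(j)}_N(t)(v(t))\tag{2}$$ for every solution $v\in C(\mathbb R;H^\sigma)$ of (1). For classical solutions, (2) holds for all $t$ in the ordinary sense, both derivatives existing. For general solutions, (2) is understood in the limiting sense: there is $E:\mathbb R\to\mathbb R$ such that for every sequence of classical solutions $w^{(k)}$ converging to $v$ in $C([-T,T];H^\sigma)$ for every $T$, one has $\frac12\|w^{(k)}(t)\|_{H^s}^2-\frac12\|w^{(k)}(0)\|_{H^s}^2\to E(t)$ locally uniformly in $t$, and for all $t$ $$\frac{d}{dt}\Big(E(t)-\sum_{j=2}^\infty\mathsf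 N^{(j)}_{0,N}(t)(v(t))\Big)=\sum_{j=2}^\infty\mathsf N^{(j)}_{1,N}(t)(v(t))+\sum_{j=2}^\infty\mathsf R^{(j)}_N(t)(v(t)).$$ -/

import Mathlib

open Filter Topology

noncomputable section

namespace FourthNLS

/-! Functions and distributions on the circle are represented by their Fourier coefficients
`u : ℤ → ℂ`. -/

/-- The weight `⟨n⟩^{2r}`, where `⟨n⟩ = (1 + n ^ 2)^{1/2}`. -/
def weight (r : ℝ) (n : ℤ) : ℝ := (1 + (n : ℝ) ^ 2) ^ r

/-- `u` belongs to the Sobolev space `H^r` of the circle. -/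
def MemH (r : ℝ) (u : ℤ → ℂ) : Prop := Summable fun n : ℤ => weight r n * ‖u n‖ ^ 2

/-- The `H^r` norm, `(∑ ⟨n⟩^{2r} |u_n|^2)^{1/2}`; only meaningful on `H^r`. -/
def normH (r : ℝ) (u : ℤ → ℂ) : ℝ := √(∑' n : ℤ, weight r n * ‖u n‖ ^ 2)

theorem weight_nonneg (r : ℝ) (n : ℤ) : 0 ≤ weight r n := by
  unfold weight
  positivity

/-- The Sobolev space `H^σ` of the circle, as a complex vector space. -/
def H (σ : ℝ) : Submodule ℂ (ℤ → ℂ) where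
  carrier := {u | MemH σ u}
  zero_mem' := by
    simp [MemH, summable_zero]
  add_mem' := by
    intro a b ha hb
    refine Summable.of_nonneg_of_le
      (fun n => mul_nonneg (weight_nonneg σ n) (sq_nonneg _)) (fun n => ?_)
      ((Summable.mul_left 2 ha).add (Summable.mul_left 2 hb))
    have h1 : ‖(a + b) n‖ ^ 2 ≤ 2 * ‖a n‖ ^ 2 + 2 * ‖b n‖ ^ 2 := by
      have h2 : ‖(a + b) n‖ ≤ ‖a n‖ + ‖b n‖ := norm_add_le _ _
      nlinarith [sq_nonneg (‖a n‖ - ‖b n‖), norm_nonneg ((a + b) n), norm_nonneg (a n),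
        norm_nonneg (b n)]
    nlinarith [mul_le_mul_of_nonneg_left h1 (weight_nonneg σ n)]
  smul_mem' := by
    intro c a ha
    refine (Summable.mul_left (‖c‖ ^ 2) ha).congr (fun n => ?_)
    simp only [Pi.smul_apply, norm_smul]
    ring

/-- The phase function `φ = n₁⁴ - n₂⁴ + n₃⁴ - n⁴`. -/
def phase (n₁ n₂ n₃ n : ℤ) : ℤ := n₁ ^ 4 - n₂ ^ 4 + n₃ ^ 4 - n ^ 4

/-- The non-resonant set `Γ_N(n)` of all `(n₁, n₂, n₃)` with `n = n₁ - n₂ + n₃`,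
`n₁, n₃ ≠ n` and `|n_j| ≤ N`; for `N = ∞` there is no restriction on the size. -/
def Gam (N : ℕ∞) (n : ℤ) : Set (ℤ × ℤ × ℤ) :=
  {p | ((p.1.natAbs : ℕ∞) ≤ N ∧ (p.2.1.natAbs : ℕ∞) ≤ N ∧ (p.2.2.natAbs : ℕ∞) ≤ N) ∧
    n = p.1 - p.2.1 + p.2.2 ∧ p.1 ≠ n ∧ p.2.2 ≠ n}

/-- The `n`-th Fourier coefficient of the right-hand side of the (truncated) renormalized cubic
fourth order NLS for the interaction representation:
`-i ∑_{Γ_N(n)} e^{-iφt} v_{n₁} conj(v_{n₂}) v_{n₃} + i |v_n|² v_n`. -/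
def vectorField (N : ℕ∞) (t : ℝ) (v : ℤ → ℂ) (n : ℤ) : ℂ :=
  -Complex.I * ∑' p : Gam N n,
      Complex.exp (-Complex.I * ((phase p.1.1 p.1.2.1 p.1.2.2 n : ℤ) : ℂ) * (t : ℂ)) *
        v p.1.1 * (starRingEnd ℂ) (v p.1.2.1) * v p.1.2.2
    + Complex.I * ((‖v n‖ ^ 2 : ℝ) : ℂ) * v n

/-- `v ∈ C(ℝ; H^r)`. -/
def ContH (r : ℝ) (v : ℝ → ℤ → ℂ) : Prop :=
  (∀ t, MemH r (v t)) ∧ ∀ t, Tendsto (fun τ => normH r (v τ - v t)) (𝓝 t) (𝓝 0)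

/-- `v` is a classical global solution of the equation with cutoff `N`. For finite `N` this is a
solution of the finite-dimensional system of ODEs for the modes `|n| ≤ N`, all other modes being
zero. For `N = ∞` it is a solution in `C(ℝ; H^r)` for some `r > 1/2`, so that all sums in the
equation converge absolutely. -/
def IsClassicalSolution (N : ℕ∞) (v : ℝ → ℤ → ℂ) : Prop :=
  (N = ⊤ → ∃ r : ℝ, 1 / 2 < r ∧ ContH r v) ∧
  (∀ n : ℤ, (n.natAbs : ℕ∞) ≤ N → ∀ t : ℝ,
    HasDerivAt (fun τ => v τ n) (vectorField N t (v t) n) t) ∧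
  (∀ n : ℤ, N < (n.natAbs : ℕ∞) → ∀ t : ℝ, v t n = 0)

/-- `w k → v` in `C([-T, T]; H^σ)` for every `T`. -/
def TendstoCH {σ : ℝ} (w : ℕ → ℝ → H σ) (v : ℝ → H σ) : Prop :=
  ∀ T : ℝ, ∀ δ > 0, ∀ᶠ k in atTop, ∀ t ∈ Set.Icc (-T) T,
    normH σ ((w k t : ℤ → ℂ) - (v t : ℤ → ℂ)) ≤ δ

/-- `w` is a sequence of classical solutions that converges to `v` in `C([-T, T]; H^σ)` for
every `T`. -/
def IsApproximation (N : ℕ∞) {σ : ℝ} (w : ℕ → ℝ → H σ) (v : ℝ → H σ) : Prop :=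
  (∀ k, IsClassicalSolution N (fun t => (w k t : ℤ → ℂ))) ∧ TendstoCH w v

/-- `v ∈ C(ℝ; H^σ)` is a (possibly rough) solution: it is a limit of classical solutions. (For
`σ < 0` and `N = ∞` the cubic term is not defined on `C(ℝ; H^σ)`, and solutions are the limits
of regular ones. For finite `N` these are again the classical solutions.) -/
def IsSolution (N : ℕ∞) {σ : ℝ} (v : ℝ → H σ) : Prop :=
  ContH σ (fun t => (v t : ℤ → ℂ)) ∧ ∃ w : ℕ → ℝ → H σ, IsApproximation N w v

/-- Real-valued `m`-linear forms on `H^σ`. They are linear over `ℝ`: the forms of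
interest are real parts of expressions in which some arguments enter through their complex
conjugates. -/
abbrev Form (σ : ℝ) (m : ℕ) : Type := MultilinearMap ℝ (fun _ : Fin m => H σ) ℝ

/-- The sum over `j ≥ 2` of the forms `A j`, evaluated at `(f, …, f)`. -/
def diagSum {σ : ℝ} {d : ℕ → ℕ} (A : (j : ℕ) → Form σ (d j)) (f : H σ) : ℝ :=
  ∑' k : ℕ, A (k + 2) (fun _ => f)

/-- The bound `sup_t |A_j(t)(f₁, …, f_m)| ≤ C(j) ∏ ‖f_k‖_{H^σ}` for all `j ≥ 2`. -/
def BoundedBy {σ : ℝ} {d : ℕ → ℕ} (A : (j : ℕ) → ℝ → Form σ (d j)) (C : ℕ → ℝ) : Prop :=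
  ∀ j, 2 ≤ j → ∀ (t : ℝ) (f : Fin (d j) → H σ),
    |A j t f| ≤ C j * ∏ k, normH σ (f k)

/-- A sequence of positive numbers that decays faster than any exponential rate. -/
def SuperexpDecay (C : ℕ → ℝ) : Prop :=
  (∀ j, 0 < C j) ∧ ∀ K : ℝ, Tendsto (fun j => C j * K ^ j) atTop (𝓝 0)

/-- The energy identity
`d/dt (½ ‖v‖²_{H^s}) = d/dt (∑ N₀) + ∑ N₁ + ∑ R` along `v`, in the classical sense: `½ ‖v‖²_{H^s}`
is finite, both derivatives exist, and the identity holds at all times. -/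
def EnergyIdentity (s : ℝ) {σ : ℝ}
    (N₀ : (j : ℕ) → ℝ → Form σ (2 * j))
    (N₁ R : (j : ℕ) → ℝ → Form σ (2 * j + 2)) (v : ℝ → H σ) : Prop :=
  (∀ t, MemH s (v t)) ∧
  ∀ t : ℝ, ∃ D : ℝ,
    HasDerivAt (fun τ => diagSum (fun j => N₀ j τ) (v τ)) D t ∧
    HasDerivAt (fun τ => 1 / 2 * normH s (v τ) ^ 2)
      (D + diagSum (fun j => N₁ j t) (v t) + diagSum (fun j => R j t) (v t)) t

/-- The energy identity along `v` in the limiting sense. For `v ∈ C(ℝ; H^σ)` the quantity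
`½ ‖v(t)‖²_{H^s}` is in general infinite. But its increment `½ ‖v(t)‖²_{H^s} - ½ ‖v(0)‖²_{H^s}` is
defined as the limit `E(t)` of the increments along classical solutions that converge to `v`, locally
uniformly in time and independently of the approximation; and
`d/dt (E - ∑ N₀(v)) = ∑ N₁(v) + ∑ R(v)`. -/
def LimitEnergyIdentity (s : ℝ) (N : ℕ∞) {σ : ℝ}
    (N₀ : (j : ℕ) → ℝ → Form σ (2 * j))
    (N₁ R : (j : ℕ) → ℝ → Form σ (2 * j + 2)) (v : ℝ → H σ) : Prop :=
  ∃ E : ℝ → ℝ,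
    (∀ w : ℕ → ℝ → H σ, IsApproximation N w v →
      TendstoLocallyUniformly
        (fun k t => 1 / 2 * normH s (w k t) ^ 2 - 1 / 2 * normH s (w k 0) ^ 2) E atTop) ∧
    ∀ t : ℝ, HasDerivAt (fun τ => E τ - diagSum (fun j => N₀ j τ) (v τ))
      (diagSum (fun j => N₁ j t) (v t) + diagSum (fun j => R j t) (v t)) t

/-- All the series over `j` in the energy identity converge absolutely, at every point of `H^σ`. -/
def SeriesConverge {σ : ℝ} {d : ℕ → ℕ} (A : (j : ℕ) → ℝ → Form σ (d j)) : Prop :=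
  ∀ (t : ℝ) (f : H σ), Summable fun k : ℕ => A (k + 2) t (fun _ => f)

end FourthNLS

end

open FourthNLS

/-! The identity comes from an infinite iteration of normal form reductions, that is, of
differentiation by parts in time. A real kernel K on frequency tuples defines a multilinear form
whose slots carry alternately v and its conjugate, with the oscillating factor e^{-iΦt}. Along a
classical solution its time derivative is -i times the form with kernel KΦ, plus i times the form
with kernel `graft K (tot N)`, in which each slot in turn is replaced by the three frequencies of
the nonlinearity (`hasDerivAt_cform`). The weight `tot` splits into `high` (non-resonant, new phase
more than four times the old one), `low` (the other non-resonant terms) and `resn` (all frequencies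
equal).

Start from the kernel `L 1` of -½‖v‖²_{H^s} and put L_{j+1} = graft(L_j, high)/Φ. Then d/dt Re
L_{j+1} = Im graft(L_j, high) - Im graft(L_{j+1}, high) - Im graft(L_{j+1}, low) - Im graft(L_{j+1},
resn). Summing over j telescopes to Im graft(L_1, high), which is the derivative of ½‖v‖²_{H^s}: on
the diagonal Φ = 0, so `low` does not occur, and the resonant contributions of the two slots cancel.

The bounds rest on the factorization of the phase: a non-resonant increment has size at least
|n₁-n||n₃-n| times the square of the largest frequency, up to a constant (`dph_lower`). By
Cauchy-Schwarz a trilinear operator with kernel |φ|^{-θ} then gains derivatives (`tri_tau_le`).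
Grafting composes a form with such an operator in one slot (`Bdd.graft`), so bounds propagate by
induction (`bdd_L`). The phase grows at least like 4^j on the support of L_{j+2}. A fraction of its
inverse power, spent at each step, beats the growing number of slots and gives superexponential
decay. The resonant term needs one slot in H^{3σ}, which the induction carries along. In the `low`
term |Φ|⁻¹ is shared between the last two generations (`bdd_low`), and this is where s > 3/10 is
needed. The cutoff only removes terms from the kernels, so all constants are independent of N.

All series are Lipschitz on bounded sets of H^σ, uniformly in t. Hence the time-integrated identity
passes to limits of classical solutions (`limitEnergyIdentity_of_locLip`). -/

noncomputable section

namespace FourthNLS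

open scoped ENNReal NNReal

/-! ### Weighted `ℓ²` norms with values in `[0, ∞]` -/

/-- The weight `⟨n⟩^ρ` as an extended nonnegative real. -/
def W (ρ : ℝ) (n : ℤ) : ℝ≥0∞ := ENNReal.ofReal (weight (ρ / 2) n)

/-- The `H^ρ` norm of a sequence of extended nonnegative reals. -/
def nrm (ρ : ℝ) (F : ℤ → ℝ≥0∞) : ℝ≥0∞ := (∑' n, (W ρ n * F n) ^ 2) ^ (1 / 2 : ℝ)

theorem one_le_base (n : ℤ) : (1 : ℝ) ≤ 1 + (n : ℝ) ^ 2 := by nlinarith [sq_nonneg (n : ℝ)]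

theorem base_pos (n : ℤ) : (0 : ℝ) < 1 + (n : ℝ) ^ 2 := by positivity

theorem weight_pos (r : ℝ) (n : ℤ) : 0 < weight r n := Real.rpow_pos_of_pos (base_pos n) _

theorem weight_mul (r r' : ℝ) (n : ℤ) : weight r n * weight r' n = weight (r + r') n :=
  (Real.rpow_add (base_pos n) _ _).symm

theorem weight_mono {r r' : ℝ} (h : r ≤ r') (n : ℤ) : weight r n ≤ weight r' n :=
  Real.rpow_le_rpow_of_exponent_le (one_le_base n) h

theorem W_mul (ρ ρ' : ℝ) (n : ℤ) : W ρ n * W ρ' n = W (ρ + ρ') n := by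
  rw [W, W, ← ENNReal.ofReal_mul (weight_nonneg _ _), weight_mul, W, add_div]

theorem W_zero (n : ℤ) : W 0 n = 1 := by simp [W, weight]

theorem W_neg_mul (ρ : ℝ) (n : ℤ) : W (-ρ) n * W ρ n = 1 := by
  rw [W_mul, neg_add_cancel, W_zero]

theorem W_mono {ρ ρ' : ℝ} (h : ρ ≤ ρ') (n : ℤ) : W ρ n ≤ W ρ' n :=
  ENNReal.ofReal_le_ofReal (weight_mono (by linarith) n)

theorem W_sq (ρ : ℝ) (n : ℤ) : W ρ n ^ 2 = ENNReal.ofReal (weight ρ n) := by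
  rw [sq, W_mul, W]; congr 2; ring

theorem nrm_mono_exp {ρ ρ' : ℝ} (h : ρ ≤ ρ') (F : ℤ → ℝ≥0∞) : nrm ρ F ≤ nrm ρ' F := by
  refine ENNReal.rpow_le_rpow (ENNReal.tsum_le_tsum fun n => ?_) (by norm_num)
  gcongr
  exact W_mono h n

theorem nrm_sq (ρ : ℝ) (F : ℤ → ℝ≥0∞) : nrm ρ F ^ 2 = ∑' n, (W ρ n * F n) ^ 2 := by
  rw [nrm, ← ENNReal.rpow_natCast, ← ENNReal.rpow_mul]; norm_num

theorem le_of_sq_le_sq {x y : ℝ≥0∞} (h : x ^ 2 ≤ y ^ 2) : x ≤ y :=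
  (ENNReal.pow_le_pow_left_iff two_ne_zero).1 h

theorem W_mul_le_nrm (ρ : ℝ) (F : ℤ → ℝ≥0∞) (n : ℤ) : W ρ n * F n ≤ nrm ρ F := by
  refine le_of_sq_le_sq ?_
  rw [nrm_sq]
  exact ENNReal.le_tsum (f := fun n => (W ρ n * F n) ^ 2) n

/-- The Cauchy-Schwarz inequality. -/
theorem tsum_mul_sq_le {ι : Type*} (f g : ι → ℝ≥0∞) :
    (∑' i, f i * g i) ^ 2 ≤ (∑' i, f i ^ 2) * ∑' i, g i ^ 2 := by
  let _ : MeasurableSpace ι := ⊤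
  have h := ENNReal.lintegral_mul_le_Lp_mul_Lq (MeasureTheory.Measure.count (α := ι))
    Real.HolderConjugate.two_two (f := f) (g := g) measurable_from_top.aemeasurable
    measurable_from_top.aemeasurable
  rw [MeasureTheory.lintegral_count' measurable_from_top,
    MeasureTheory.lintegral_count' measurable_from_top,
    MeasureTheory.lintegral_count' measurable_from_top] at h
  have h2 : ∀ x : ℝ≥0∞, (x ^ (1 / 2 : ℝ)) ^ 2 = x := fun x => by
    rw [← ENNReal.rpow_natCast, ← ENNReal.rpow_mul]; norm_num
  calc (∑' i, f i * g i) ^ 2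
      ≤ ((∑' i, f i ^ (2 : ℝ)) ^ (1 / 2 : ℝ) * (∑' i, g i ^ (2 : ℝ)) ^ (1 / 2 : ℝ)) ^ 2 := by
        gcongr
        exact h
    _ = _ := by
        rw [mul_pow, h2, h2]
        norm_num

/-! ### Trilinear operators -/

/-- The trilinear operator with kernel `τ(p, a, b)`, the remaining frequency being
`p - ε (a - b)`. -/
def tri (ε : ℤ) (τ : ℤ → ℤ → ℤ → ℝ≥0∞) (F G H : ℤ → ℝ≥0∞) (p : ℤ) : ℝ≥0∞ :=
  ∑' z : ℤ × ℤ, τ p z.1 z.2 * (F (p - ε * (z.1 - z.2)) * G z.1 * H z.2)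

/-- Cauchy-Schwarz in (a, b) at fixed output frequency p leaves the sum of the squares of the three
inputs. Summing over p, with (a, b) fixed, is a translation in the first input and factorizes the
rest. -/
theorem tri_le {ε : ℤ} {τ : ℤ → ℤ → ℤ → ℝ≥0∞} {ρ₀ ρ₁ ρ₂ ρ₃ : ℝ} {B : ℝ≥0∞}
    (h : ∀ p, ∑' z : ℤ × ℤ, (τ p z.1 z.2 * W ρ₀ p * (W (-ρ₁) (p - ε * (z.1 - z.2)) *
      W (-ρ₂) z.1 * W (-ρ₃) z.2)) ^ 2 ≤ B ^ 2) (F G H : ℤ → ℝ≥0∞) :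
    nrm ρ₀ (tri ε τ F G H) ≤ B * (nrm ρ₁ F * nrm ρ₂ G * nrm ρ₃ H) := by
  refine le_of_sq_le_sq ?_
  rw [mul_pow, mul_pow, mul_pow, nrm_sq, nrm_sq, nrm_sq, nrm_sq]
  have key : ∀ p, (W ρ₀ p * tri ε τ F G H p) ^ 2 ≤ B ^ 2 * ∑' z : ℤ × ℤ,
      ((W ρ₁ (p - ε * (z.1 - z.2)) * F (p - ε * (z.1 - z.2))) ^ 2 *
        (W ρ₂ z.1 * G z.1) ^ 2 * (W ρ₃ z.2 * H z.2) ^ 2) := by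
    intro p
    rw [tri, ← ENNReal.tsum_mul_left]
    have e : ∀ z : ℤ × ℤ, W ρ₀ p * (τ p z.1 z.2 * (F (p - ε * (z.1 - z.2)) * G z.1 * H z.2)) =
        (τ p z.1 z.2 * W ρ₀ p * (W (-ρ₁) (p - ε * (z.1 - z.2)) *
          W (-ρ₂) z.1 * W (-ρ₃) z.2)) *
        ((W ρ₁ (p - ε * (z.1 - z.2)) * F (p - ε * (z.1 - z.2))) *
          (W ρ₂ z.1 * G z.1) * (W ρ₃ z.2 * H z.2)) := by
      intro z
      calc _ = (W (-ρ₁) (p - ε * (z.1 - z.2)) * W ρ₁ (p - ε * (z.1 - z.2))) *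
          (W (-ρ₂) z.1 * W ρ₂ z.1) * (W (-ρ₃) z.2 * W ρ₃ z.2) *
          (W ρ₀ p * (τ p z.1 z.2 * (F (p - ε * (z.1 - z.2)) * G z.1 * H z.2))) := by
            rw [W_neg_mul, W_neg_mul, W_neg_mul]; ring
        _ = _ := by ring
    rw [tsum_congr e]
    refine (tsum_mul_sq_le _ _).trans ?_
    simp only [mul_pow _ _ 2] at h ⊢
    gcongr
    exact h p
  refine (ENNReal.tsum_le_tsum key).trans ?_
  rw [ENNReal.tsum_mul_left, ENNReal.tsum_comm]
  gcongr
  have e : ∀ z : ℤ × ℤ, ∑' p, ((W ρ₁ (p - ε * (z.1 - z.2)) * F (p - ε * (z.1 - z.2))) ^ 2 *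
        (W ρ₂ z.1 * G z.1) ^ 2 * (W ρ₃ z.2 * H z.2) ^ 2) =
      (∑' p, (W ρ₁ p * F p) ^ 2) * ((W ρ₂ z.1 * G z.1) ^ 2 * (W ρ₃ z.2 * H z.2) ^ 2) := by
    intro z
    rw [← (Equiv.subRight (ε * (z.1 - z.2))).tsum_eq (fun p => (W ρ₁ p * F p) ^ 2),
      ← ENNReal.tsum_mul_right]
    exact tsum_congr fun p => by simp only [Equiv.subRight_apply]; ring
  rw [tsum_congr e, ENNReal.tsum_mul_left, ENNReal.tsum_prod', mul_assoc]
  gcongr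
  refine le_of_eq ?_
  simp only [ENNReal.tsum_mul_left, ENNReal.tsum_mul_right]

/-! ### The phase and the non-resonant trilinear estimate -/

/-- The increment of the phase when the frequency `p`, carrying the sign `ε`, is replaced by
`p - ε (a - b)`, `a` and `b`. -/
def dph (ε p a b : ℤ) : ℤ := ε * ((p - ε * (a - b)) ^ 4 - p ^ 4) + a ^ 4 - b ^ 4

/-- The non-resonance condition `n₁, n₃ ≠ n`. -/
def Nonres (ε p a b : ℤ) : Prop := a ≠ b ∧ p ≠ if ε = 1 then a else b

/-- The resonance `n₁ = n₂ = n₃ = n`. -/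
def Res (p a b : ℤ) : Prop := a = b ∧ p = a

/-- The square of the size of the largest frequency. -/
def size (ε p a b : ℤ) : ℝ :=
  1 + ((p - ε * (a - b) : ℤ) : ℝ) ^ 2 + (a : ℝ) ^ 2 + (b : ℝ) ^ 2 + (p : ℝ) ^ 2

/-- The phase factors as (n₁-n₂)(n₁-n)(n₁²+n₂²+n₃²+n²+2(n₁+n₃)²), up to sign. The last factor is at
least half of `size`, since non-resonance excludes that all frequencies vanish. In the proof q is n₁
and c is n₃. -/
theorem dph_lower {ε p a b : ℤ} (hε : ε = 1 ∨ ε = -1) (h : Nonres ε p a b) :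
    |((a - b : ℤ) : ℝ)| * |((p - (if ε = 1 then a else b) : ℤ) : ℝ)| * (size ε p a b / 2) ≤
      |((dph ε p a b : ℤ) : ℝ)| := by
  obtain ⟨h1, h2⟩ := h
  have key : ∀ q c : ℤ, 1 ≤ (q ^ 2 + a ^ 2 + b ^ 2 + p ^ 2) → 
      |((a - b : ℤ) : ℝ)| * |((p - c : ℤ) : ℝ)| * 
        ((1 + (q : ℝ) ^ 2 + (a : ℝ) ^ 2 + (b : ℝ) ^ 2 + (p : ℝ) ^ 2) / 2) ≤ 
      |((a - b : ℤ) : ℝ)| * |((p - c : ℤ) : ℝ)| * 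
        |(q : ℝ) ^ 2 + (a : ℝ) ^ 2 + (b : ℝ) ^ 2 + (p : ℝ) ^ 2 + 2 * ((q : ℝ) + c) ^ 2| := by
    intro q c h
    have h' : (1 : ℝ) ≤ (q ^ 2 + a ^ 2 + b ^ 2 + p ^ 2) := by exact_mod_cast h
    rw [abs_of_nonneg (a := _ + 2 * ((q : ℝ) + c) ^ 2) (by positivity)]
    gcongr
    nlinarith [sq_nonneg ((q : ℝ) + c)]
  have hab : 1 ≤ a ^ 2 + b ^ 2 := by
    by_contra! hc
    have ha : a = 0 := by nlinarith [sq_nonneg a, sq_nonneg b]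
    have hb : b = 0 := by nlinarith [sq_nonneg a, sq_nonneg b]
    exact h1 (ha.trans hb.symm)
  rcases hε with rfl | rfl
  · refine (key _ _ (by nlinarith [sq_nonneg (p - 1 * (a - b)), sq_nonneg p])).trans (le_of_eq ?_)
    rw [← abs_mul, ← abs_mul, dph, ← abs_neg]
    congr 1
    push_cast
    ring
  · refine (key _ _ (by nlinarith [sq_nonneg (p - (-1) * (a - b)), sq_nonneg p])).trans
      (le_of_eq ?_)
    rw [← abs_mul, ← abs_mul, dph, ← abs_neg]
    congr 1
    rw [if_neg (by norm_num)]
    push_cast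
    ring

open Classical in
/-- The kernel `|φ|^{-θ}` restricted to the non-resonant set. -/
def tau (θ : ℝ) (ε p a b : ℤ) : ℝ≥0∞ :=
  if Nonres ε p a b then ENNReal.ofReal (|((dph ε p a b : ℤ) : ℝ)| ^ (-θ)) else 0

theorem one_le_size (ε p a b : ℤ) : 1 ≤ size ε p a b := by
  unfold size
  nlinarith [sq_nonneg ((p - ε * (a - b) : ℤ) : ℝ), sq_nonneg (a : ℝ), sq_nonneg (b : ℝ),
    sq_nonneg (p : ℝ)]

theorem weight_le_rpow {r Q : ℝ} (hr : 0 ≤ r) {n : ℤ} (h : 1 + (n : ℝ) ^ 2 ≤ Q) :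
    weight r n ≤ Q ^ r :=
  Real.rpow_le_rpow (base_pos n).le h hr

/-- With A, C the two differences and Q the squared largest frequency, the weights cost Q^R and the
phase gains (ACQ)^{-2θ}. As R ≤ 2θ, the remaining negative power of Q can be traded for one of AC/2
≤ Q. This leaves (AC)^{-(4θ-R)}, summable in both differences once 4θ - R > 1. -/
theorem weighted_kernel_le {θ R ρ₀ ρ₁ ρ₂ ρ₃ : ℝ} (hθ : 0 ≤ θ) (hR : R ≤ 2 * θ) (h₁ : ρ₁ ≤ 0)
    (h₂ : ρ₂ ≤ 0) (h₃ : ρ₃ ≤ 0) (hs : max ρ₀ 0 - ρ₁ - ρ₂ - ρ₃ ≤ R) {ε p a b : ℤ}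
    (hε : ε = 1 ∨ ε = -1) (h : Nonres ε p a b) :
    (|((dph ε p a b : ℤ) : ℝ)| ^ (-θ)) ^ 2 * (weight ρ₀ p *
      (weight (-ρ₁) (p - ε * (a - b)) * weight (-ρ₂) a * weight (-ρ₃) b)) ≤
    2 ^ (4 * θ - R) * (|((a - b : ℤ) : ℝ)| ^ (-(4 * θ - R)) *
      |((p - (if ε = 1 then a else b) : ℤ) : ℝ)| ^ (-(4 * θ - R))) := by
  have hl := dph_lower hε h
  have hQ := one_le_size ε p a b
  set Q := size ε p a b with hQdef
  have hpos : ∀ n : ℤ, n ≠ 0 → 0 < |(n : ℝ)| := fun n hn => abs_pos.2 (by exact_mod_cast hn)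
  have hA := hpos _ (sub_ne_zero.2 h.1)
  have hB := hpos _ (sub_ne_zero.2 h.2)
  set A := |((a - b : ℤ) : ℝ)| with hAdef
  set C := |((p - (if ε = 1 then a else b) : ℤ) : ℝ)| with hCdef
  have hAQ : A ^ 2 ≤ 2 * Q := by
    rw [hAdef, hQdef, size, sq_abs]; push_cast
    nlinarith [sq_nonneg ((a : ℝ) + b), sq_nonneg ((p : ℝ) - ε * (a - b)), sq_nonneg (p : ℝ)]
  have hCQ : C ^ 2 ≤ 2 * Q := by
    rw [hCdef, hQdef, size, sq_abs]
    split_ifs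
    · push_cast
      nlinarith [sq_nonneg ((a : ℝ) + p), sq_nonneg ((p : ℝ) - ε * (a - b)), sq_nonneg (b : ℝ)]
    · push_cast
      nlinarith [sq_nonneg ((b : ℝ) + p), sq_nonneg ((p : ℝ) - ε * (a - b)), sq_nonneg (a : ℝ)]
  have hACQ : A * C / 2 ≤ Q := by nlinarith [sq_nonneg (A - C)]
  have hQ0 : 0 < Q := by linarith
  have hw : weight ρ₀ p *
      (weight (-ρ₁) (p - ε * (a - b)) * weight (-ρ₂) a * weight (-ρ₃) b) ≤ Q ^ R := by
    have e : Q ^ (max ρ₀ 0) * (Q ^ (-ρ₁) * Q ^ (-ρ₂) * Q ^ (-ρ₃)) =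
        Q ^ (max ρ₀ 0 - ρ₁ - ρ₂ - ρ₃) := by
      rw [← Real.rpow_add hQ0, ← Real.rpow_add hQ0, ← Real.rpow_add hQ0]; congr 1; ring
    refine le_trans ?_ (Real.rpow_le_rpow_of_exponent_le hQ hs)
    rw [← e]
    have w0 : weight ρ₀ p ≤ Q ^ (max ρ₀ 0) :=
      (weight_mono (le_max_left _ _) p).trans (weight_le_rpow (le_max_right _ _) (by
        rw [hQdef, size]
        nlinarith [sq_nonneg ((p - ε * (a - b) : ℤ) : ℝ), sq_nonneg (a : ℝ), sq_nonneg (b : ℝ)]))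
    have w1 : weight (-ρ₁) (p - ε * (a - b)) ≤ Q ^ (-ρ₁) := weight_le_rpow (by linarith) (by
        rw [hQdef, size]
        nlinarith [sq_nonneg (p : ℝ), sq_nonneg (a : ℝ), sq_nonneg (b : ℝ)])
    have w2 : weight (-ρ₂) a ≤ Q ^ (-ρ₂) := weight_le_rpow (by linarith) (by
        rw [hQdef, size]
        nlinarith [sq_nonneg (p : ℝ), sq_nonneg ((p - ε * (a - b) : ℤ) : ℝ), sq_nonneg (b : ℝ)])
    have w3 : weight (-ρ₃) b ≤ Q ^ (-ρ₃) := weight_le_rpow (by linarith) (by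
        rw [hQdef, size]
        nlinarith [sq_nonneg (p : ℝ), sq_nonneg ((p - ε * (a - b) : ℤ) : ℝ), sq_nonneg (a : ℝ)])
    have := weight_nonneg
    gcongr <;> apply_rules [mul_nonneg, Real.rpow_nonneg, weight_nonneg]
  have hph : (|((dph ε p a b : ℤ) : ℝ)| ^ (-θ)) ^ 2 ≤ (A * C * (Q / 2)) ^ (-(2 * θ)) := by
    rw [← Real.rpow_natCast, ← Real.rpow_mul (abs_nonneg _),
      show -θ * ((2 : ℕ) : ℝ) = -(2 * θ) by push_cast; ring]
    exact Real.rpow_le_rpow_of_nonpos (by positivity) hl (by linarith)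
  calc _ ≤ (A * C * (Q / 2)) ^ (-(2 * θ)) * Q ^ R := by
        gcongr
        apply_rules [mul_nonneg, weight_nonneg]
    _ = (A * C / 2) ^ (-(2 * θ)) * Q ^ (R - 2 * θ) := by
        rw [show A * C * (Q / 2) = A * C / 2 * Q by ring, Real.mul_rpow (by positivity) hQ0.le,
          mul_assoc, ← Real.rpow_add hQ0]; congr 2; ring
    _ ≤ (A * C / 2) ^ (-(2 * θ)) * (A * C / 2) ^ (R - 2 * θ) := by
        refine mul_le_mul_of_nonneg_left ?_ (by positivity)
        exact Real.rpow_le_rpow_of_nonpos (by positivity) hACQ (by linarith)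
    _ = _ := by
        rw [← Real.rpow_add (by positivity), show -(2 * θ) + (R - 2 * θ) = -(4 * θ - R) by ring,
          Real.div_rpow (by positivity) (by norm_num), Real.mul_rpow hA.le hB.le,
          Real.rpow_neg (by norm_num : (0:ℝ) ≤ 2), div_inv_eq_mul, mul_comm]

/-- The non-resonant trilinear estimate with a gain of `|φ|^{-θ}`. -/
theorem tri_tau_le {θ R : ℝ} (hθ : 0 ≤ θ) (hR : R ≤ 2 * θ) (hR' : 1 < 4 * θ - R) :
    ∃ B : ℝ≥0, ∀ (ε : ℤ), (ε = 1 ∨ ε = -1) → ∀ ρ₀ ρ₁ ρ₂ ρ₃ : ℝ, ρ₁ ≤ 0 → ρ₂ ≤ 0 → ρ₃ ≤ 0 →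
      max ρ₀ 0 - ρ₁ - ρ₂ - ρ₃ ≤ R → ∀ F G H : ℤ → ℝ≥0∞,
      nrm ρ₀ (tri ε (tau θ ε) F G H) ≤ B * (nrm ρ₁ F * nrm ρ₂ G * nrm ρ₃ H) := by
  set γ := 4 * θ - R with hγ
  set g : ℤ → ℝ≥0∞ := fun n => ENNReal.ofReal (|(n : ℝ)| ^ (-γ)) with hg
  have hZ : ∑' n, g n ≠ ⊤ := (Real.summable_abs_int_rpow hR').tsum_ofReal_ne_top
  set S : ℝ≥0∞ := ENNReal.ofReal (2 ^ γ) * ((∑' n, g n) * ∑' n, g n) with hS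
  have hStop : S ≠ ⊤ := ENNReal.mul_ne_top ENNReal.ofReal_ne_top (ENNReal.mul_ne_top hZ hZ)
  refine ⟨(S ^ (1 / 2 : ℝ)).toNNReal, fun ε hε ρ₀ ρ₁ ρ₂ ρ₃ h₁ h₂ h₃ hs F G H => ?_⟩
  rw [ENNReal.coe_toNNReal (ENNReal.rpow_ne_top_of_nonneg (by norm_num) hStop)]
  refine tri_le (fun p => ?_) F G H
  rw [show (S ^ (1 / 2 : ℝ)) ^ 2 = S by
    rw [← ENNReal.rpow_natCast, ← ENNReal.rpow_mul]; norm_num]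
  have hle : ∀ z : ℤ × ℤ, (tau θ ε p z.1 z.2 * W ρ₀ p * (W (-ρ₁) (p - ε * (z.1 - z.2)) *
      W (-ρ₂) z.1 * W (-ρ₃) z.2)) ^ 2 ≤ ENNReal.ofReal (2 ^ γ) *
        (g (z.1 - z.2) * g (p - if ε = 1 then z.1 else z.2)) := by
    rintro ⟨a, b⟩
    by_cases h : Nonres ε p a b
    · simp only [tau, if_pos h, mul_pow, W_sq]
      have := weighted_kernel_le hθ hR h₁ h₂ h₃ hs hε h
      rw [hg]
      simp only
      rw [← ENNReal.ofReal_pow (by positivity), ← ENNReal.ofReal_mul (by positivity),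
        ← ENNReal.ofReal_mul (weight_nonneg _ _),
        ← ENNReal.ofReal_mul (mul_nonneg (weight_nonneg _ _) (weight_nonneg _ _)),
        ← ENNReal.ofReal_mul (mul_nonneg (by positivity) (weight_nonneg _ _)),
        ← ENNReal.ofReal_mul (by positivity), ← ENNReal.ofReal_mul (by positivity)]
      refine ENNReal.ofReal_le_ofReal ?_
      rw [mul_assoc]
      exact this
    · simp [tau, h]
  refine (ENNReal.tsum_le_tsum hle).trans ?_
  rw [ENNReal.tsum_mul_left, hS]
  gcongr
  rw [ENNReal.tsum_prod']
  -- The sign decides whether a or b occurs in the second difference. The other variable has to be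
  -- summed first.
  by_cases h1 : ε = 1
  · simp only [h1, if_true]
    have : ∀ a : ℤ, ∑' b : ℤ, g (a - b) * g (p - a) = (∑' n, g n) * g (p - a) := fun a => by
      rw [ENNReal.tsum_mul_right, ← (Equiv.subLeft a).tsum_eq g]; rfl
    rw [tsum_congr this, ENNReal.tsum_mul_left, ← (Equiv.subLeft p).tsum_eq g]; rfl
  · simp only [h1, if_false]
    rw [ENNReal.tsum_comm]
    have : ∀ b : ℤ, ∑' a : ℤ, g (a - b) * g (p - b) = (∑' n, g n) * g (p - b) := fun b => by
      rw [ENNReal.tsum_mul_right, ← (Equiv.subRight b).tsum_eq g]; rfl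
    rw [tsum_congr this, ENNReal.tsum_mul_left, ← (Equiv.subLeft p).tsum_eq g]; rfl

/-- The resonant trilinear estimate. -/
theorem nrm_mul_mul_le (ρ₁ ρ₂ ρ₃ : ℝ) (F G H : ℤ → ℝ≥0∞) :
    nrm (ρ₁ + ρ₂ + ρ₃) (fun p => F p * G p * H p) ≤ nrm ρ₁ F * nrm ρ₂ G * nrm ρ₃ H := by
  refine le_of_sq_le_sq ?_
  rw [nrm_sq, mul_pow, mul_pow, nrm_sq ρ₁ F, mul_assoc, ← mul_pow, ← ENNReal.tsum_mul_right]
  refine ENNReal.tsum_le_tsum fun n => ?_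
  rw [← W_mul, ← W_mul, ← mul_pow]
  refine pow_le_pow_left' ?_ 2
  -- One factor stays in ℓ²; the other two are bounded pointwise by their ℓ² norms.
  calc W ρ₁ n * W ρ₂ n * W ρ₃ n * (F n * G n * H n)
      = W ρ₁ n * F n * ((W ρ₂ n * G n) * (W ρ₃ n * H n)) := by ring
    _ ≤ _ := by gcongr <;> exact W_mul_le_nrm _ _ _

/-- `H^r` is an algebra for `r > 1/2`. -/
theorem tri_one_le {r : ℝ} (hr : 1 / 2 < r) : ∃ B : ℝ≥0, ∀ (ε : ℤ), (ε = 1 ∨ ε = -1) →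
    ∀ F G H : ℤ → ℝ≥0∞,
      nrm r (tri ε (fun _ _ _ => 1) F G H) ≤ B * (nrm r F * nrm r G * nrm r H) := by
  set g : ℤ → ℝ≥0∞ := fun n => ENNReal.ofReal (weight (-r) n) with hg
  have hZ : ∑' n, g n ≠ ⊤ := by
    refine Summable.tsum_ofReal_ne_top ?_
    rw [← summable_norm_iff]
    have h1 : Summable fun n : ℤ => |(n : ℝ)| ^ (-(2 * r)) + if n = 0 then (1 : ℝ) else 0 :=
      (Real.summable_abs_int_rpow (by linarith)).add (summable_of_hasFiniteSupport
        ((Set.finite_singleton (0 : ℤ)).subset fun n hn => by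
          by_contra h; simp at h; simp [h] at hn))
    refine h1.of_nonneg_of_le (fun _ => norm_nonneg _) fun n => ?_
    rw [Real.norm_of_nonneg (weight_nonneg _ _)]
    by_cases hn : n = 0
    · simp [hn, weight, Real.zero_rpow (show -(2 * r) ≠ 0 by linarith)]
    · simp only [hn, if_false, add_zero]
      have hn' : 0 < |(n : ℝ)| := abs_pos.2 (by exact_mod_cast hn)
      calc weight (-r) n ≤ (|(n : ℝ)| ^ 2) ^ (-r) :=
            Real.rpow_le_rpow_of_nonpos (by positivity) (by rw [sq_abs]; linarith) (by linarith)
        _ = |(n : ℝ)| ^ (-(2 * r)) := by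
            rw [← Real.rpow_natCast, ← Real.rpow_mul (abs_nonneg _)]; congr 1; push_cast; ring
  set K : ℝ≥0∞ := ENNReal.ofReal (9 ^ r) with hK
  set S : ℝ≥0∞ := K * (3 * ((∑' n, g n) * ∑' n, g n)) with hS
  have hStop : S ≠ ⊤ := ENNReal.mul_ne_top ENNReal.ofReal_ne_top
    (ENNReal.mul_ne_top (by norm_num) (ENNReal.mul_ne_top hZ hZ))
  refine ⟨(S ^ (1 / 2 : ℝ)).toNNReal, fun ε hε F G H => ?_⟩
  rw [ENNReal.coe_toNNReal (ENNReal.rpow_ne_top_of_nonneg (by norm_num) hStop)]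
  refine tri_le (fun p => ?_) F G H
  rw [show (S ^ (1 / 2 : ℝ)) ^ 2 = S by
    rw [← ENNReal.rpow_natCast, ← ENNReal.rpow_mul]; norm_num]
  have hle : ∀ z : ℤ × ℤ, (1 * W r p * (W (-r) (p - ε * (z.1 - z.2)) *
      W (-r) z.1 * W (-r) z.2)) ^ 2 ≤ K * (g z.1 * g z.2 + g (p - ε * (z.1 - z.2)) * g z.2 +
        g (p - ε * (z.1 - z.2)) * g z.1) := by
    rintro ⟨a, b⟩
    simp only [one_mul, mul_pow, W_sq, hg, hK]
    set q := p - ε * (a - b) with hq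
    -- The output frequency is a signed sum of three others, so p² is at most 3 times the sum of
    -- their squares, hence 9 times the largest. The weight at p then cancels the inverse weight of
    -- the dominant input, and the other two are summable.
    have hp : 1 + (p : ℝ) ^ 2 ≤ 9 * max (1 + (q : ℝ) ^ 2) (max (1 + (a : ℝ) ^ 2) (1 + (b : ℝ) ^ 2)) := by
      have e : (p : ℝ) ^ 2 ≤ 3 * ((q : ℝ) ^ 2 + a ^ 2 + b ^ 2) := by
        have : (p : ℝ) = q + ε * (a - b) := by rw [hq]; push_cast; ring
        rw [this]
        rcases hε with h | h <;> rw [h] <;> push_cast <;>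
          nlinarith [sq_nonneg ((q : ℝ) - a), sq_nonneg ((q : ℝ) + b), sq_nonneg ((a : ℝ) + b),
            sq_nonneg ((q : ℝ) + a), sq_nonneg ((q : ℝ) - b)]
      have m1 := le_max_left (1 + (q : ℝ) ^ 2) (max (1 + (a : ℝ) ^ 2) (1 + (b : ℝ) ^ 2))
      have m2 := (le_max_left (1 + (a : ℝ) ^ 2) (1 + (b : ℝ) ^ 2)).trans
        (le_max_right (1 + (q : ℝ) ^ 2) _)
      have m3 := (le_max_right (1 + (a : ℝ) ^ 2) (1 + (b : ℝ) ^ 2)).trans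
        (le_max_right (1 + (q : ℝ) ^ 2) _)
      linarith
    have hr0 : 0 ≤ r := by linarith
    have hw : weight r p ≤ 9 ^ r * (weight r q + weight r a + weight r b) := by
      have key : ∀ n : ℤ, 1 + (p : ℝ) ^ 2 ≤ 9 * (1 + (n : ℝ) ^ 2) →
          weight r p ≤ 9 ^ r * weight r n := fun n hn => by
        rw [weight, weight, ← Real.mul_rpow (by norm_num) (base_pos n).le]
        exact Real.rpow_le_rpow (base_pos p).le hn hr0
      have n1 := weight_nonneg r q
      have n2 := weight_nonneg r a
      have n3 := weight_nonneg r b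
      have n9 : (0 : ℝ) < 9 ^ r := by positivity
      rcases max_choice (1 + (q : ℝ) ^ 2) (max (1 + (a : ℝ) ^ 2) (1 + (b : ℝ) ^ 2)) with h | h
      · rw [h] at hp; nlinarith [key q hp]
      · rw [h] at hp
        rcases max_choice (1 + (a : ℝ) ^ 2) (1 + (b : ℝ) ^ 2) with h | h
        · rw [h] at hp; nlinarith [key a hp]
        · rw [h] at hp; nlinarith [key b hp]
    have e : ∀ n : ℤ, weight r n * weight (-r) n = 1 := fun n => by
      rw [weight_mul]; simp [weight]
    have hfin : weight r p * (weight (-r) q * weight (-r) a * weight (-r) b) ≤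
        9 ^ r * (weight (-r) a * weight (-r) b + weight (-r) q * weight (-r) b +
          weight (-r) q * weight (-r) a) := by
      calc _ ≤ 9 ^ r * (weight r q + weight r a + weight r b) *
            (weight (-r) q * weight (-r) a * weight (-r) b) := by
              refine mul_le_mul_of_nonneg_right hw ?_
              apply_rules [mul_nonneg, weight_nonneg]
        _ = 9 ^ r * ((weight r q * weight (-r) q) * (weight (-r) a * weight (-r) b) +
            (weight r a * weight (-r) a) * (weight (-r) q * weight (-r) b) +
            (weight r b * weight (-r) b) * (weight (-r) q * weight (-r) a)) := by ring
        _ = _ := by rw [e, e, e]; ring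
    have nn := weight_nonneg (-r)
    have nnm : ∀ x y, 0 ≤ weight (-r) x * weight (-r) y := fun x y => mul_nonneg (nn x) (nn y)
    rw [← ENNReal.ofReal_mul (nn _), ← ENNReal.ofReal_mul (nnm _ _),
      ← ENNReal.ofReal_mul (weight_nonneg _ _), ← ENNReal.ofReal_mul (nn _),
      ← ENNReal.ofReal_mul (nn _),
      ← ENNReal.ofReal_add (nnm _ _) (nnm _ _),
      ← ENNReal.ofReal_add (add_nonneg (nnm _ _) (nnm _ _)) (nnm _ _),
      ← ENNReal.ofReal_mul (by positivity)]
    exact ENNReal.ofReal_le_ofReal hfin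
  refine (ENNReal.tsum_le_tsum hle).trans ?_
  rw [ENNReal.tsum_mul_left, hS]
  gcongr
  rw [ENNReal.tsum_add, ENNReal.tsum_add]
  set Z := ∑' n, g n with hZdef
  have inj : ∀ c : ℤ, ∑' n, g (c - n) = Z := fun c => (Equiv.subLeft c).tsum_eq g
  have inj' : ∀ c : ℤ, ∑' n, g (n + c) = Z := fun c => (Equiv.addRight c).tsum_eq g
  have q1 : ∀ b : ℤ, ∑' a : ℤ, g (p - ε * (a - b)) = Z := fun b => by
    rcases hε with h | h
    · rw [← inj (p + b)]; exact tsum_congr fun a => by rw [h]; congr 1; ring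
    · rw [← inj' (p - b)]; exact tsum_congr fun a => by rw [h]; congr 1; ring
  have q2 : ∀ a : ℤ, ∑' b : ℤ, g (p - ε * (a - b)) = Z := fun a => by
    rcases hε with h | h
    · rw [← inj' (p - a)]; exact tsum_congr fun b => by rw [h]; congr 1; ring
    · rw [← inj (p + a)]; exact tsum_congr fun b => by rw [h]; congr 1; ring
  have s1 : ∑' z : ℤ × ℤ, g z.1 * g z.2 = Z * Z := by
    rw [ENNReal.tsum_prod']
    simp only [ENNReal.tsum_mul_left, ENNReal.tsum_mul_right]; rfl
  have s2 : ∑' z : ℤ × ℤ, g (p - ε * (z.1 - z.2)) * g z.2 = Z * Z := by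
    rw [ENNReal.tsum_prod', ENNReal.tsum_comm]
    simp only [ENNReal.tsum_mul_left, ENNReal.tsum_mul_right, q1]; rfl
  have s3 : ∑' z : ℤ × ℤ, g (p - ε * (z.1 - z.2)) * g z.1 = Z * Z := by
    rw [ENNReal.tsum_prod']
    simp only [ENNReal.tsum_mul_left, ENNReal.tsum_mul_right, q2]; rfl
  rw [s1, s2, s3]
  exact le_of_eq (by ring)

/-! ### Kernels and grafting

The slot `k` of a form carries `v` if `k` is even and its complex conjugate if `k` is odd. -/

/-- The sign carried by the slot `k`. -/
def sg {n : ℕ} (k : Fin n) : ℤ := (-1) ^ (k : ℕ)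

theorem sg_cases {n : ℕ} (k : Fin n) : sg k = 1 ∨ sg k = -1 := neg_one_pow_eq_or ℤ _

/-- Two new slots in front, one without and one with conjugation, shift the old slots by two and
leave their conjugations unchanged. -/
theorem sg_succ_succ {n : ℕ} (k : Fin n) : sg k.succ.succ = sg k := by
  simp [sg, pow_succ]

/-- The phase of a tuple of frequencies. -/
def Phi {n : ℕ} (x : Fin n → ℤ) : ℤ := ∑ k, sg k * x k ^ 4

/-- Replacing the frequency in slot `k` by three frequencies; the two new slots are put in
front. -/
def child {n : ℕ} (k : Fin n) : (Fin n → ℤ) × ℤ × ℤ ≃ (Fin (n + 2) → ℤ) where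
  toFun z := Fin.cons (α := fun _ => ℤ) z.2.1 (Fin.cons (α := fun _ => ℤ) z.2.2
    (Function.update z.1 k (z.1 k - sg k * (z.2.1 - z.2.2))))
  invFun y := (Function.update (fun i => y i.succ.succ) k
    (y k.succ.succ + sg k * (y 0 - y 1)), y 0, y 1)
  left_inv z := by
    obtain ⟨x, a, b⟩ := z
    change (Function.update (Function.update x k (x k - sg k * (a - b))) k
      (Function.update x k (x k - sg k * (a - b)) k + sg k * (a - b)), a, b) = (x, a, b)
    rw [Function.update_self, Function.update_idem, sub_add_cancel, Function.update_eq_self]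
  right_inv y := by
    ext i
    refine Fin.cases rfl (fun i => ?_) i
    refine Fin.cases rfl (fun i => ?_) i
    by_cases h : i = k
    · subst h; simp
    · simp

theorem child_zero {n : ℕ} (k : Fin n) (x : Fin n → ℤ) (a b : ℤ) : child k (x, a, b) 0 = a := rfl

theorem child_one {n : ℕ} (k : Fin n) (x : Fin n → ℤ) (a b : ℤ) : child k (x, a, b) 1 = b := rfl

theorem child_succ_succ {n : ℕ} (k i : Fin n) (x : Fin n → ℤ) (a b : ℤ) :
    child k (x, a, b) i.succ.succ = Function.update x k (x k - sg k * (a - b)) i := rfl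

theorem prod_child {M : Type*} [CommMonoid M] {n : ℕ} (F : Fin (n + 2) → ℤ → M) (k : Fin n)
    (x : Fin n → ℤ) (a b : ℤ) :
    ∏ i, F i (child k (x, a, b) i) = F k.succ.succ (x k - sg k * (a - b)) * F 0 a * F 1 b *
      ∏ i ∈ Finset.univ.erase k, F i.succ.succ (x i) := by
  rw [Fin.prod_univ_succ, Fin.prod_univ_succ, child_zero]
  have h1 : ∏ i : Fin n, F i.succ.succ (child k (x, a, b) i.succ.succ) =
      F k.succ.succ (x k - sg k * (a - b)) *
        ∏ i ∈ Finset.univ.erase k, F i.succ.succ (x i) := by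
    rw [← Finset.mul_prod_erase _ _ (Finset.mem_univ k)]
    congr 1
    · rw [child_succ_succ, Function.update_self]
    · refine Finset.prod_congr rfl fun i hi => ?_
      rw [child_succ_succ, Function.update_of_ne (Finset.ne_of_mem_erase hi)]
  rw [h1, show (Fin.succ 0 : Fin (n + 2)) = 1 from rfl, child_one]
  simp only [mul_assoc, mul_left_comm]

/-- Phases add under grafting. The exponential of a form times that of the nonlinearity is therefore
the exponential of the grafted form. -/
theorem Phi_child {n : ℕ} (k : Fin n) (x : Fin n → ℤ) (a b : ℤ) :
    Phi (child k (x, a, b)) = Phi x + dph (sg k) (x k) a b := by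
  rw [Phi, Fin.sum_univ_succ, Fin.sum_univ_succ, child_zero, show (Fin.succ 0 : Fin (n + 2)) = 1
    from rfl, child_one, Phi]
  have h1 : ∑ i : Fin n, sg i.succ.succ * (child k (x, a, b) i.succ.succ) ^ 4 =
      ∑ i, sg i * x i ^ 4 + sg k * ((x k - sg k * (a - b)) ^ 4 - x k ^ 4) := by
    rw [← Finset.add_sum_erase _ _ (Finset.mem_univ k),
      ← Finset.add_sum_erase _ _ (Finset.mem_univ k), child_succ_succ, Function.update_self,
      sg_succ_succ]
    have : ∑ i ∈ Finset.univ.erase k, sg i.succ.succ * (child k (x, a, b) i.succ.succ) ^ 4 =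
        ∑ i ∈ Finset.univ.erase k, sg i * x i ^ 4 :=
      Finset.sum_congr rfl fun i hi => by
        rw [child_succ_succ, Function.update_of_ne (Finset.ne_of_mem_erase hi), sg_succ_succ]
    rw [this]; ring
  have h2 : ((0 : Fin (n + 2)) : ℕ) = 0 := rfl
  have h3 : ((1 : Fin (n + 2)) : ℕ) = 1 := rfl
  rw [h1, dph, sg, sg, h2, h3]; ring

/-- The sum over all `k` of the kernels that arise from `K` by replacing the frequency in slot `k`
by three frequencies, with weight `χ k`. -/
def graft {n : ℕ} (K : (Fin n → ℤ) → ℝ) (χ : Fin n → (Fin n → ℤ) → ℤ → ℤ → ℝ)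
    (y : Fin (n + 2) → ℤ) : ℝ :=
  ∑ k, K ((child k).symm y).1 *
    χ k ((child k).symm y).1 ((child k).symm y).2.1 ((child k).symm y).2.2

/-- The absolute form with kernel `K`. -/
def absForm {n : ℕ} (K : (Fin n → ℤ) → ℝ) (F : Fin n → ℤ → ℝ≥0∞) : ℝ≥0∞ :=
  ∑' x, ‖K x‖ₑ * ∏ k, F k (x k)

theorem absForm_update {n : ℕ} (K : (Fin n → ℤ) → ℝ) (k : Fin n) (F : Fin n → ℤ → ℝ≥0∞)
    (G : ℤ → ℝ≥0∞) : absForm K (Function.update F k G) =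
      ∑' x, ‖K x‖ₑ * (G (x k) * ∏ i ∈ Finset.univ.erase k, F i (x i)) := by
  refine tsum_congr fun x => ?_
  rw [← Finset.mul_prod_erase _ _ (Finset.mem_univ k), Function.update_self]
  congr 2
  exact Finset.prod_congr rfl fun i hi => by
    rw [Function.update_of_ne (Finset.ne_of_mem_erase hi)]

/-- Summing the two new frequencies first turns them and the old slot into the output of a trilinear
operator, inserted in slot k of the parent form. -/
theorem tsum_child_eq {n : ℕ} (K : (Fin n → ℤ) → ℝ) (k : Fin n) (τ : ℤ → ℤ → ℤ → ℝ≥0∞)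
    (F : Fin (n + 2) → ℤ → ℝ≥0∞) :
    ∑' z : (Fin n → ℤ) × ℤ × ℤ, ‖K z.1‖ₑ * τ (z.1 k) z.2.1 z.2.2 * ∏ i, F i (child k z i) =
      absForm K (Function.update (fun i => F i.succ.succ) k
        (tri (sg k) τ (F k.succ.succ) (F 0) (F 1))) := by
  rw [absForm_update, ENNReal.tsum_prod']
  refine tsum_congr fun x => ?_
  rw [tri, ← ENNReal.tsum_mul_right, ← ENNReal.tsum_mul_left]
  refine tsum_congr fun z => ?_
  rw [show ((x, z) : (Fin n → ℤ) × ℤ × ℤ) = (x, z.1, z.2) from rfl, prod_child]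
  ring

theorem absForm_graft_le {n : ℕ} {K K' : (Fin n → ℤ) → ℝ}
    {χ : Fin n → (Fin n → ℤ) → ℤ → ℤ → ℝ} {τ : Fin n → ℤ → ℤ → ℤ → ℝ≥0∞}
    (h : ∀ k x a b, ‖K x * χ k x a b‖ₑ ≤ ‖K' x‖ₑ * τ k (x k) a b)
    (F : Fin (n + 2) → ℤ → ℝ≥0∞) :
    absForm (graft K χ) F ≤ ∑ k, absForm K' (Function.update (fun i => F i.succ.succ) k
      (tri (sg k) (τ k) (F k.succ.succ) (F 0) (F 1))) := by
  calc absForm (graft K χ) F ≤ ∑' y, ∑ k, ‖K ((child k).symm y).1 *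
        χ k ((child k).symm y).1 ((child k).symm y).2.1 ((child k).symm y).2.2‖ₑ *
        ∏ i, F i (y i) := by
        refine ENNReal.tsum_le_tsum fun y => ?_
        rw [← Finset.sum_mul]
        gcongr
        exact enorm_sum_le _ _
    _ = ∑ k, ∑' y, ‖K ((child k).symm y).1 *
        χ k ((child k).symm y).1 ((child k).symm y).2.1 ((child k).symm y).2.2‖ₑ *
        ∏ i, F i (y i) := Summable.tsum_finsetSum fun _ _ => ENNReal.summable
    _ ≤ _ := by
        refine Finset.sum_le_sum fun k _ => ?_
        rw [← tsum_child_eq, ← (child k).tsum_eq]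
        refine ENNReal.tsum_le_tsum fun z => ?_
        rw [Equiv.symm_apply_apply]
        gcongr
        exact h _ _ _ _

/-- The absolute form with kernel `K` is bounded on `H^{ρ 0} × H^{ρ 1} × ⋯`. -/
def Bdd {n : ℕ} (K : (Fin n → ℤ) → ℝ) (ρ : Fin n → ℝ) (C : ℝ≥0) : Prop :=
  ∀ F, absForm K F ≤ C * ∏ k, nrm (ρ k) (F k)

theorem Bdd.mono {n : ℕ} {K K' : (Fin n → ℤ) → ℝ} {ρ ρ' : Fin n → ℝ} {C C' : ℝ≥0}
    (h : Bdd K ρ C) (hK : ∀ x, |K' x| ≤ |K x|) (hρ : ∀ k, ρ k ≤ ρ' k) (hC : C ≤ C') :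
    Bdd K' ρ' C' := by
  intro F
  calc absForm K' F ≤ absForm K F := by
        refine ENNReal.tsum_le_tsum fun x => ?_
        gcongr
        exact enorm_le_iff_norm_le.2 (hK x)
    _ ≤ _ := (h F).trans ?_
  gcongr with k
  exact nrm_mono_exp (hρ k) _

/-- The factor n counts the slots. The majorant K' may differ from K, so that powers of the phase
can be moved between the parent kernel and the trilinear operator; t k is the regularity in which
the operator hands its output to the parent. -/
theorem Bdd.graft {n : ℕ} {K K' : (Fin n → ℤ) → ℝ}
    {χ : Fin n → (Fin n → ℤ) → ℤ → ℤ → ℝ} {τ : Fin n → ℤ → ℤ → ℤ → ℝ≥0∞}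
    (h : ∀ k x a b, ‖K x * χ k x a b‖ₑ ≤ ‖K' x‖ₑ * τ k (x k) a b)
    {ρ : Fin (n + 2) → ℝ} {t : Fin n → ℝ} {C B : ℝ≥0}
    (hK : ∀ k, Bdd K' (Function.update (fun i => ρ i.succ.succ) k (t k)) C)
    (hT : ∀ k F G H, nrm (t k) (tri (sg k) (τ k) F G H) ≤
      B * (nrm (ρ k.succ.succ) F * nrm (ρ 0) G * nrm (ρ 1) H)) :
    Bdd (graft K χ) ρ (n * C * B) := by
  intro F
  refine (absForm_graft_le h F).trans ?_
  have key : ∀ k ∈ Finset.univ, absForm K' (Function.update (fun i => F i.succ.succ) k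
      (tri (sg k) (τ k) (F k.succ.succ) (F 0) (F 1))) ≤ C * B * ∏ i, nrm (ρ i) (F i) := by
    intro k _
    refine (hK k _).trans ?_
    rw [mul_assoc]
    gcongr
    rw [← Finset.mul_prod_erase _ _ (Finset.mem_univ k), Function.update_self,
      Function.update_self]
    have e : ∏ i ∈ Finset.univ.erase k, nrm (Function.update (fun i => ρ i.succ.succ) k (t k) i)
        (Function.update (fun i => F i.succ.succ) k
          (tri (sg k) (τ k) (F k.succ.succ) (F 0) (F 1)) i) =
        ∏ i ∈ Finset.univ.erase k, nrm (ρ i.succ.succ) (F i.succ.succ) :=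
      Finset.prod_congr rfl fun i hi => by
        rw [Function.update_of_ne (Finset.ne_of_mem_erase hi),
          Function.update_of_ne (Finset.ne_of_mem_erase hi)]
    rw [e, Fin.prod_univ_succ, Fin.prod_univ_succ,
      ← Finset.mul_prod_erase _ _ (Finset.mem_univ k)]
    calc _ ≤ B * (nrm (ρ k.succ.succ) (F k.succ.succ) * nrm (ρ 0) (F 0) * nrm (ρ 1) (F 1)) *
          ∏ i ∈ Finset.univ.erase k, nrm (ρ i.succ.succ) (F i.succ.succ) := by
          gcongr
          exact hT k _ _ _
      _ = _ := by
          rw [show (Fin.succ 0 : Fin (n + 2)) = 1 from rfl]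
          ring
  refine (Finset.sum_le_card_nsmul _ _ _ key).trans (le_of_eq ?_)
  simp only [Finset.card_univ, Fintype.card_fin, nsmul_eq_mul, ENNReal.coe_mul,
    ENNReal.coe_natCast]
  ring

theorem Bdd.const_mul {n : ℕ} {K : (Fin n → ℤ) → ℝ} {ρ : Fin n → ℝ} {C : ℝ≥0} (h : Bdd K ρ C)
    (c : ℝ≥0) : Bdd (fun x => c * K x) ρ (c * C) := by
  intro F
  have : absForm (fun x => (c : ℝ) * K x) F = c * absForm K F := by
    rw [absForm, absForm, ← ENNReal.tsum_mul_left]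
    refine tsum_congr fun x => ?_
    rw [enorm_mul, show ‖((c : ℝ≥0) : ℝ)‖ₑ = (c : ℝ≥0∞) by simp, mul_assoc]
  rw [this, ENNReal.coe_mul, mul_assoc]
  gcongr
  exact h F

theorem graft_mul {n : ℕ} (K : (Fin n → ℤ) → ℝ) (χ : Fin n → (Fin n → ℤ) → ℤ → ℤ → ℝ)
    (g : (Fin (n + 2) → ℤ) → ℝ) (y : Fin (n + 2) → ℤ) :
    graft K χ y * g y = graft K (fun k x a b => χ k x a b * g (child k (x, a, b))) y := by
  rw [graft, graft, Finset.sum_mul]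
  refine Finset.sum_congr rfl fun k _ => ?_
  rw [← mul_assoc, Equiv.apply_symm_apply]

/-! ### The kernels of the normal form expansion -/

section Kernels

variable (s : ℝ) (N : ℕ∞)

open Classical in
/-- The non-resonant part of the nonlinearity in slot `k`, restricted to the region where the new
phase is much larger than the old one. -/
def high {n : ℕ} (k : Fin n) (x : Fin n → ℤ) (a b : ℤ) : ℝ :=
  -- Only the output frequency is cut off here, because the coefficients of a solution vanish above
  -- the cutoff.
  if Nonres (sg k) (x k) a b ∧ ((x k).natAbs : ℕ∞) ≤ N ∧
    4 * |Phi x| < |Phi x + dph (sg k) (x k) a b| then -(sg k : ℝ) else 0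

open Classical in
/-- The non-resonant part of the nonlinearity in slot `k`, restricted to the region where the new
phase is not much larger than the old one. -/
def low {n : ℕ} (k : Fin n) (x : Fin n → ℤ) (a b : ℤ) : ℝ :=
  if Nonres (sg k) (x k) a b ∧ ((x k).natAbs : ℕ∞) ≤ N ∧
    |Phi x + dph (sg k) (x k) a b| ≤ 4 * |Phi x| then -(sg k : ℝ) else 0

open Classical in
/-- The resonant part of the nonlinearity in slot `k`. -/
def resn {n : ℕ} (k : Fin n) (x : Fin n → ℤ) (a b : ℤ) : ℝ :=
  if Res (x k) a b then (sg k : ℝ) else 0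

/-- The kernels of the boundary terms of the normal form expansion, starting from that of
`-½ ‖v‖²_{H^s}` for `j = 1`. -/
def L : (j : ℕ) → (Fin (2 * j) → ℤ) → ℝ
  | 0 => fun _ => 0
  | 1 => fun x : Fin 2 → ℤ => if x 0 = x 1 then -(weight s (x 0) / 2) else 0
  -- Division by a vanishing phase does no harm: the numerator is nonzero only where |Φ| strictly
  -- exceeds 4 times a parent phase.
  | j + 2 => fun y : Fin (2 * (j + 1) + 2) → ℤ => graft (L (j + 1)) (high N) y / (Phi y : ℝ)

theorem abs_sg {n : ℕ} (k : Fin n) : |(sg k : ℝ)| = 1 := by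
  rcases sg_cases k with h | h <;> rw [h] <;> norm_num

variable {N} in
theorem abs_high_le {n : ℕ} (k : Fin n) (x : Fin n → ℤ) (a b : ℤ) : |high N k x a b| ≤ 1 := by
  unfold high; split_ifs <;> simp [abs_sg]

variable {N} in
theorem abs_low_le {n : ℕ} (k : Fin n) (x : Fin n → ℤ) (a b : ℤ) : |low N k x a b| ≤ 1 := by
  unfold low; split_ifs <;> simp [abs_sg]

theorem abs_resn_le {n : ℕ} (k : Fin n) (x : Fin n → ℤ) (a b : ℤ) : |resn k x a b| ≤ 1 := by
  unfold resn; split_ifs <;> simp [abs_sg]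

theorem L_one_apply (x : Fin 2 → ℤ) :
    L s N 1 x = if x 0 = x 1 then -(weight s (x 0) / 2) else 0 := rfl

theorem L_add_two (j : ℕ) (y : Fin (2 * (j + 1) + 2) → ℤ) :
    L s N (j + 2) y = graft (L s N (j + 1)) (high N) y / (Phi y : ℝ) := by
  rw [L]

variable {s N}

theorem Phi_eq_zero_of_L_one {x : Fin 2 → ℤ} (h : L s N 1 x ≠ 0) : Phi x = 0 := by
  rw [L_one_apply] at h
  have h' : x 0 = x 1 := by
    by_contra h'; simp [h'] at h
  simp [Phi, Fin.sum_univ_two, sg, h']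

/-! ### Growth of the phase on the support of the kernels -/

theorem exists_of_graft_high_ne_zero {n : ℕ} {K : (Fin n → ℤ) → ℝ} {y : Fin (n + 2) → ℤ}
    (h : graft K (high N) y ≠ 0) : ∃ x, K x ≠ 0 ∧ 4 * |Phi x| < |Phi y| := by
  obtain ⟨k, -, hk⟩ := Finset.exists_ne_zero_of_sum_ne_zero h
  refine ⟨_, left_ne_zero_of_mul hk, ?_⟩
  have h2 := right_ne_zero_of_mul hk
  rw [high] at h2
  split_ifs at h2 with h3
  · have := h3.2.2
    rwa [← Phi_child, Equiv.apply_symm_apply] at this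
  · exact absurd rfl h2

/-- The first nonzero phase is an integer, so at least 1 in modulus, and each `high` step multiplies
it by more than 4. This growth is the source of the superexponential decay. -/
theorem pow_le_abs_Phi (j : ℕ) (y : Fin (2 * (j + 1) + 2) → ℤ) (h : L s N (j + 2) y ≠ 0) :
    4 ^ j ≤ |Phi y| := by
  induction j with
  | zero =>
    rw [L_add_two] at h
    obtain ⟨x, -, h2⟩ := exists_of_graft_high_ne_zero (div_ne_zero_iff.1 h).1
    have := abs_nonneg (Phi x)
    simp only [pow_zero]
    omega
  | succ j ih =>
    rw [L_add_two] at h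
    obtain ⟨x, h1, h2⟩ := exists_of_graft_high_ne_zero (div_ne_zero_iff.1 h).1
    have := ih x h1
    rw [pow_succ]
    omega

/-- The kernel of the `(j+1)`-st form before normal form reduction, divided by `|φ|^θ`. -/
def Q (s : ℝ) (N : ℕ∞) (θ : ℝ) (j : ℕ) (y : Fin (2 * j + 2) → ℤ) : ℝ :=
  graft (L s N j) (high N) y * |(Phi y : ℝ)| ^ (-θ)

theorem abs_L_eq (j : ℕ) (y : Fin (2 * (j + 1) + 2) → ℤ) :
    |L s N (j + 2) y| = |Q s N 1 (j + 1) y| := by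
  rw [L_add_two, Q, abs_div, abs_mul, Real.rpow_neg_one, abs_inv, abs_abs, div_eq_mul_inv]

/-- Differentiating the exponential of a boundary form gives back exactly the term that it was built
to remove. -/
theorem graft_high_eq (j : ℕ) (y : Fin (2 * (j + 1) + 2) → ℤ) :
    graft (L s N (j + 1)) (high N) y = L s N (j + 2) y * (Phi y : ℝ) := by
  rw [L_add_two]
  by_cases h : graft (L s N (j + 1)) (high N) y = 0
  · simp [h]
  · obtain ⟨x, -, h2⟩ := exists_of_graft_high_ne_zero h
    have : (Phi y : ℝ) ≠ 0 := by
      intro h0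
      have h0' : Phi y = 0 := by exact_mod_cast h0
      rw [h0', abs_zero] at h2
      have := abs_nonneg (Phi x)
      omega
    rw [div_mul_cancel₀ _ this]

theorem Q_eq_graft (θ : ℝ) (j : ℕ) : Q s N θ j = graft (L s N j) (fun k x a b =>
    high N k x a b * |((Phi x + dph (sg k) (x k) a b : ℤ) : ℝ)| ^ (-θ)) := by
  ext y
  rw [Q, graft_mul _ _ fun y => |(Phi y : ℝ)| ^ (-θ)]
  simp only [Phi_child]

theorem rpow_neg_le_of_le_mul {c u d θ : ℝ} (hc : 1 ≤ c) (hd : 0 < d) (h : d ≤ c * u)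
    (hθ : 0 ≤ θ) (hθ' : θ ≤ 1) : u ^ (-θ) ≤ c * d ^ (-θ) := by
  have hc0 : 0 < c := by linarith
  calc u ^ (-θ) ≤ (d / c) ^ (-θ) :=
        Real.rpow_le_rpow_of_nonpos (by positivity) (by rwa [div_le_iff₀ hc0, mul_comm])
          (by linarith)
    _ = c ^ θ * d ^ (-θ) := by
        rw [Real.div_rpow hd.le hc0.le, Real.rpow_neg hc0.le, div_inv_eq_mul, mul_comm]
    _ ≤ c * d ^ (-θ) := by
        gcongr
        calc c ^ θ ≤ c ^ (1 : ℝ) := Real.rpow_le_rpow_of_exponent_le hc hθ'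
          _ = c := Real.rpow_one c

theorem dph_pos {ε p a b : ℤ} (hε : ε = 1 ∨ ε = -1) (h : Nonres ε p a b) :
    0 < |((dph ε p a b : ℤ) : ℝ)| := by
  refine lt_of_lt_of_le ?_ (dph_lower hε h)
  have := one_le_size ε p a b
  have h1 : 0 < |((a - b : ℤ) : ℝ)| := abs_pos.2 (by exact_mod_cast sub_ne_zero.2 h.1)
  have h2 : 0 < |((p - (if ε = 1 then a else b) : ℤ) : ℝ)| :=
    abs_pos.2 (by exact_mod_cast sub_ne_zero.2 h.2)
  positivity

theorem enorm_le_mul_tau {θ : ℝ} {ε p a b : ℤ} (hN : Nonres ε p a b) {k k' : ℝ}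
    (h : |k| ≤ |k'| * |((dph ε p a b : ℤ) : ℝ)| ^ (-θ)) : ‖k‖ₑ ≤ ‖k'‖ₑ * tau θ ε p a b := by
  rw [tau, if_pos hN, ← ofReal_norm, ← ofReal_norm,
    ← ENNReal.ofReal_mul (norm_nonneg _)]
  exact ENNReal.ofReal_le_ofReal h

/-- The form lives on the diagonal, so any split of the 2s derivatives between the two slots is
allowed, by Cauchy-Schwarz. -/
theorem bdd_L_one {ρ : Fin 2 → ℝ} (h : ρ 0 + ρ 1 = 2 * s) : Bdd (L s N 1) ρ 1 := by
  intro F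
  have e : absForm (n := 2) (L s N 1) F ≤
      ∑' n : ℤ, (W (ρ 0) n * F 0 n) * (W (ρ 1) n * F 1 n) := by
    have h1 : ∀ x : Fin 2 → ℤ, ‖L s N 1 x‖ₑ * ∏ k, F k (x k) ≤
        if x 0 = x 1 then (W (ρ 0) (x 0) * F 0 (x 0)) * (W (ρ 1) (x 0) * F 1 (x 0)) else 0 := by
      intro x
      rw [L_one_apply, Fin.prod_univ_two]
      split_ifs with hx
      · rw [← hx]
        calc _ ≤ W (2 * s) (x 0) * (F 0 (x 0) * F 1 (x 0)) := by
              gcongr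
              rw [W, ← ofReal_norm, mul_div_cancel_left₀ _ (by norm_num : (2 : ℝ) ≠ 0)]
              refine ENNReal.ofReal_le_ofReal ?_
              rw [norm_neg, Real.norm_of_nonneg (by have := weight_nonneg s (x 0); positivity)]
              linarith [weight_nonneg s (x 0)]
          _ = _ := by rw [← h, ← W_mul]; ring
      · simp
    refine (ENNReal.tsum_le_tsum h1).trans ?_
    rw [← (finTwoArrowEquiv ℤ).symm.tsum_eq, ENNReal.tsum_prod']
    refine ENNReal.tsum_le_tsum fun a => ?_
    rw [tsum_eq_single a]
    · simp
    · intro b hb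
      simp [hb.symm]
  refine e.trans (le_of_sq_le_sq ?_)
  rw [ENNReal.coe_one, one_mul, Fin.prod_univ_two, mul_pow, nrm_sq, nrm_sq]
  exact tsum_mul_sq_le _ _

/-- The parent phase is 0, so the whole phase is the increment and the full power |φ|^{-θ} is
available. The total derivative count is 2s - ∑ρ. -/
theorem bdd_Q_one {θ R : ℝ} (hs : 0 ≤ s) (hθ : 0 ≤ θ) (hR : R ≤ 2 * θ) (hR' : 1 < 4 * θ - R) :
    ∃ C : ℝ≥0, ∀ (N : ℕ∞) (ρ : Fin 4 → ℝ), (∀ k, ρ k ≤ 0) → 2 * s - ∑ k, ρ k ≤ R →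
      Bdd (Q s N θ 1) ρ C := by
  obtain ⟨B, hB⟩ := tri_tau_le hθ hR hR'
  refine ⟨(2 : ℕ) * 1 * B, fun N ρ hρ hsum => ?_⟩
  rw [Q_eq_graft]
  rw [Fin.sum_univ_four] at hsum
  -- After grafting, the parent slots 0 and 1 are the slots 2 and 3. The operator's output is paired
  -- with the untouched one and must make up the regularity 2s.
  set t : Fin 2 → ℝ := fun k => 2 * s - ρ (if k = 0 then 3 else 2) with ht
  refine Bdd.graft (n := 2) (K := L s N 1) (K' := L s N 1) (τ := fun k => tau θ (sg k)) (t := t)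
    ?_ ?_ ?_
  · intro k x a b
    by_cases hx : L s N 1 x = 0
    · rw [hx]; simp
    rw [Phi_eq_zero_of_L_one hx, zero_add]
    by_cases h : Nonres (sg k) (x k) a b
    · refine enorm_le_mul_tau h ?_
      rw [abs_mul, abs_mul, abs_of_nonneg (Real.rpow_nonneg (abs_nonneg _) _)]
      gcongr
      exact mul_le_of_le_one_left (by positivity) (abs_high_le k x a b)
    · simp [high, h]
  · intro k
    refine bdd_L_one ?_
    fin_cases k
    · change (2 * s - ρ 3) + ρ 3 = 2 * s
      ring
    · change ρ 2 + (2 * s - ρ 2) = 2 * s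
      ring
  · intro k F G H
    refine hB _ (sg_cases k) _ _ _ _ (hρ _) (hρ _) (hρ _) ?_ F G H
    have h0 : ∀ i, 0 ≤ 2 * s - ρ i := fun i => by linarith [hρ i]
    rw [ht, max_eq_left (h0 _)]
    fin_cases k
    · change 2 * s - ρ 3 - ρ 2 - ρ 0 - ρ 1 ≤ R
      linarith
    · change 2 * s - ρ 2 - ρ 3 - ρ 0 - ρ 1 ≤ R
      linarith

/-- At most one slot is in `H^{3σ}`, all the others being in `H^σ`. -/
def Adm (σ : ℝ) {n : ℕ} (ρ : Fin n → ℝ) : Prop := ∃ k₀, ∀ i, ρ i = if i = k₀ then 3 * σ else σ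

/-- If the rough slot is an untouched one, the parent already has it and the output is placed in
H^σ. Otherwise the output becomes the rough slot of the parent. At most one of the three inputs is
rough, so their exponents add up to at least 5σ. -/
theorem Adm.exists_update {σ : ℝ} (hσ : σ ≤ 0) {n : ℕ} {ρ : Fin (n + 2) → ℝ} (h : Adm σ ρ)
    (k : Fin n) : ∃ t, Adm σ (Function.update (fun i => ρ i.succ.succ) k t) ∧ t ≤ σ ∧ t ≤ 0 ∧
      ρ k.succ.succ ≤ 0 ∧ ρ 0 ≤ 0 ∧ ρ 1 ≤ 0 ∧ 5 * σ ≤ ρ k.succ.succ + ρ 0 + ρ 1 := by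
  obtain ⟨k₀, hk⟩ := h
  have hle : ∀ i, ρ i ≤ 0 := fun i => by rw [hk]; split_ifs <;> linarith
  have hsum : 5 * σ ≤ ρ k.succ.succ + ρ 0 + ρ 1 := by
    have n1 : k.succ.succ ≠ 0 := Fin.succ_ne_zero _
    have n2 : k.succ.succ ≠ 1 := by
      rw [show (1 : Fin (n + 2)) = Fin.succ 0 from rfl]
      exact fun h => Fin.succ_ne_zero k (Fin.succ_injective _ h)
    have n3 : (0 : Fin (n + 2)) ≠ 1 := by
      rw [show (1 : Fin (n + 2)) = Fin.succ 0 from rfl]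
      exact (Fin.succ_ne_zero _).symm
    rw [hk, hk, hk]
    split_ifs with h1 h2 h3 h4 h5 h6 h7
    all_goals first
      | linarith
      | (subst_vars; simp_all)
  by_cases h : ∃ i : Fin n, i ≠ k ∧ i.succ.succ = k₀
  · obtain ⟨i, hik, rfl⟩ := h
    refine ⟨σ, ⟨i, fun l => ?_⟩, le_rfl, hσ, hle _, hle _, hle _, hsum⟩
    by_cases hl : l = k
    · subst hl; simp [hik.symm]
    · rw [Function.update_of_ne hl, hk]
      simp
  · push Not at h
    refine ⟨3 * σ, ⟨k, fun l => ?_⟩, by linarith, by linarith, hle _, hle _, hle _, hsum⟩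
    by_cases hl : l = k
    · subst hl; simp
    · rw [Function.update_of_ne hl, hk, if_neg hl, if_neg (h l hl)]

/-- A sequence that decays faster than any exponential rate. -/
def decaySeq (A B : ℝ≥0) (j : ℕ) : ℝ≥0 := A * ∏ i ∈ Finset.range j, (B * (i + 1) * (3 / 4) ^ i)

theorem decaySeq_succ (A B : ℝ≥0) (j : ℕ) :
    decaySeq A B (j + 1) = decaySeq A B j * (B * (j + 1) * (3 / 4) ^ j) := by
  rw [decaySeq, decaySeq, Finset.prod_range_succ, ← mul_assoc]

/-- Base case: the whole factor |Φ|⁻¹ goes to the operator, with 2s - 6σ derivatives to pay.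
Inductive step: the power 3/4 pays for the -5σ derivatives of an admissible configuration, and the
remaining 1/4 yields the factor (3/4)^j. -/
theorem bdd_L {σ : ℝ} (hs : 0 ≤ s) (hσ : σ ≤ 0) (h1 : 2 * s - 6 * σ ≤ 2) (h2 : -5 * σ ≤ 3 / 2) :
    ∃ A B : ℝ≥0, 1 ≤ A ∧ 1 ≤ B ∧ ∀ (N : ℕ∞) (j : ℕ) (ρ : Fin (2 * (j + 1) + 2) → ℝ), Adm σ ρ →
      Bdd (L s N (j + 2)) ρ (decaySeq A B (j + 2)) := by
  obtain ⟨A, hA⟩ := bdd_Q_one (θ := 1) (R := 2 * s - 6 * σ) hs (by norm_num) (by linarith)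
    (by linarith)
  obtain ⟨B, hB⟩ := tri_tau_le (θ := 3 / 4) (R := -5 * σ) (by norm_num) (by linarith) (by linarith)
  -- The summand 1 makes both constants at least 1. The factor 8 absorbs the 4 from slot count and
  -- phase comparison together with the loss (3/4)², as `decaySeq` has exponent j + 2 where the
  -- phase gives j.
  refine ⟨A + 1, 8 * B + 1, by simp, by simp, fun N j => ?_⟩
  induction j with
  | zero =>
    intro ρ hρ
    have hle : ∀ i, ρ i ≤ 0 := fun i => by
      obtain ⟨k₀, hk⟩ := hρ
      rw [hk]; split_ifs <;> linarith
    refine (hA N ρ hle ?_).mono (fun x => (abs_L_eq 0 x).le) (fun _ => le_rfl) ?_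
    · obtain ⟨k₀, hk⟩ := hρ
      have : ∑ k : Fin 4, ρ k = 6 * σ := by
        have h3 : ∀ k : Fin 4, ρ k = σ + if k = k₀ then 2 * σ else 0 := fun k => by
          refine (hk k).trans ?_
          split_ifs <;> ring
        rw [Finset.sum_congr rfl fun k _ => h3 k, Finset.sum_add_distrib, Finset.sum_ite_eq']
        simp; ring
      exact (sub_right_inj.2 this).le
    · rw [decaySeq, Finset.prod_range_succ, Finset.prod_range_one]
      norm_num
      rw [← NNReal.coe_le_coe]
      push_cast
      have := A.2
      have := B.2
      have h3 : (1 : ℝ) ≤ (8 * B + 1) * ((8 * B + 1) * 2 * (3 / 4)) := by nlinarith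
      nlinarith
  | succ j ih =>
    intro ρ hρ
    choose t ht using fun k => hρ.exists_update hσ k
    have h := Bdd.graft (n := 2 * (j + 2)) (K := L s N (j + 2))
      (K' := fun x => ((2 * (3 / 4) ^ j : ℝ≥0) : ℝ) * L s N (j + 2) x)
      (χ := fun k x a b => high N k x a b * |((Phi x + dph (sg k) (x k) a b : ℤ) : ℝ)| ^ (-1 : ℝ))
      (τ := fun k => tau (3 / 4) (sg k)) (ρ := ρ) (t := t)
      (C := 2 * (3 / 4) ^ j * decaySeq (A + 1) (8 * B + 1) (j + 2)) (B := B) ?_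
      (fun k => (ih _ (ht k).1).const_mul _) ?_
    · rw [← Q_eq_graft] at h
      refine h.mono (fun x => (abs_L_eq (j + 1) x).le) (fun _ => le_rfl) ?_
      rw [show j + 1 + 2 = j + 2 + 1 from rfl, decaySeq_succ _ _ (j + 2), ← NNReal.coe_le_coe]
      push_cast
      have h0 : (0 : ℝ) ≤ decaySeq (A + 1) (8 * B + 1) (j + 2) := NNReal.coe_nonneg _
      have h3 : (0 : ℝ) ≤ (3 / 4) ^ j := by positivity
      have h4 : (0 : ℝ) ≤ B := B.2
      have h5 : (0 : ℝ) ≤ j := Nat.cast_nonneg j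
      have e : 2 * ((j : ℝ) + 2) * (2 * (3 / 4) ^ j * decaySeq (A + 1) (8 * B + 1) (j + 2)) * B =
          decaySeq (A + 1) (8 * B + 1) (j + 2) * ((3 / 4) ^ j * (4 * B * (j + 2))) := by ring
      rw [e]
      refine mul_le_mul_of_nonneg_left ?_ h0
      rw [pow_add]
      have e2 : (8 * (B : ℝ) + 1) * ((j : ℝ) + 2 + 1) * ((3 / 4) ^ j * (3 / 4) ^ 2) =
        (3 / 4) ^ j * ((8 * (B : ℝ) + 1) * ((j : ℝ) + 2 + 1) * (9 / 16)) := by ring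
      rw [e2]
      refine mul_le_mul_of_nonneg_left ?_ h3
      nlinarith [mul_nonneg h4 h5]
    · intro k x a b
      by_cases hx : L s N (j + 2) x = 0
      · simp [hx]
      by_cases hh : Nonres (sg k) (x k) a b ∧ ((x k).natAbs : ℕ∞) ≤ N ∧
          4 * |Phi x| < |Phi x + dph (sg k) (x k) a b|
      swap
      · simp [high, hh]
      refine enorm_le_mul_tau hh.1 ?_
      have hpos := dph_pos (sg_cases k) hh.1
      set d := |((dph (sg k) (x k) a b : ℤ) : ℝ)| with hd
      set u := |((Phi x + dph (sg k) (x k) a b : ℤ) : ℝ)| with hu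
      have hΦ : (4 : ℝ) ^ j ≤ |(Phi x : ℝ)| := by exact_mod_cast pow_le_abs_Phi j x hx
      have h4 : 4 * |(Phi x : ℝ)| < u := by rw [hu]; exact_mod_cast hh.2.2
      -- In the `high` region the new phase u dominates the old one, so the increment d is
      -- comparable with u.
      have h5 : d ≤ 2 * u := by
        have : d ≤ u + |(Phi x : ℝ)| := by
          rw [hd, hu]
          calc _ = |((Phi x + dph (sg k) (x k) a b : ℤ) : ℝ) - Phi x| := by
                congr 1; push_cast; ring
            _ ≤ _ := abs_sub _ _
        linarith [abs_nonneg (Phi x : ℝ)]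
      have hu0 : 0 < u := by linarith
      -- The power 1/4 is spent on decay, using u ≥ 4^j and 4^{-1/4} ≤ 3/4; the power 3/4 goes to
      -- the operator.
      have h6 : u ^ (-1 : ℝ) ≤ (3 / 4) ^ j * (2 * d ^ (-(3 / 4) : ℝ)) := by
        rw [show (-1 : ℝ) = -(1 / 4) + -(3 / 4) by norm_num, Real.rpow_add hu0]
        gcongr
        · calc u ^ (-(1 / 4) : ℝ) ≤ ((4 : ℝ) ^ j) ^ (-(1 / 4) : ℝ) :=
                Real.rpow_le_rpow_of_nonpos (by positivity)
                  (by linarith [abs_nonneg (Phi x : ℝ)]) (by norm_num)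
            _ = ((4 : ℝ) ^ (-(1 / 4) : ℝ)) ^ j := by
                rw [← Real.rpow_natCast, ← Real.rpow_mul (by norm_num), mul_comm,
                  Real.rpow_mul (by norm_num), Real.rpow_natCast]
            _ ≤ (3 / 4) ^ j := by
                gcongr
                rw [Real.rpow_neg (by norm_num), inv_le_comm₀ (by positivity) (by norm_num)]
                rw [one_div, Real.le_rpow_inv_iff_of_pos (by norm_num) (by norm_num) (by norm_num)]
                norm_num
        · exact rpow_neg_le_of_le_mul (by norm_num) hpos h5 (by norm_num) (by norm_num)
      rw [abs_mul, abs_mul, abs_mul, abs_of_nonneg (Real.rpow_nonneg (abs_nonneg _) _)]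
      rw [show |(((2 * (3 / 4) ^ j : ℝ≥0)) : ℝ)| = 2 * (3 / 4) ^ j by
        rw [abs_of_nonneg (NNReal.coe_nonneg _)]; push_cast; rfl]
      calc _ ≤ |L s N (j + 2) x| * (1 * ((3 / 4) ^ j * (2 * d ^ (-(3 / 4) : ℝ)))) := by
            gcongr
            exact abs_high_le k x a b
        _ = _ := by ring
    · intro k F G H
      obtain ⟨-, hts, ht0, q1, q2, q3, q4⟩ := ht k
      refine hB _ (sg_cases k) _ _ _ _ q1 q2 q3 ?_ F G H
      rw [max_eq_right ht0]
      linarith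

end Kernels

/-! ### Bounds for the kernels, with superexponential decay -/

section KernelBounds

variable {s : ℝ} {N : ℕ∞}

open Classical in
theorem tri_res (ε : ℤ) (F G H : ℤ → ℝ≥0∞) (p : ℤ) :
    tri ε (fun p a b => if Res p a b then 1 else 0) F G H p = F p * G p * H p := by
  rw [tri, tsum_eq_single (p, p)]
  · simp [Res]
  · rintro ⟨a, b⟩ hz
    have : ¬ Res p a b := by
      rintro ⟨h1, h2⟩
      exact hz (by rw [h2, ← h1])
    simp [this]

/-- The resonant nonlinearity |v|²v lies in H^{3σ} when v lies in H^σ. This is why K must be bounded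
with one slot in H^{3σ}. -/
theorem bdd_resn {σ : ℝ} {C : ℝ≥0} {n : ℕ} {K : (Fin n → ℤ) → ℝ} (h : ∀ ρ, Adm σ ρ → Bdd K ρ C) :
    Bdd (graft K resn) (fun _ => σ) (n * C * 1) := by
  classical
  refine Bdd.graft (K' := K) (τ := fun k p a b => if Res p a b then 1 else 0)
    (t := fun _ => 3 * σ) ?_ ?_ ?_
  · intro k x a b
    rw [enorm_mul, resn]
    gcongr
    split_ifs
    · rw [← ofReal_norm, Real.norm_eq_abs, abs_sg, ENNReal.ofReal_one]
    · simp
  · exact fun k => h _ ⟨k, fun i => by by_cases hi : i = k <;> simp [hi]⟩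
  · intro k F G H
    rw [ENNReal.coe_one, one_mul, funext (tri_res (sg k) F G H), show 3 * σ = σ + σ + σ by ring]
    exact nrm_mul_mul_le _ _ _ _ _ _

/-- In the `high` region |Φ|^{-θ} is at most a constant times the same power of the increment. The
operator maps three factors in H^σ to L², hence to H^σ. -/
theorem bdd_Q_add_two {θ R σ : ℝ} (hσ : σ ≤ 0) (hθ : 0 ≤ θ) (hθ' : θ ≤ 1) (hR : R ≤ 2 * θ)
    (hR' : 1 < 4 * θ - R) (hR'' : -3 * σ ≤ R) : ∃ B : ℝ≥0, ∀ (N : ℕ∞) (j : ℕ) (C : ℝ≥0),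
      Bdd (L s N (j + 2)) (fun _ => σ) C →
        Bdd (Q s N θ (j + 2)) (fun _ => σ) ((2 * (j + 2) : ℕ) * (2 * C) * B) := by
  obtain ⟨B, hB⟩ := tri_tau_le hθ hR hR'
  refine ⟨B, fun N j C hC => ?_⟩
  rw [Q_eq_graft]
  refine Bdd.graft (K := L s N (j + 2)) (K' := fun x => ((2 : ℝ≥0) : ℝ) * L s N (j + 2) x)
    (τ := fun k => tau θ (sg k)) (t := fun _ => σ) ?_ ?_ ?_
  · intro k x a b
    by_cases hh : Nonres (sg k) (x k) a b ∧ ((x k).natAbs : ℕ∞) ≤ N ∧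
        4 * |Phi x| < |Phi x + dph (sg k) (x k) a b|
    swap
    · simp [high, hh]
    refine enorm_le_mul_tau hh.1 ?_
    have hpos := dph_pos (sg_cases k) hh.1
    set d := |((dph (sg k) (x k) a b : ℤ) : ℝ)| with hd
    set u := |((Phi x + dph (sg k) (x k) a b : ℤ) : ℝ)| with hu
    have h4 : 4 * |(Phi x : ℝ)| < u := by rw [hu]; exact_mod_cast hh.2.2
    have h5 : d ≤ 2 * u := by
      have : d ≤ u + |(Phi x : ℝ)| := by
        rw [hd, hu]
        calc _ = |((Phi x + dph (sg k) (x k) a b : ℤ) : ℝ) - Phi x| := by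
              congr 1; push_cast; ring
          _ ≤ _ := abs_sub _ _
      linarith [abs_nonneg (Phi x : ℝ)]
    have h6 := rpow_neg_le_of_le_mul (by norm_num) hpos h5 hθ hθ'
    rw [abs_mul, abs_mul, abs_mul, abs_of_nonneg (Real.rpow_nonneg (abs_nonneg _) _),
      show |((2 : ℝ≥0) : ℝ)| = 2 by norm_num]
    calc _ ≤ |L s N (j + 2) x| * (1 * (2 * d ^ (-θ))) := by
          gcongr
          exact abs_high_le k x a b
      _ = _ := by ring
  · intro k
    rw [Function.update_eq_self_iff.2 rfl]
    exact hC.const_mul _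
  · intro k F G H
    refine hB _ (sg_cases k) _ _ _ _ hσ hσ hσ ?_ F G H
    rw [max_eq_right hσ]
    linarith

/-- The new phase gives no gain here, but the increment is at most 5|Φ| with Φ the parent phase. The
parent's |Φ|⁻¹ is therefore split: the power 1-α is converted into a power of the increment, which
puts the output of the operator in L², and the power α stays with the parent, which has to accept
one slot in L². -/
theorem bdd_low {α R σ : ℝ} (hσ : σ ≤ 0) (hα : 0 ≤ α) (hα' : α ≤ 1) (hR : R ≤ 2 * (1 - α))
    (hR' : 1 < 4 * (1 - α) - R) (hR'' : -3 * σ ≤ R) : ∃ B : ℝ≥0, ∀ (N : ℕ∞) (j : ℕ) (C : ℝ≥0),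
      (∀ k, Bdd (Q s N α (j + 1)) (Function.update (fun _ => σ) k 0) C) →
        Bdd (graft (L s N (j + 2)) (low N)) (fun _ => σ) ((2 * (j + 2) : ℕ) * (5 * C) * B) := by
  obtain ⟨B, hB⟩ := tri_tau_le (by linarith) hR hR'
  refine ⟨B, fun N j C hC => ?_⟩
  refine Bdd.graft (K := L s N (j + 2))
    (K' := (fun x => ((5 : ℝ≥0) : ℝ) * Q s N α (j + 1) x : (Fin (2 * (j + 1) + 2) → ℤ) → ℝ))
    (τ := fun k => tau (1 - α) (sg k)) (t := fun _ => 0) ?_ ?_ ?_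
  · intro k x a b
    by_cases hh : Nonres (sg k) (x k) a b ∧ ((x k).natAbs : ℕ∞) ≤ N ∧
        |Phi x + dph (sg k) (x k) a b| ≤ 4 * |Phi x|
    swap
    · simp [low, hh]
    by_cases hx : L s N (j + 2) x = 0
    · simp [hx]
    refine enorm_le_mul_tau hh.1 ?_
    have hpos := dph_pos (sg_cases k) hh.1
    have hΦ : (4 : ℝ) ^ j ≤ |(Phi x : ℝ)| := by exact_mod_cast pow_le_abs_Phi j x hx
    set d := |((dph (sg k) (x k) a b : ℤ) : ℝ)| with hd
    set u := |(Phi x : ℝ)| with hu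
    have hu0 : 0 < u := lt_of_lt_of_le (by positivity) hΦ
    have h4 : |((Phi x + dph (sg k) (x k) a b : ℤ) : ℝ)| ≤ 4 * u := by
      rw [hu]; exact_mod_cast hh.2.2
    have h5 : d ≤ 5 * u := by
      have : d ≤ |((Phi x + dph (sg k) (x k) a b : ℤ) : ℝ)| + u := by
        rw [hd, hu]
        calc _ = |((Phi x + dph (sg k) (x k) a b : ℤ) : ℝ) - Phi x| := by
              congr 1; push_cast; ring
          _ ≤ _ := abs_sub _ _
      linarith
    have h6 := rpow_neg_le_of_le_mul (θ := 1 - α) (by norm_num) hpos h5 (by linarith) (by linarith)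
    have h7 : |L s N (j + 2) x| = |graft (L s N (j + 1)) (high N) x| * (u ^ (-α) *
        u ^ (-(1 - α))) := by
      rw [abs_L_eq, Q, abs_mul, ← Real.rpow_add hu0,
        abs_of_nonneg (Real.rpow_nonneg (abs_nonneg _) _)]
      congr 2
      ring
    rw [abs_mul, abs_mul, h7, show |((5 : ℝ≥0) : ℝ)| = 5 by norm_num, Q, abs_mul,
      abs_of_nonneg (Real.rpow_nonneg (abs_nonneg _) _), ← hu]
    calc _ ≤ |graft (L s N (j + 1)) (high N) x| * (u ^ (-α) * (5 * d ^ (-(1 - α)))) * 1 := by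
          gcongr
          exact abs_low_le k x a b
      _ = _ := by ring
  · exact fun k => (hC k).const_mul _
  · intro k F G H
    refine hB _ (sg_cases k) _ _ _ _ hσ hσ hσ ?_ F G H
    rw [max_self]
    linarith

theorem decaySeq_pos {A B : ℝ≥0} (hA : 1 ≤ A) (hB : 1 ≤ B) (j : ℕ) : 0 < decaySeq A B j := by
  have hA0 : 0 < A := lt_of_lt_of_le one_pos hA
  have hB0 : 0 < B := lt_of_lt_of_le one_pos hB
  refine mul_pos hA0 (Finset.prod_pos fun i _ => ?_)
  positivity

/-- Ratio test: consecutive terms have ratio B|K|(j+1)(3/4)^j, which tends to 0. -/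
theorem superexpDecay_decaySeq {A B : ℝ≥0} (hA : 1 ≤ A) (hB : 1 ≤ B) :
    SuperexpDecay (fun j => (decaySeq A B j : ℝ)) := by
  refine ⟨fun j => decaySeq_pos hA hB j, fun K => ?_⟩
  by_cases hK : K = 0
  · refine tendsto_const_nhds.congr' ?_
    filter_upwards [eventually_gt_atTop 0] with j hj
    rw [hK, zero_pow hj.ne', mul_zero]
  refine (summable_of_ratio_test_tendsto_lt_one (l := 0) one_pos ?_ ?_).tendsto_atTop_zero
  · exact Eventually.of_forall fun j =>
      mul_ne_zero (NNReal.coe_ne_zero.2 (decaySeq_pos hA hB j).ne') (pow_ne_zero _ hK)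
  · have h1 : Tendsto (fun j : ℕ => (B : ℝ) * |K| * ((j : ℝ) * (3 / 4) ^ j + (3 / 4) ^ j)) atTop
        (𝓝 ((B : ℝ) * |K| * (0 + 0))) :=
      ((tendsto_self_mul_const_pow_of_lt_one (by norm_num) (by norm_num)).add
        (tendsto_pow_atTop_nhds_zero_of_lt_one (by norm_num) (by norm_num))).const_mul _
    rw [add_zero, mul_zero] at h1
    refine h1.congr fun j => ?_
    beta_reduce
    rw [decaySeq_succ, norm_mul, norm_mul, norm_pow, norm_pow, pow_succ, NNReal.norm_eq,
      NNReal.norm_eq, Real.norm_eq_abs]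
    have h2 : (decaySeq A B j : ℝ) ≠ 0 := NNReal.coe_ne_zero.2 (decaySeq_pos hA hB j).ne'
    have h3 : |K| ^ j ≠ 0 := pow_ne_zero _ (abs_ne_zero.2 hK)
    field_simp
    push_cast
    ring

theorem SuperexpDecay.mul_succ {C : ℕ → ℝ} (h : SuperexpDecay C) {D : ℝ}
    (hD : 0 < D) : SuperexpDecay (fun j => D * (j + 1) * C j) := by
  refine ⟨fun j => mul_pos (by positivity) (h.1 j), fun K => ?_⟩
  have h1 := ((h.2 (2 * |K|)).const_mul D)
  rw [mul_zero] at h1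
  refine squeeze_zero_norm (fun j => ?_) h1
  rw [norm_mul, norm_mul, norm_pow, Real.norm_of_nonneg (h.1 j).le,
    Real.norm_of_nonneg (by positivity), mul_pow, Real.norm_eq_abs]
  have h2 : (j : ℝ) + 1 ≤ 2 ^ j := by exact_mod_cast Nat.lt_two_pow_self
  calc D * (j + 1) * C j * |K| ^ j = D * (C j * ((j + 1) * |K| ^ j)) := by ring
    _ ≤ D * (C j * (2 ^ j * |K| ^ j)) := by
        have := (h.1 j).le
        gcongr

theorem SuperexpDecay.shift {C : ℕ → ℝ} (h : SuperexpDecay C) :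
    SuperexpDecay (fun j => C (j - 1)) := by
  refine ⟨fun j => h.1 _, fun K => ?_⟩
  rw [← tendsto_add_atTop_iff_nat 1]
  have := (h.2 K).mul_const K
  rw [zero_mul] at this
  exact this.congr fun j => by beta_reduce; rw [Nat.add_sub_cancel, pow_succ, mul_assoc]

/-- The kernels of the expansion are bounded on `H^σ`, with constants that do not depend on the
cutoff and decay superexponentially. -/
theorem exists_bounds {ε σ : ℝ} (hs' : s ≤ 1 / 2) (hε : 0 < ε)
    (hε' : ε < (s - 3 / 10) / 2) (hσ : σ = s - 1 / 2 - ε) : ∃ C₀ C₁ C₂ : ℕ → ℝ≥0,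
      SuperexpDecay (fun j => (C₀ j : ℝ)) ∧ SuperexpDecay (fun j => (C₁ j : ℝ)) ∧
      SuperexpDecay (fun j => (C₂ j : ℝ)) ∧ ∀ (N : ℕ∞) (j : ℕ),
        Bdd (L s N (j + 2)) (fun _ => σ) (C₀ (j + 2)) ∧
        Bdd (graft (L s N (j + 2)) (low N)) (fun _ => σ) (C₁ (j + 2)) ∧
        Bdd (graft (L s N (j + 2)) resn) (fun _ => σ) (C₂ (j + 2)) := by
  have hσ0 : σ ≤ 0 := by linarith
  obtain ⟨A, B, hA, hB, hL⟩ := bdd_L (s := s) (σ := σ) (by linarith) hσ0 (by linarith)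
    (by linarith)
  -- This is the least α allowed by R ≤ 2α for the first generation, where R = 2s - 3σ; it leaves
  -- the largest power 1-α for `bdd_low`. There 4(1-α) + 3σ > 1 reads 5s - 1/2 - 9ε > 1, which
  -- forces s > 3/10. The first generation needs 2s - 3σ > 1, that is 3/2 - s + 3ε > 1, and this
  -- uses ε > 0 when s = 1/2.
  set α := s - 3 / 2 * σ with hα
  obtain ⟨A₁, hA₁⟩ := bdd_Q_one (s := s) (θ := α) (R := 2 * s - 3 * σ) (by linarith) (by linarith)
    (by linarith) (by linarith)
  obtain ⟨B₁, hB₁⟩ := bdd_Q_add_two (s := s) (θ := α) (R := -3 * σ) hσ0 (by linarith)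
    (by linarith) (by linarith) (by linarith) le_rfl
  obtain ⟨B₂, hB₂⟩ := bdd_low (s := s) (α := α) (R := -3 * σ) hσ0 (by linarith)
    (by linarith) (by linarith) (by linarith) le_rfl
  have hLσ : ∀ N j, Bdd (L s N (j + 2)) (fun _ => σ) (decaySeq A B (j + 2)) := fun N j =>
    (hL N j (fun i => if i = 0 then 3 * σ else σ) ⟨0, fun _ => rfl⟩).mono (fun _ => le_rfl)
      (fun k => by split_ifs <;> linarith) le_rfl
  -- The first summand serves the later generations, the second the initial one. The bound for the
  -- `low` terms goes back two grafts, which explains the index j - 1 and the two slot counts in the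
  -- second sequence below.
  set D : ℝ≥0 := (40 * B₁ + 20 * A₁) * B₂ + 1 with hD
  have hdec := superexpDecay_decaySeq hA hB
  refine ⟨decaySeq A B, fun j => (j + 1) * (D * (j + 1) * decaySeq A B (j - 1)),
    fun j => 2 * (j + 1) * decaySeq A B j, hdec, ?_, ?_, fun N j => ⟨hLσ N j, ?_, ?_⟩⟩
  · have := (hdec.shift.mul_succ (D := D) (by positivity)).mul_succ (D := 1) one_pos
    convert this using 2
    push_cast
    ring
  · have := hdec.mul_succ (D := 2) two_pos
    convert this using 2
    push_cast
    ring
  · have hB0 : (0 : ℝ) ≤ B₁ := B₁.2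
    have hB0' : (0 : ℝ) ≤ B₂ := B₂.2
    have hA0 : (0 : ℝ) ≤ A₁ := A₁.2
    cases j with
    | zero =>
      have h1 := hB₂ N 0 A₁ fun k => hA₁ N _ (fun i => by
        by_cases h : i = k
        · simp [h]
        · simp [Function.update_of_ne h, hσ0]) (by
          have : ∑ i : Fin 4, Function.update (fun _ => σ) k 0 i = 3 * σ := by
            rw [Finset.sum_update_of_mem (Finset.mem_univ k)]
            simp [Finset.card_sdiff]
          exact (sub_right_inj.2 this).le)
      refine h1.mono (fun _ => le_rfl) (fun _ => le_rfl) ?_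
      have h2 : (1 : ℝ) ≤ decaySeq A B 1 := by
        rw [decaySeq, Finset.prod_range_one]
        have hA1 : (1 : ℝ) ≤ A := hA
        have hB1 : (1 : ℝ) ≤ B := hB
        push_cast
        norm_num
        nlinarith
      rw [← NNReal.coe_le_coe]
      push_cast
      norm_num
      have h3 : (D : ℝ) = (40 * B₁ + 20 * A₁) * B₂ + 1 := by rw [hD]; push_cast; rfl
      have h4 : (20 : ℝ) * A₁ * B₂ ≤ D := by rw [h3]; nlinarith [mul_nonneg hB0 hB0']
      have h5 : (0 : ℝ) ≤ D := D.2
      nlinarith [mul_le_mul_of_nonneg_left h2 h5]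
    | succ j =>
      have h1 := hB₂ N (j + 1) _ fun k => (hB₁ N j _ (hLσ N j)).mono (fun _ => le_rfl)
        (ρ' := Function.update (fun _ => σ) k 0) (fun i => by
          by_cases h : i = k
          · simp [h, hσ0]
          · simp [Function.update_of_ne h]) le_rfl
      refine h1.mono (fun _ => le_rfl) (fun _ => le_rfl) ?_
      beta_reduce
      rw [← NNReal.coe_le_coe, show j + 1 + 2 - 1 = j + 2 from rfl]
      push_cast
      have h3 : (D : ℝ) = (40 * B₁ + 20 * A₁) * B₂ + 1 := by rw [hD]; push_cast; rfl
      have h4 : (40 : ℝ) * B₁ * B₂ ≤ D := by rw [h3]; nlinarith [mul_nonneg hA0 hB0']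
      have h0 : (0 : ℝ) ≤ decaySeq A B (j + 2) := NNReal.coe_nonneg _
      have hj : (0 : ℝ) ≤ j := Nat.cast_nonneg j
      calc _ = 40 * B₁ * B₂ * ((j + 3) * (j + 2)) * (decaySeq A B (j + 2) : ℝ) := by ring
        _ ≤ D * ((j + 4) * (j + 4)) * (decaySeq A B (j + 2) : ℝ) := by gcongr <;> norm_num
        _ = _ := by ring
  · refine (bdd_resn (hL N j)).mono (fun _ => le_rfl) (fun _ => le_rfl) ?_
    beta_reduce
    rw [mul_one]
    gcongr
    rw [← NNReal.coe_le_coe]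
    push_cast
    linarith

/-- A graft with bounded weights is bounded on the algebra `H^r`. -/
theorem exists_bdd_graft {r : ℝ} (hr : 1 / 2 < r) : ∃ B : ℝ≥0, ∀ (n : ℕ) (K : (Fin n → ℤ) → ℝ)
    (χ : Fin n → (Fin n → ℤ) → ℤ → ℤ → ℝ) (t : ℝ) (C : ℝ≥0), (∀ k x a b, |χ k x a b| ≤ 1) →
      t ≤ r → Bdd K (fun _ => t) C → Bdd (graft K χ) (fun _ => r) (n * C * B) := by
  obtain ⟨B, hB⟩ := tri_one_le hr
  refine ⟨B, fun n K χ t C hχ ht hK => ?_⟩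
  refine Bdd.graft (K' := K) (τ := fun k p a b => 1) (t := fun _ => t) ?_ ?_ ?_
  · intro k x a b
    rw [enorm_mul]
    gcongr
    rw [← ofReal_norm, ← ENNReal.ofReal_one]
    exact ENNReal.ofReal_le_ofReal (hχ k x a b)
  · intro k
    refine hK.mono (fun _ => le_rfl) (fun i => ?_) le_rfl
    by_cases h : i = k
    · simp [h]
    · simp [Function.update_of_ne h, ht]
  · exact fun k F G H => (nrm_mono_exp ht _).trans (hB _ (sg_cases k) F G H)

end KernelBounds

/-! ### The norm of `H^r` -/

/-- The isometric embedding of `H^r` into `ℓ²`. -/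
def toLp (r : ℝ) : H r →ₗ[ℝ] lp (fun _ : ℤ => ℂ) 2 where
  toFun f := ⟨fun n => (weight (r / 2) n : ℂ) * (f : ℤ → ℂ) n, by
    refine memℓp_gen ?_
    refine Summable.congr f.2 fun n => ?_
    simp only [ENNReal.toReal_ofNat, Real.rpow_two, norm_mul, Complex.norm_real, mul_pow,
      Real.norm_eq_abs, sq_abs]
    rw [sq (weight _ _), weight_mul, add_halves]⟩
  map_add' f g := by
    ext n
    exact mul_add _ _ _
  map_smul' c f := by
    ext n
    simp [mul_left_comm]

theorem norm_toLp {r : ℝ} (f : H r) : ‖toLp r f‖ = normH r f := by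
  have h := lp.norm_rpow_eq_tsum (p := 2) (by simp) (toLp r f)
  simp only [ENNReal.toReal_ofNat, Real.rpow_two] at h
  rw [normH, ← Real.sqrt_sq (norm_nonneg (toLp r f)), h]
  congr 1
  refine tsum_congr fun n => ?_
  change ‖(weight (r / 2) n : ℂ) * (f : ℤ → ℂ) n‖ ^ 2 = _
  rw [norm_mul, Complex.norm_real, mul_pow, Real.norm_eq_abs, sq_abs, sq (weight _ _), weight_mul,
    add_halves]

theorem normH_nonneg (r : ℝ) (f : ℤ → ℂ) : 0 ≤ normH r f := Real.sqrt_nonneg _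

theorem normH_add_le {r : ℝ} (f g : H r) :
    normH r ((f : ℤ → ℂ) + g) ≤ normH r f + normH r g := by
  rw [← Submodule.coe_add, ← norm_toLp, ← norm_toLp, ← norm_toLp, map_add]
  exact norm_add_le _ _

theorem normH_sub_comm {r : ℝ} (f g : ℤ → ℂ) : normH r (f - g) = normH r (g - f) := by
  rw [normH, normH]
  congr 2
  ext n
  rw [Pi.sub_apply, Pi.sub_apply, norm_sub_rev]

theorem normH_le_add_sub {r : ℝ} (f g : H r) :
    normH r f ≤ normH r g + normH r ((f : ℤ → ℂ) - g) := by
  have := normH_add_le g (f - g)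
  simpa using this

theorem abs_normH_sub_le {r : ℝ} (f g : H r) :
    |normH r f - normH r g| ≤ normH r ((f : ℤ → ℂ) - g) := by
  rw [abs_sub_le_iff]
  have h1 := normH_le_add_sub f g
  have h2 := normH_le_add_sub g f
  rw [normH_sub_comm] at h2
  constructor <;> linarith

/-- The absolute values of a sequence. -/
def en (f : ℤ → ℂ) (n : ℤ) : ℝ≥0∞ := ‖f n‖ₑ

theorem W_mul_en_sq (r : ℝ) (f : ℤ → ℂ) (n : ℤ) :
    (W r n * en f n) ^ 2 = ENNReal.ofReal (weight r n * ‖f n‖ ^ 2) := by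
  rw [mul_pow, W_sq, en, ← ofReal_norm, ← ENNReal.ofReal_pow (norm_nonneg _),
    ← ENNReal.ofReal_mul (weight_nonneg _ _)]

theorem nrm_en {r : ℝ} {f : ℤ → ℂ} (hf : MemH r f) :
    nrm r (en f) = ENNReal.ofReal (normH r f) := by
  have h0 : ∀ n, 0 ≤ weight r n * ‖f n‖ ^ 2 := fun n =>
    mul_nonneg (weight_nonneg _ _) (sq_nonneg _)
  rw [nrm, tsum_congr (W_mul_en_sq r f), ← ENNReal.ofReal_tsum_of_nonneg h0 hf, normH,
    ENNReal.ofReal_rpow_of_nonneg (tsum_nonneg h0) (by norm_num), Real.sqrt_eq_rpow]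

theorem MemH.mono {r r' : ℝ} (h : r ≤ r') {f : ℤ → ℂ} (hf : MemH r' f) : MemH r f :=
  Summable.of_nonneg_of_le (fun _ => mul_nonneg (weight_nonneg _ _) (sq_nonneg _))
    (fun n => mul_le_mul_of_nonneg_right (weight_mono h n) (sq_nonneg _)) hf

theorem normH_mono {r r' : ℝ} (h : r ≤ r') {f : ℤ → ℂ} (hf : MemH r' f) :
    normH r f ≤ normH r' f :=
  Real.sqrt_le_sqrt ((hf.mono h).tsum_le_tsum
    (fun n => mul_le_mul_of_nonneg_right (weight_mono h n) (sq_nonneg _)) hf)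

/-! ### Multilinear forms with given kernels -/

/-- The slot `k` carries the conjugate of the argument if `k` is odd. -/
def cj {n : ℕ} (k : Fin n) : ℂ →ₗ[ℝ] ℂ :=
  if sg k = 1 then LinearMap.id else Complex.conjAe.toLinearMap

theorem norm_cj {n : ℕ} (k : Fin n) (z : ℂ) : ‖cj k z‖ = ‖z‖ := by
  unfold cj
  split_ifs
  · rfl
  · exact Complex.norm_conj z

theorem enorm_cj {n : ℕ} (k : Fin n) (z : ℂ) : ‖cj k z‖ₑ = ‖z‖ₑ := by
  rw [← ofReal_norm, norm_cj, ofReal_norm]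

/-- The coefficient `K(x) e^{-iφ(x)t}`. -/
def coef {n : ℕ} (K : (Fin n → ℤ) → ℝ) (t : ℝ) (x : Fin n → ℤ) : ℂ :=
  (K x : ℂ) * Complex.exp (-Complex.I * ((Phi x : ℤ) : ℂ) * (t : ℂ))

theorem norm_exp_phase (m : ℤ) (t : ℝ) :
    ‖Complex.exp (-Complex.I * (m : ℂ) * (t : ℂ))‖ = 1 := by
  have : -Complex.I * (m : ℂ) * (t : ℂ) = ((-(m * t) : ℝ) : ℂ) * Complex.I := by
    push_cast; ring
  rw [this, Complex.norm_exp_ofReal_mul_I]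

theorem enorm_coef {n : ℕ} (K : (Fin n → ℤ) → ℝ) (t : ℝ) (x : Fin n → ℤ) :
    ‖coef K t x‖ₑ = ‖K x‖ₑ := by
  rw [← ofReal_norm, coef, norm_mul, norm_exp_phase, mul_one, Complex.norm_real, ofReal_norm]

/-- A term of the form with kernel `K`. -/
def cterm {n : ℕ} (K : (Fin n → ℤ) → ℝ) (t : ℝ) (f : Fin n → ℤ → ℂ) (x : Fin n → ℤ) : ℂ :=
  coef K t x * ∏ k, cj k (f k (x k))

/-- The form with kernel `K`. -/
def cform {n : ℕ} (K : (Fin n → ℤ) → ℝ) (t : ℝ) (f : Fin n → ℤ → ℂ) : ℂ :=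
  ∑' x, cterm K t f x

theorem enorm_prod_cj {n : ℕ} (s : Finset (Fin n)) (f : Fin n → ℤ → ℂ) (x : Fin n → ℤ) :
    ‖∏ k ∈ s, cj k (f k (x k))‖ₑ = ∏ k ∈ s, en (f k) (x k) := by
  rw [← ofReal_norm, norm_prod, ENNReal.ofReal_prod_of_nonneg fun _ _ => norm_nonneg _]
  exact Finset.prod_congr rfl fun k _ => by rw [ofReal_norm, enorm_cj]; rfl

theorem enorm_cterm {n : ℕ} (K : (Fin n → ℤ) → ℝ) (t : ℝ) (f : Fin n → ℤ → ℂ) (x : Fin n → ℤ) :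
    ‖cterm K t f x‖ₑ = ‖K x‖ₑ * ∏ k, en (f k) (x k) := by
  rw [cterm, enorm_mul, enorm_coef, enorm_prod_cj]

theorem tsum_enorm_cterm {n : ℕ} (K : (Fin n → ℤ) → ℝ) (t : ℝ) (f : Fin n → ℤ → ℂ) :
    ∑' x, ‖cterm K t f x‖ₑ = absForm K (fun k => en (f k)) :=
  tsum_congr fun x => enorm_cterm K t f x

section

variable {n : ℕ} {K : (Fin n → ℤ) → ℝ} {r : ℝ} {C : ℝ≥0}

theorem Bdd.absForm_le (h : Bdd K (fun _ => r) C) {f : Fin n → ℤ → ℂ} (hf : ∀ k, MemH r (f k)) :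
    absForm K (fun k => en (f k)) ≤ ENNReal.ofReal (C * ∏ k, normH r (f k)) := by
  refine (h _).trans (le_of_eq ?_)
  rw [ENNReal.ofReal_mul C.coe_nonneg, ENNReal.ofReal_prod_of_nonneg fun _ _ => normH_nonneg _ _,
    ENNReal.ofReal_coe_nnreal]
  congr 1
  exact Finset.prod_congr rfl fun k _ => nrm_en (hf k)

theorem Bdd.summable (h : Bdd K (fun _ => r) C) (t : ℝ) {f : Fin n → ℤ → ℂ}
    (hf : ∀ k, MemH r (f k)) : Summable (cterm K t f) := by
  refine Summable.of_enorm ?_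
  rw [tsum_enorm_cterm]
  exact ne_top_of_le_ne_top ENNReal.ofReal_ne_top (h.absForm_le hf)

theorem enorm_tsum_le {ι : Type*} (f : ι → ℂ) : ‖∑' i, f i‖ₑ ≤ ∑' i, ‖f i‖ₑ := by
  by_cases h : ∑' i, ‖f i‖ₑ = ⊤
  · rw [h]; exact le_top
  · have hs : Summable fun i => ‖f i‖ := by
      have := ENNReal.summable_toReal h
      simpa using this
    have h1 := norm_tsum_le_tsum_norm hs
    rw [← ofReal_norm]
    refine (ENNReal.ofReal_le_ofReal h1).trans (le_of_eq ?_)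
    rw [ENNReal.ofReal_tsum_of_nonneg (fun _ => norm_nonneg _) hs]
    exact tsum_congr fun i => ofReal_norm _

theorem Bdd.norm_cform_le (h : Bdd K (fun _ => r) C) (t : ℝ) {f : Fin n → ℤ → ℂ}
    (hf : ∀ k, MemH r (f k)) : ‖cform K t f‖ ≤ C * ∏ k, normH r (f k) := by
  have h0 : 0 ≤ C * ∏ k, normH r (f k) :=
    mul_nonneg C.2 (Finset.prod_nonneg fun _ _ => normH_nonneg _ _)
  rw [← ENNReal.ofReal_le_ofReal_iff h0, ofReal_norm]
  refine (enorm_tsum_le _).trans ?_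
  rw [tsum_enorm_cterm]
  exact h.absForm_le hf

/-- The evaluation of the `m`-th Fourier coefficient of the argument in slot `k`. -/
def evalSlot (r : ℝ) (k : Fin n) (m : ℤ) : H r →ₗ[ℝ] ℂ :=
  cj k ∘ₗ LinearMap.proj (R := ℝ) (φ := fun _ : ℤ => ℂ) m ∘ₗ
    ((H r).subtype.restrictScalars ℝ)

/-- A term of the form with kernel `K`, as a multilinear map. -/
def termMap (K : (Fin n → ℤ) → ℝ) (r t : ℝ) (x : Fin n → ℤ) :
    MultilinearMap ℝ (fun _ : Fin n => H r) ℂ :=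
  coef K t x • (MultilinearMap.mkPiAlgebra ℝ (Fin n) ℂ).compLinearMap
    fun k => evalSlot r k (x k)

/-- The form with kernel `K`, as a multilinear map. -/
def mform (h : Bdd K (fun _ => r) C) (t : ℝ) : MultilinearMap ℝ (fun _ : Fin n => H r) ℂ where
  toFun f := ∑' x, termMap K r t x f
  map_update_add' f k u v := by
    rw [← Summable.tsum_add]
    · exact tsum_congr fun x => MultilinearMap.map_update_add _ _ _ _ _
    · exact h.summable t fun i => (Function.update f k u i).2
    · exact h.summable t fun i => (Function.update f k v i).2
  map_update_smul' f k c u := by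
    rw [← tsum_const_smul'']
    exact tsum_congr fun x => MultilinearMap.map_update_smul _ _ _ _ _

/-- The Lipschitz bound for the restriction of a bounded multilinear map to the diagonal. -/
theorem norm_diag_sub_le {G : Type*} [NormedAddCommGroup G] [NormedSpace ℝ G]
    (A : MultilinearMap ℝ (fun _ : Fin n => H r) G) {c R : ℝ} (hc : 0 ≤ c)
    (hA : ∀ f, ‖A f‖ ≤ c * ∏ k, normH r (f k)) {f g : H r} (hf : normH r f ≤ R)
    (hg : normH r g ≤ R) :
    ‖A (fun _ => f) - A (fun _ => g)‖ ≤ c * n * R ^ (n - 1) * normH r ((f : ℤ → ℂ) - g) := by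
  -- The `H^r` norm is pulled back from ℓ² locally, so that the general Lipschitz estimate for
  -- bounded multilinear maps applies.
  let i1 : SeminormedAddCommGroup (H r) := SeminormedAddCommGroup.induced (H r) _ (toLp r)
  let i2 : NormedSpace ℝ (H r) := NormedSpace.induced ℝ (H r) _ (toLp r)
  have hnorm : ∀ f : H r, ‖f‖ = normH r f := fun f => norm_toLp f
  have hR : 0 ≤ R := (normH_nonneg _ _).trans hf
  have h := A.norm_image_sub_le_of_bound hc (fun m => by simpa only [hnorm] using hA m)
    (fun _ => f) (fun _ => g)
  rw [Fintype.card_fin] at h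
  refine h.trans ?_
  have e1 : ‖(fun _ : Fin n => f)‖ ≤ R := (pi_norm_le_iff_of_nonneg hR).2 fun _ => by
    rw [hnorm]; exact hf
  have e2 : ‖(fun _ : Fin n => g)‖ ≤ R := (pi_norm_le_iff_of_nonneg hR).2 fun _ => by
    rw [hnorm]; exact hg
  have e3 : ‖(fun _ : Fin n => f) - fun _ => g‖ ≤ normH r ((f : ℤ → ℂ) - g) :=
    (pi_norm_le_iff_of_nonneg (normH_nonneg _ _)).2 fun _ => by
      rw [← Submodule.coe_sub, ← hnorm]; rfl
  gcongr
  exact max_le e1 e2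

end

/-! ### Continuity of locally Lipschitz functionals along curves -/

/-- `F(t, ·)` is Lipschitz on bounded sets of `H^r`, uniformly in `t`, and `F` is continuous
in `t`. -/
structure LocLip {r : ℝ} {G : Type*} [NormedAddCommGroup G] (F : ℝ → H r → G) : Prop where
  lip : ∀ R : ℝ, ∃ l : ℝ, ∀ (t : ℝ) (f g : H r), normH r f ≤ R → normH r g ≤ R →
    ‖F t f - F t g‖ ≤ l * normH r ((f : ℤ → ℂ) - g)
  cont : ∀ f, Continuous fun t => F t f

theorem ContH.continuous_normH {r : ℝ} {v : ℝ → H r} (hv : ContH r (fun t => (v t : ℤ → ℂ))) :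
    Continuous fun t => normH r (v t) := by
  refine continuous_iff_continuousAt.2 fun t => tendsto_iff_norm_sub_tendsto_zero.2 ?_
  exact squeeze_zero (fun _ => norm_nonneg _) (fun τ => abs_normH_sub_le (v τ) (v t)) (hv.2 t)

theorem LocLip.continuous {r : ℝ} {G : Type*} [NormedAddCommGroup G] {F : ℝ → H r → G}
    (hF : LocLip F) {v : ℝ → H r} (hv : ContH r (fun t => (v t : ℤ → ℂ))) :
    Continuous fun t => F t (v t) := by
  refine continuous_iff_continuousAt.2 fun t => tendsto_iff_norm_sub_tendsto_zero.2 ?_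
  obtain ⟨l, hl⟩ := hF.lip (normH r (v t) + 1)
  have h1 : ∀ᶠ τ in 𝓝 t, normH r (v τ) ≤ normH r (v t) + 1 :=
    (hv.continuous_normH.tendsto t).eventually_le_const (by linarith)
  have h2 : Tendsto (fun τ => l * normH r ((v τ : ℤ → ℂ) - v t) + ‖F τ (v t) - F t (v t)‖) (𝓝 t)
      (𝓝 0) := by
    have h3 := tendsto_iff_norm_sub_tendsto_zero.1 ((hF.cont (v t)).tendsto t)
    simpa using ((hv.2 t).const_mul l).add h3
  refine squeeze_zero' (Eventually.of_forall fun _ => norm_nonneg _) ?_ h2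
  filter_upwards [h1] with τ hτ
  calc ‖F τ (v τ) - F t (v t)‖ = ‖(F τ (v τ) - F τ (v t)) + (F τ (v t) - F t (v t))‖ := by
        rw [sub_add_sub_cancel]
    _ ≤ _ := (norm_add_le _ _).trans (by gcongr; exact hl τ _ _ hτ (by linarith))

theorem Bdd.locLip {n : ℕ} {K : (Fin n → ℤ) → ℝ} {r : ℝ} {C : ℝ≥0} (h : Bdd K (fun _ => r) C) :
    LocLip (fun t (f : H r) => cform K t (fun _ => f)) where
  lip R := ⟨C * n * R ^ (n - 1), fun t f g hf hg =>
    norm_diag_sub_le (mform h t) C.2 (fun f => h.norm_cform_le t fun k => (f k).2) hf hg⟩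
  cont f := by
    have hs : Summable fun x => ‖cterm K 0 (fun _ => (f : ℤ → ℂ)) x‖ :=
      (h.summable 0 fun _ => f.2).norm
    refine continuous_tsum (fun x => ?_) hs fun x t => le_of_eq ?_
    · unfold cterm coef
      fun_prop
    · rw [← toReal_enorm, ← toReal_enorm, enorm_cterm, enorm_cterm]

/-! ### The vector field -/

open Classical in
/-- The right-hand side of the equation, extended by zero to the modes above the cutoff. -/
def rhs (N : ℕ∞) (t : ℝ) (v : ℤ → ℂ) (n : ℤ) : ℂ :=
  if (n.natAbs : ℕ∞) ≤ N then vectorField N t v n else 0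

open Classical in
/-- The weights of the nonlinearity in a slot with sign `ε`. -/
def totp (N : ℕ∞) (ε p a b : ℤ) : ℝ :=
  (if Nonres ε p a b ∧ (p.natAbs : ℕ∞) ≤ N then -(ε : ℝ) else 0) + if Res p a b then (ε : ℝ) else 0

/-- The weights of the nonlinearity in slot `k`. -/
def tot (N : ℕ∞) {n : ℕ} (k : Fin n) (x : Fin n → ℤ) (a b : ℤ) : ℝ := totp N (sg k) (x k) a b

theorem high_add_low_add_resn (N : ℕ∞) {n : ℕ} (k : Fin n) (x : Fin n → ℤ) (a b : ℤ) :
    high N k x a b + low N k x a b + resn k x a b = tot N k x a b := by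
  unfold high low resn tot totp
  congr 1
  by_cases h1 : Nonres (sg k) (x k) a b
  · by_cases h2 : ((x k).natAbs : ℕ∞) ≤ N
    · by_cases h3 : 4 * |Phi x| < |Phi x + dph (sg k) (x k) a b|
      · simp [h1, h2, h3, not_le.2 h3]
      · simp [h1, h2, h3, not_lt.1 h3]
    · simp [h2]
  · simp [h1]

theorem abs_totp_le (N : ℕ∞) {ε : ℤ} (hε : ε = 1 ∨ ε = -1) (p a b : ℤ) :
    |totp N ε p a b| ≤ 1 := by
  have h1 : |(ε : ℝ)| = 1 := by rcases hε with h | h <;> rw [h] <;> norm_num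
  unfold totp
  by_cases h : Res p a b
  · have : ¬ Nonres ε p a b := fun h' => h'.1 h.1
    simp [h, this, h1]
  · simp only [h, if_false, add_zero]
    split_ifs <;> simp [h1]

theorem tri_en_ne_top {r : ℝ} (hr : 1 / 2 < r) {ε : ℤ} (hε : ε = 1 ∨ ε = -1) {v : ℤ → ℂ}
    (hv : MemH r v) (p : ℤ) : tri ε (fun _ _ _ => 1) (en v) (en v) (en v) p ≠ ⊤ := by
  obtain ⟨B, hB⟩ := tri_one_le hr
  have h1 := hB ε hε (en v) (en v) (en v)
  have h2 := (W_mul_le_nrm r (tri ε (fun _ _ _ => 1) (en v) (en v) (en v)) p).trans h1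
  rw [nrm_en hv] at h2
  intro htop
  rw [htop, W, ENNReal.mul_top (ENNReal.ofReal_pos.2 (weight_pos _ _)).ne', top_le_iff] at h2
  have h3 : (B : ℝ≥0∞) * (ENNReal.ofReal (normH r v) * ENNReal.ofReal (normH r v) *
    ENNReal.ofReal (normH r v)) ≠ ⊤ := by finiteness
  exact h3 h2

/-- The complex conjugate if `ε ≠ 1`. -/
def cjs (ε : ℤ) : ℂ →ₗ[ℝ] ℂ := if ε = 1 then LinearMap.id else Complex.conjAe.toLinearMap

theorem cj_eq_cjs {n : ℕ} (k : Fin n) : cj k = cjs (sg k) := rfl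

theorem cjs_one (z : ℂ) : cjs 1 z = z := by simp [cjs]

theorem cjs_neg_one (z : ℂ) : cjs (-1) z = (starRingEnd ℂ) z := by
  rw [cjs, if_neg (by norm_num)]; rfl

theorem norm_cjs (ε : ℤ) (z : ℂ) : ‖cjs ε z‖ = ‖z‖ := by
  unfold cjs
  split_ifs
  · rfl
  · exact Complex.norm_conj z

/-- The trilinear terms of the nonlinearity. -/
def nlterm (ε : ℤ) (t : ℝ) (v : ℤ → ℂ) (p : ℤ) (z : ℤ × ℤ) : ℂ :=
  Complex.exp (-Complex.I * ((dph ε p z.1 z.2 : ℤ) : ℂ) * (t : ℂ)) *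
    (cjs ε (v (p - ε * (z.1 - z.2))) * v z.1 * (starRingEnd ℂ) (v z.2))

theorem enorm_nlterm (ε : ℤ) (t : ℝ) (v : ℤ → ℂ) (p : ℤ) (z : ℤ × ℤ) :
    ‖nlterm ε t v p z‖ₑ = en v (p - ε * (z.1 - z.2)) * en v z.1 * en v z.2 := by
  rw [nlterm, enorm_mul, enorm_mul, enorm_mul]
  simp only [en]
  rw [← ofReal_norm, norm_exp_phase, ENNReal.ofReal_one, one_mul, ← ofReal_norm (cjs _ _),
    norm_cjs, ofReal_norm, ← ofReal_norm ((starRingEnd ℂ) _), Complex.norm_conj, ofReal_norm]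

/-- The set is parametrized by the two frequencies other than n₁. For ε = 1 they are a = n₃, b = n₂;
for the conjugated equation the roles are exchanged, so that a always enters unconjugated. The
frequency cutoff is left to the summand. -/
theorem tsum_Gam_eq {N : ℕ∞} {p : ℤ} {ε : ℤ} (hε : ε = 1 ∨ ε = -1) (g : ℤ × ℤ × ℤ → ℂ)
    (hg : ∀ q, ¬ (((q.1.natAbs : ℕ∞) ≤ N ∧ (q.2.1.natAbs : ℕ∞) ≤ N ∧ (q.2.2.natAbs : ℕ∞) ≤ N)) →
      g q = 0) [∀ z : ℤ × ℤ, Decidable (Nonres ε p z.1 z.2)] :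
    ∑' q : Gam N p, g q = ∑' z : ℤ × ℤ, if Nonres ε p z.1 z.2 then
      g (p - ε * (z.1 - z.2), if ε = 1 then (z.2, z.1) else (z.1, z.2)) else 0 := by
  classical
  rw [tsum_subtype (Gam N p) g]
  have hinj : Function.Injective (fun z : ℤ × ℤ => ((p - ε * (z.1 - z.2),
      if ε = 1 then (z.2, z.1) else (z.1, z.2)) : ℤ × ℤ × ℤ)) := by
    rintro ⟨a, b⟩ ⟨a', b'⟩ h
    have h2 := congrArg Prod.snd h
    simp only at h2
    split_ifs at h2 <;> simp_all
  rw [← hinj.tsum_eq]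
  · refine tsum_congr fun z => ?_
    obtain ⟨a, b⟩ := z
    rw [Set.indicator_apply]
    by_cases h : Nonres ε p a b
    · simp only [h, if_true]
      refine ite_eq_left_iff.2 fun h1 => (hg _ fun h2 => h1 ⟨h2, ?_⟩).symm
      obtain ⟨h3, h4⟩ := h
      rcases hε with rfl | rfl
      · simp only [if_true] at h4 ⊢
        refine ⟨by ring, fun h => h3 (by linarith), h4.symm⟩
      · simp only [show ¬ ((-1 : ℤ) = 1) by norm_num, if_false] at h4 ⊢
        refine ⟨by ring, fun h => h3 (by linarith), h4.symm⟩
    · simp only [h, if_false]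
      rw [if_neg]
      rintro ⟨-, h2, h3, h4⟩
      refine h ⟨fun hab => h3 (by simp [hab]), fun hp => h4 ?_⟩
      rcases hε with rfl | rfl
      · simp only [if_true] at hp ⊢
        exact hp.symm
      · simp only [show ¬ ((-1 : ℤ) = 1) by norm_num, if_false] at hp ⊢
        exact hp.symm
  · rintro ⟨n1, n2, n3⟩ hq
    have h1 : (n1, n2, n3) ∈ Gam N p := by
      by_contra h; exact hq (Set.indicator_of_notMem h _)
    obtain ⟨-, h2, -, -⟩ := h1
    simp only at h2
    rcases hε with rfl | rfl
    · refine ⟨(n3, n2), ?_⟩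
      simp only [if_true]
      rw [h2]; congr 1; ring
    · refine ⟨(n2, n3), ?_⟩
      simp only [show ¬ ((-1 : ℤ) = 1) by norm_num, if_false]
      rw [h2]; congr 1; ring

/-- The equation and its conjugate take one common form, with the sign ε absorbed in the weights.
Absolute convergence, from the algebra property of H^r, allows the resonant term to be merged into
the sum. -/
theorem cjs_rhs {N : ℕ∞} {r : ℝ} (hr : 1 / 2 < r) {ε : ℤ} (hε : ε = 1 ∨ ε = -1) (t : ℝ)
    {v : ℤ → ℂ} (hv : MemH r v) (hN : ∀ n : ℤ, N < (n.natAbs : ℕ∞) → v n = 0) (p : ℤ) :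
    cjs ε (rhs N t v p) =
      Complex.I * ∑' z : ℤ × ℤ, (totp N ε p z.1 z.2 : ℂ) * nlterm ε t v p z := by
  classical
  have hres : ∑' z : ℤ × ℤ, ((if Res p z.1 z.2 then (ε : ℝ) else 0 : ℝ) : ℂ) * nlterm ε t v p z =
      ε * (((‖v p‖ ^ 2 : ℝ) : ℂ) * cjs ε (v p)) := by
    rw [tsum_eq_single (p, p)]
    · have : dph ε p p p = 0 := by simp [dph]
      simp only [nlterm, Res, and_self, if_true, this]
      simp only [sub_self, mul_zero, sub_zero, Int.cast_zero, zero_mul, Complex.exp_zero, one_mul]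
      rw [mul_assoc (cjs ε (v p)), Complex.mul_conj, Complex.normSq_eq_norm_sq]
      push_cast
      ring
    · rintro ⟨a, b⟩ hz
      have : ¬ Res p a b := by
        rintro ⟨h1, h2⟩
        exact hz (by rw [h2, ← h1])
      simp [this]
  have hsum : ∀ c : ℤ × ℤ → ℝ, (∀ z, |c z| ≤ 1) →
      Summable fun z : ℤ × ℤ => (c z : ℂ) * nlterm ε t v p z := by
    intro c hc
    refine Summable.of_enorm (ne_top_of_le_ne_top (tri_en_ne_top hr hε hv p) ?_)
    refine ENNReal.tsum_le_tsum fun z => ?_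
    rw [enorm_mul, enorm_nlterm]
    gcongr
    rw [← ofReal_norm, Complex.norm_real, ← ENNReal.ofReal_one]
    exact ENNReal.ofReal_le_ofReal (hc z)
  have hε1 : |(ε : ℝ)| = 1 := by rcases hε with h | h <;> rw [h] <;> norm_num
  have hsplit : ∑' z : ℤ × ℤ, (totp N ε p z.1 z.2 : ℂ) * nlterm ε t v p z =
      ∑' z : ℤ × ℤ, ((if Nonres ε p z.1 z.2 ∧ (p.natAbs : ℕ∞) ≤ N then -(ε : ℝ) else 0 : ℝ) : ℂ) *
        nlterm ε t v p z + ε * (((‖v p‖ ^ 2 : ℝ) : ℂ) * cjs ε (v p)) := by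
    rw [← hres, ← Summable.tsum_add]
    · refine tsum_congr fun z => ?_
      rw [← add_mul, ← Complex.ofReal_add, totp]
    · exact hsum _ fun z => by split_ifs <;> simp [hε1]
    · exact hsum _ fun z => by split_ifs <;> simp [hε1]
  rw [hsplit]
  by_cases hp : (p.natAbs : ℕ∞) ≤ N
  · rw [rhs, if_pos hp, vectorField]
    set g : ℤ × ℤ × ℤ → ℂ := fun q => Complex.exp (-Complex.I *
      ((phase q.1 q.2.1 q.2.2 p : ℤ) : ℂ) * (t : ℂ)) *
        v q.1 * (starRingEnd ℂ) (v q.2.1) * v q.2.2 with hg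
    have hg0 : ∀ q : ℤ × ℤ × ℤ, ¬ (((q.1.natAbs : ℕ∞) ≤ N ∧ (q.2.1.natAbs : ℕ∞) ≤ N ∧
        (q.2.2.natAbs : ℕ∞) ≤ N)) → g q = 0 := by
      intro q hq
      rw [hg]
      simp only [not_and_or, not_le] at hq
      rcases hq with h | h | h <;> simp [hN _ h]
    change cjs ε (-Complex.I * ∑' q : Gam N p, g q + _) = _
    rw [tsum_Gam_eq hε g hg0]
    rcases hε with rfl | rfl
    · rw [cjs_one, cjs_one, mul_add, ← tsum_mul_left, ← tsum_mul_left]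
      congr 1
      · refine tsum_congr fun z => ?_
        by_cases h : Nonres 1 p z.1 z.2
        · have : phase (p - 1 * (z.1 - z.2)) z.2 z.1 p = dph 1 p z.1 z.2 := by
            rw [phase, dph]; ring
          simp only [h, hp, and_self, if_true, hg, nlterm, this, cjs_one]
          push_cast
          ring
        · simp [h]
      · push_cast; ring
    · rw [cjs_neg_one, cjs_neg_one, map_add, map_mul, Complex.conj_tsum, mul_add, ← tsum_mul_left,
        ← tsum_mul_left]
      congr 1
      · refine tsum_congr fun z => ?_
        by_cases h : Nonres (-1) p z.1 z.2
        · have : phase (p - (-1) * (z.1 - z.2)) z.1 z.2 p = -dph (-1) p z.1 z.2 := by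
            rw [phase, dph]; ring
          simp only [h, hp, and_self, if_true, hg, nlterm, this, cjs_neg_one,
            show ¬ ((-1 : ℤ) = 1) by norm_num, if_false]
          simp only [map_mul, ← Complex.exp_conj, map_neg, Complex.conj_I, Complex.conj_ofReal,
            map_intCast, Complex.conj_conj]
          push_cast
          ring_nf
        · simp [h]
      · simp only [map_mul, Complex.conj_I, Complex.conj_ofReal]
        push_cast; ring
  · have hv0 : v p = 0 := hN p (not_le.1 hp)
    simp [rhs, hp, hv0]

/-! ### Time derivatives of forms along classical solutions -/

section Derivative

variable {N : ℕ∞} {r : ℝ} {n : ℕ} {K : (Fin n → ℤ) → ℝ}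

/-- A classical solution with values in the algebra `H^r`, `r > 1/2`. -/
structure SolvesIn (N : ℕ∞) (r : ℝ) (v : ℝ → H r) : Prop where
  cont : ContH r (fun t => (v t : ℤ → ℂ))
  deriv : ∀ (m : ℤ) (t : ℝ), HasDerivAt (fun τ => (v τ : ℤ → ℂ) m) (rhs N t (v t) m) t
  supp : ∀ (m : ℤ), N < (m.natAbs : ℕ∞) → ∀ t, (v t : ℤ → ℂ) m = 0

/-- The derivative of a term of a form along a solution. -/
def dterm (N : ℕ∞) (K : (Fin n → ℤ) → ℝ) (t : ℝ) (v : ℤ → ℂ) (x : Fin n → ℤ) : ℂ :=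
  -Complex.I * cterm (fun x => K x * (Phi x : ℝ)) t (fun _ => v) x +
    ∑ k, coef K t x * (cj k (rhs N t v (x k)) * ∏ i ∈ Finset.univ.erase k, cj i (v (x i)))

theorem hasDerivAt_cterm {v : ℝ → H r} (hv : SolvesIn N r v) (x : Fin n → ℤ) (t : ℝ) :
    HasDerivAt (fun τ => cterm K τ (fun _ => (v τ : ℤ → ℂ)) x) (dterm N K t (v t) x) t := by
  have h1 : HasDerivAt (fun τ => coef K τ x) (coef K t x * (-Complex.I * ((Phi x : ℤ) : ℂ))) t := by
    have h2 : HasDerivAt (fun τ : ℝ => -Complex.I * ((Phi x : ℤ) : ℂ) * (τ : ℂ))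
        (-Complex.I * ((Phi x : ℤ) : ℂ)) t := by
      simpa using (Complex.ofRealCLM.hasDerivAt (x := t)).const_mul
        (-Complex.I * ((Phi x : ℤ) : ℂ))
    have h3 := (h2.cexp).const_mul (K x : ℂ)
    exact h3.congr_deriv (by simp only [coef]; ring)
  have h4 : ∀ k ∈ (Finset.univ : Finset (Fin n)), HasDerivAt (fun τ => cj k ((v τ : ℤ → ℂ) (x k)))
      (cj k (rhs N t (v t) (x k))) t := fun k _ =>
    ((cj k).toContinuousLinearMap.hasFDerivAt).comp_hasDerivAt t (hv.deriv (x k) t)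
  have h5 := h1.mul (HasDerivAt.fun_finsetProd h4)
  refine h5.congr_deriv ?_
  simp only [dterm, Finset.mul_sum, cterm, coef]
  congr 1
  · push_cast; ring
  · exact Finset.sum_congr rfl fun k _ => by rw [smul_eq_mul]; ring

theorem nrm_en_const_mul_le {B : ℝ≥0} {v : ℤ → ℂ} (hv : MemH r v) (m : ℕ) :
    (B : ℝ≥0∞) * nrm r (en v) ^ m ≤ ENNReal.ofReal (B * normH r v ^ m) := by
  rw [nrm_en hv, ENNReal.ofReal_mul B.coe_nonneg, ENNReal.ofReal_pow (normH_nonneg _ _),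
    ENNReal.ofReal_coe_nnreal]

theorem enorm_rhs_le (hr : 1 / 2 < r) {ε : ℤ} (hε : ε = 1 ∨ ε = -1) (t : ℝ)
    {v : ℤ → ℂ} (hv : MemH r v) (hN : ∀ n : ℤ, N < (n.natAbs : ℕ∞) → v n = 0) (p : ℤ) :
    ‖cjs ε (rhs N t v p)‖ₑ ≤ tri ε (fun _ _ _ => 1) (en v) (en v) (en v) p := by
  rw [cjs_rhs hr hε t hv hN, enorm_mul, ← ofReal_norm, Complex.norm_I, ENNReal.ofReal_one,
    one_mul]
  refine (enorm_tsum_le _).trans (ENNReal.tsum_le_tsum fun z => ?_)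
  rw [enorm_mul, enorm_nlterm]
  gcongr
  rw [← ofReal_norm, Complex.norm_real, ← ENNReal.ofReal_one]
  exact ENNReal.ofReal_le_ofReal (abs_totp_le N hε _ _ _)

theorem tsum_slot_le (hr : 1 / 2 < r) {ρ : ℝ} (hρ : ρ ≤ r) {C : ℝ≥0} (hK : Bdd K (fun _ => ρ) C) :
    ∃ B : ℝ≥0, ∀ (t : ℝ) (v : ℤ → ℂ), MemH r v → (∀ n : ℤ, N < (n.natAbs : ℕ∞) → v n = 0) →
      ∀ k, ∑' x, ‖coef K t x * (cj k (rhs N t v (x k)) *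
        ∏ i ∈ Finset.univ.erase k, cj i (v (x i)))‖ₑ ≤ B * nrm r (en v) ^ (n + 2) := by
  obtain ⟨B, hB⟩ := tri_one_le hr
  refine ⟨C * B, fun t v hv hN k => ?_⟩
  set T := tri (sg k) (fun _ _ _ => 1) (en v) (en v) (en v) with hT
  calc _ ≤ ∑' x, ‖K x‖ₑ * (T (x k) * ∏ i ∈ Finset.univ.erase k, en v (x i)) := by
        refine ENNReal.tsum_le_tsum fun x => ?_
        rw [enorm_mul, enorm_mul, enorm_coef, enorm_prod_cj _ (fun _ => v)]
        gcongr
        exact enorm_rhs_le hr (sg_cases k) t hv hN _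
    _ = absForm K (Function.update (fun _ => en v) k T) := (absForm_update K k _ _).symm
    _ ≤ C * ∏ i, nrm ρ (Function.update (fun _ => en v) k T i) := hK _
    _ ≤ C * (B * nrm r (en v) ^ 3 * nrm r (en v) ^ (n - 1)) := by
        gcongr
        rw [← Finset.mul_prod_erase _ _ (Finset.mem_univ k), Function.update_self]
        have e : ∏ i ∈ Finset.univ.erase k, nrm ρ (Function.update (fun _ => en v) k T i) ≤
            nrm r (en v) ^ (n - 1) := by
          rw [Finset.prod_congr rfl (g := fun _ => nrm ρ (en v)) fun i hi => by
            rw [Function.update_of_ne (Finset.ne_of_mem_erase hi)], Finset.prod_const,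
            Finset.card_erase_of_mem (Finset.mem_univ k), Finset.card_univ, Fintype.card_fin]
          gcongr
          exact nrm_mono_exp hρ _
        refine mul_le_mul' ?_ e
        refine (nrm_mono_exp hρ _).trans ((hB _ (sg_cases k) _ _ _).trans (le_of_eq ?_))
        ring
    _ = _ := by
        have : n + 2 = 3 + (n - 1) := by have := k.pos; omega
        rw [this, pow_add, ENNReal.coe_mul]
        ring

/-- Inserting the equation in slot k and reindexing by `child k` gives the grafted form, because
phases add. Absolute summability justifies the rearrangement. -/
theorem tsum_coef_rhs (hr : 1 / 2 < r) {ρ : ℝ} (hρ : ρ ≤ r) {C : ℝ≥0} (hK : Bdd K (fun _ => ρ) C)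
    (t : ℝ) {v : ℤ → ℂ} (hv : MemH r v) (hN : ∀ n : ℤ, N < (n.natAbs : ℕ∞) → v n = 0) :
    ∑ k, ∑' x, coef K t x * (cj k (rhs N t v (x k)) *
      ∏ i ∈ Finset.univ.erase k, cj i (v (x i))) =
    Complex.I * cform (graft K (tot N)) t (fun _ => v) := by
  have hterm : ∀ (k : Fin n) (z : (Fin n → ℤ) × ℤ × ℤ),
      cterm (fun y => K ((child k).symm y).1 * tot N k ((child k).symm y).1 ((child k).symm y).2.1
        ((child k).symm y).2.2) t (fun _ => v) (child k z) =
      coef K t z.1 * (((totp N (sg k) (z.1 k) z.2.1 z.2.2 : ℂ) * nlterm (sg k) t v (z.1 k) z.2) *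
        ∏ i ∈ Finset.univ.erase k, cj i (v (z.1 i))) := by
    rintro k ⟨x, a, b⟩
    have h0 : ∀ m : ℕ, cj (0 : Fin (m + 1)) = LinearMap.id := fun m => by
      rw [cj, if_pos]; simp [sg]
    have h1 : ∀ z, cj (1 : Fin (n + 2)) z = (starRingEnd ℂ) z := fun z => by
      rw [cj_eq_cjs, show sg (1 : Fin (n + 2)) = -1 from by
        rw [sg, show ((1 : Fin (n + 2)) : ℕ) = 1 from rfl, pow_one], cjs_neg_one]
    have h2 : ∀ i : Fin n, cj i.succ.succ = cj i := fun i => by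
      rw [cj_eq_cjs, sg_succ_succ, cj_eq_cjs]
    rw [cterm, coef, Equiv.symm_apply_apply, prod_child (fun i m => cj i (v m)), Phi_child, coef,
      nlterm, h0, h1, h2]
    simp only [h2, LinearMap.id_apply, tot]
    rw [show -Complex.I * ((Phi x + dph (sg k) (x k) a b : ℤ) : ℂ) * (t : ℂ) =
      -Complex.I * ((Phi x : ℤ) : ℂ) * (t : ℂ) +
      -Complex.I * ((dph (sg k) (x k) a b : ℤ) : ℂ) * (t : ℂ) by push_cast; ring, Complex.exp_add]
    rw [cj_eq_cjs k]
    push_cast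
    ring
  have hsum : ∀ k : Fin n, Summable fun z : (Fin n → ℤ) × ℤ × ℤ =>
      coef K t z.1 * (((totp N (sg k) (z.1 k) z.2.1 z.2.2 : ℂ) * nlterm (sg k) t v (z.1 k) z.2) *
        ∏ i ∈ Finset.univ.erase k, cj i (v (z.1 i))) := by
    intro k
    obtain ⟨B, hB⟩ := tri_one_le hr
    refine Summable.of_enorm (ne_top_of_le_ne_top ?_ (b := absForm K (Function.update
      (fun _ => en v) k (tri (sg k) (fun _ _ _ => 1) (en v) (en v) (en v)))) ?_)
    · refine ne_top_of_le_ne_top ?_ (hK _)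
      refine ENNReal.mul_ne_top ENNReal.coe_ne_top (ENNReal.prod_ne_top fun i _ => ?_)
      have hne : nrm r (en v) ≠ ⊤ := by rw [nrm_en hv]; exact ENNReal.ofReal_ne_top
      refine ne_top_of_le_ne_top ?_ (nrm_mono_exp hρ _)
      by_cases h : i = k
      · subst h
        rw [Function.update_self]
        refine ne_top_of_le_ne_top ?_ (hB _ (sg_cases _) _ _ _)
        finiteness
      · rwa [Function.update_of_ne h]
    · rw [← tsum_child_eq (F := fun _ => en v)]
      refine ENNReal.tsum_le_tsum fun z => ?_
      rw [show z = (z.1, z.2.1, z.2.2) from rfl, prod_child (fun _ => en v), enorm_mul, enorm_mul,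
        enorm_mul, enorm_coef, enorm_nlterm, enorm_prod_cj _ (fun _ => v)]
      rw [mul_one]
      refine mul_le_mul' le_rfl (mul_le_mul' ((mul_le_mul' ?_ le_rfl).trans (one_mul _).le) le_rfl)
      rw [← ofReal_norm, Complex.norm_real, ← ENNReal.ofReal_one]
      exact ENNReal.ofReal_le_ofReal (abs_totp_le N (sg_cases k) _ _ _)
  have e1 : cform (graft K (tot N)) t (fun _ => v) = ∑ k, ∑' z : (Fin n → ℤ) × ℤ × ℤ,
      coef K t z.1 * (((totp N (sg k) (z.1 k) z.2.1 z.2.2 : ℂ) * nlterm (sg k) t v (z.1 k) z.2) *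
        ∏ i ∈ Finset.univ.erase k, cj i (v (z.1 i))) := by
    rw [cform]
    have e2 : ∀ y, cterm (graft K (tot N)) t (fun _ => v) y = ∑ k, cterm (fun y =>
        K ((child k).symm y).1 * tot N k ((child k).symm y).1 ((child k).symm y).2.1
          ((child k).symm y).2.2) t (fun _ => v) y := by
      intro y
      simp only [cterm, coef, graft]
      push_cast
      rw [Finset.sum_mul, Finset.sum_mul]
    rw [tsum_congr e2, Summable.tsum_finsetSum]
    · refine Finset.sum_congr rfl fun k _ => ?_
      rw [← (child k).tsum_eq]
      exact tsum_congr (hterm k)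
    · intro k _
      rw [← (child k).summable_iff]
      exact (hsum k).congr fun z => (hterm k z).symm
  rw [e1, Finset.mul_sum]
  refine Finset.sum_congr rfl fun k _ => ?_
  rw [(hsum k).tsum_prod, ← tsum_mul_left]
  refine tsum_congr fun x => ?_
  dsimp only
  rw [cj_eq_cjs, cjs_rhs hr (sg_cases k) t hv hN, tsum_mul_left, tsum_mul_right]
  ring

/-- The derivative of a form along a classical solution. -/
theorem hasDerivAt_cform (hr : 1 / 2 < r) {ρ : ℝ} (hρ : ρ ≤ r) {C C₁ : ℝ≥0}
    (hK : Bdd K (fun _ => ρ) C) (hΦ : Bdd (fun x => K x * (Phi x : ℝ)) (fun _ => r) C₁)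
    {v : ℝ → H r} (hv : SolvesIn N r v) (t₀ : ℝ) :
    HasDerivAt (fun t => cform K t (fun _ => (v t : ℤ → ℂ)))
      (-Complex.I * cform (fun x => K x * (Phi x : ℝ)) t₀ (fun _ => (v t₀ : ℤ → ℂ)) +
        Complex.I * cform (graft K (tot N)) t₀ (fun _ => (v t₀ : ℤ → ℂ))) t₀ := by
  have hmem : ∀ t, MemH r (v t) := fun t => (v t).2
  have hKr : Bdd K (fun _ => r) C := hK.mono (fun _ => le_rfl) (fun _ => hρ) le_rfl
  obtain ⟨B, hB⟩ := tsum_slot_le (N := N) hr hρ hK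
  obtain ⟨B', hB'⟩ := exists_bdd_graft hr
  have hG : Bdd (graft K (tot N)) (fun _ => r) (n * C * B') :=
    hB' n K _ ρ C (fun k x a b => abs_totp_le N (sg_cases k) _ _ _) hρ hK
  set g : ℝ → ℂ := fun t => -Complex.I * cform (fun x => K x * (Phi x : ℝ)) t
    (fun _ => (v t : ℤ → ℂ)) + Complex.I * cform (graft K (tot N)) t (fun _ => (v t : ℤ → ℂ)) with hg
  have hgc : Continuous g :=
    (continuous_const.mul (hΦ.locLip.continuous hv.cont)).add
      (continuous_const.mul (hG.locLip.continuous hv.cont))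
  have hslot : ∀ t k, Summable fun x => coef K t x * (cj k (rhs N t (v t) (x k)) *
      ∏ i ∈ Finset.univ.erase k, cj i ((v t : ℤ → ℂ) (x i))) := fun t k =>
    Summable.of_enorm (ne_top_of_le_ne_top (by rw [nrm_en (hmem t)]; finiteness)
      (hB t (v t) (hmem t) (fun m hm => hv.supp m hm t) k))
  have hsum : ∀ t, ∑' x, dterm N K t (v t) x = g t := by
    intro t
    simp only [dterm]
    rw [Summable.tsum_add ((hΦ.summable t fun _ => hmem t).mul_left _)
      (summable_sum fun k _ => hslot t k), tsum_mul_left,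
      Summable.tsum_finsetSum fun k _ => hslot t k,
      tsum_coef_rhs hr hρ hK t (hmem t) (fun m hm => hv.supp m hm t)]
    rfl
  have hbound : ∀ t, ∑' x, ‖dterm N K t (v t) x‖ₑ ≤
      ENNReal.ofReal (C₁ * normH r (v t) ^ n + n * (B * normH r (v t) ^ (n + 2))) := by
    intro t
    have h0 := normH_nonneg r (v t)
    calc _ ≤ ∑' x, (‖cterm (fun x => K x * (Phi x : ℝ)) t (fun _ => (v t : ℤ → ℂ)) x‖ₑ +
          ∑ k, ‖coef K t x * (cj k (rhs N t (v t) (x k)) *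
            ∏ i ∈ Finset.univ.erase k, cj i ((v t : ℤ → ℂ) (x i)))‖ₑ) := by
          refine ENNReal.tsum_le_tsum fun x => ?_
          refine (enorm_add_le _ _).trans (add_le_add (le_of_eq ?_) (enorm_sum_le _ _))
          rw [enorm_mul, enorm_neg, ← ofReal_norm Complex.I, Complex.norm_I, ENNReal.ofReal_one,
            one_mul]
      _ = absForm (fun x => K x * (Phi x : ℝ)) (fun _ => en (v t)) +
          ∑ k, ∑' x, ‖coef K t x * (cj k (rhs N t (v t) (x k)) *
            ∏ i ∈ Finset.univ.erase k, cj i ((v t : ℤ → ℂ) (x i)))‖ₑ := by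
          rw [ENNReal.tsum_add, tsum_enorm_cterm, Summable.tsum_finsetSum fun _ _ =>
            ENNReal.summable]
      _ ≤ ENNReal.ofReal (C₁ * normH r (v t) ^ n) +
          ∑ k : Fin n, ENNReal.ofReal (B * normH r (v t) ^ (n + 2)) := by
          refine add_le_add ?_ (Finset.sum_le_sum fun k _ => ?_)
          · refine (hΦ.absForm_le fun _ => hmem t).trans (le_of_eq ?_)
            rw [Finset.prod_const, Finset.card_univ, Fintype.card_fin]
          · exact (hB t (v t) (hmem t) (fun m hm => hv.supp m hm t) k).trans
              (nrm_en_const_mul_le (hmem t) _)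
      _ = _ := by
          rw [Finset.sum_const, Finset.card_univ, Fintype.card_fin, nsmul_eq_mul,
            ENNReal.ofReal_add (by positivity) (by positivity),
            ENNReal.ofReal_mul (p := (n : ℝ)) (by positivity), ENNReal.ofReal_natCast]
  -- Measurability in t is free, since each term is a pointwise derivative.
  have hmeas : ∀ x, Measurable fun t => dterm N K t (v t) x := by
    intro x
    have : (fun t => dterm N K t (v t) x) =
        deriv (fun τ => cterm K τ (fun _ => (v τ : ℤ → ℂ)) x) :=
      funext fun t => (hasDerivAt_cterm hv x t).deriv.symm
    rw [this]
    exact measurable_deriv _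
  -- The bound `hbound` controls the sum of the term derivatives at each time, but supplies no
  -- summable majorant uniform in time. So the terms are integrated, sum and integral are exchanged,
  -- and the continuity of g then gives the derivative.
  have hint : ∀ a b : ℝ, a ≤ b → cform K b (fun _ => (v b : ℤ → ℂ)) -
      cform K a (fun _ => (v a : ℤ → ℂ)) = ∫ t in a..b, g t := by
    intro a b hab
    have hcont : Continuous fun t => C₁ * normH r (v t) ^ n + n * (B * normH r (v t) ^ (n + 2)) := by
      have := hv.cont.continuous_normH
      fun_prop
    obtain ⟨M, hM⟩ := (isCompact_Icc (a := a) (b := b)).bddAbove_image hcont.continuousOn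
    have hM' : ∀ t ∈ Set.Ioc a b, ∑' x, ‖dterm N K t (v t) x‖ₑ ≤ ENNReal.ofReal M := fun t ht =>
      (hbound t).trans (ENNReal.ofReal_le_ofReal (hM ⟨t, ⟨ht.1.le, ht.2⟩, rfl⟩))
    have hfin : ∑' x, ∫⁻ t in Set.Ioc a b, ‖dterm N K t (v t) x‖ₑ ≠ ⊤ := by
      rw [← MeasureTheory.lintegral_tsum fun x => (hmeas x).enorm.aemeasurable]
      refine ne_top_of_le_ne_top ?_ (MeasureTheory.setLIntegral_mono' measurableSet_Ioc hM')
      rw [MeasureTheory.setLIntegral_const, Real.volume_Ioc]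
      finiteness
    rw [intervalIntegral.integral_of_le hab]
    simp only [← hsum]
    rw [MeasureTheory.integral_tsum (fun x => (hmeas x).aestronglyMeasurable) hfin, cform, cform,
      ← (hKr.summable b fun _ => hmem b).tsum_sub (hKr.summable a fun _ => hmem a)]
    refine tsum_congr fun x => ?_
    rw [← intervalIntegral.integral_of_le hab]
    refine (intervalIntegral.integral_eq_sub_of_hasDerivAt
      (fun t _ => hasDerivAt_cterm hv x t) ?_).symm
    rw [intervalIntegrable_iff_integrableOn_Ioc_of_le hab]
    refine ⟨(hmeas x).aestronglyMeasurable, ?_⟩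
    exact lt_of_le_of_lt (ENNReal.le_tsum x) (lt_top_iff_ne_top.2 hfin)
  have h1 : HasDerivAt (fun t => cform K (t₀ - 1) (fun _ => (v (t₀ - 1) : ℤ → ℂ)) +
      ∫ τ in (t₀ - 1)..t, g τ) (g t₀) t₀ :=
    (hgc.integral_hasStrictDerivAt (t₀ - 1) t₀).hasDerivAt.const_add _
  refine h1.congr_of_eventuallyEq ?_
  filter_upwards [eventually_ge_nhds (show t₀ - 1 < t₀ by linarith)] with t ht
  rw [← hint _ _ ht, add_sub_cancel]

end Derivative

/-! ### Classical solutions are smooth -/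

theorem ContH.mono {r r' : ℝ} (h : r ≤ r') {v : ℝ → ℤ → ℂ} (hv : ContH r' v) : ContH r v := by
  refine ⟨fun t => (hv.1 t).mono h, fun t => ?_⟩
  refine squeeze_zero (fun _ => normH_nonneg _ _) (fun τ => normH_mono h ?_) (hv.2 t)
  exact (H r').sub_mem (hv.1 τ) (hv.1 t)

theorem contH_of_finite {r : ℝ} {v : ℝ → ℤ → ℂ} (S : Finset ℤ) (hS : ∀ n ∉ S, ∀ t, v t n = 0)
    (hc : ∀ n, Continuous fun t => v t n) : ContH r v := by
  refine ⟨fun t => summable_of_ne_finset_zero (s := S) fun n hn => by simp [hS n hn t],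
    fun t => ?_⟩
  have h1 : ∀ τ, normH r (v τ - v t) = √(∑ n ∈ S, weight r n * ‖v τ n - v t n‖ ^ 2) := by
    intro τ
    rw [normH, tsum_eq_sum (s := S)]
    · rfl
    · intro n hn
      simp [hS n hn]
  have h2 : Continuous fun τ => √(∑ n ∈ S, weight r n * ‖v τ n - v t n‖ ^ 2) := by
    refine Real.continuous_sqrt.comp (continuous_finsetSum _ fun n _ => ?_)
    have := hc n
    fun_prop
  have h3 := h2.tendsto t
  simp only [sub_self, norm_zero, ne_eq, OfNat.ofNat_ne_zero, not_false_eq_true, zero_pow, mul_zero,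
    Finset.sum_const_zero, Real.sqrt_zero] at h3
  exact h3.congr fun τ => (h1 τ).symm

/-- For finite N only finitely many modes are active, so any exponent above 1/2 will do; 1 is
chosen. Both cases are thereby treated as solutions in an algebra. -/
theorem IsClassicalSolution.exists_solvesIn {N : ℕ∞} {v : ℝ → ℤ → ℂ}
    (hv : IsClassicalSolution N v) : ∃ r : ℝ, 1 / 2 < r ∧ ∃ u : ℝ → H r,
      SolvesIn N r u ∧ ∀ t, (u t : ℤ → ℂ) = v t := by
  obtain ⟨h1, h2, h3⟩ := hv
  have hd : ∀ (m : ℤ) (t : ℝ), HasDerivAt (fun τ => v τ m) (rhs N t (v t) m) t := by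
    intro m t
    rw [rhs]
    split_ifs with hm
    · exact h2 m hm t
    · have : (fun τ => v τ m) = fun _ => 0 := funext fun τ => h3 m (not_le.1 hm) τ
      rw [this]
      exact hasDerivAt_const _ _
  have key : ∃ r : ℝ, 1 / 2 < r ∧ ContH r v := by
    by_cases hN : N = ⊤
    · exact h1 hN
    · lift N to ℕ using hN
      refine ⟨1, by norm_num, contH_of_finite (Finset.Icc (-(N : ℤ)) N) (fun n hn t => ?_)
        fun n => continuous_iff_continuousAt.2 fun t => (hd n t).continuousAt⟩
      refine h3 n ?_ t
      rw [Finset.mem_Icc] at hn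
      have : N < n.natAbs := by omega
      exact_mod_cast this
  obtain ⟨r, hr, hc⟩ := key
  exact ⟨r, hr, fun t => ⟨v t, hc.1 t⟩, ⟨hc, hd, h3⟩, fun _ => rfl⟩

/-! ### The energy as a form -/

theorem re_cform_L_one {s : ℝ} {N : ℕ∞} (t : ℝ) {v : ℤ → ℂ} :
    (cform (n := 2) (L s N 1) t (fun _ => v)).re = -(1 / 2 * normH s v ^ 2) := by
  have h1 : cform (n := 2) (L s N 1) t (fun _ => v) =
      ∑' m : ℤ, ((-(1 / 2) * (weight s m * ‖v m‖ ^ 2) : ℝ) : ℂ) := by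
    have hinj : Function.Injective (fun m : ℤ => (fun _ : Fin 2 => m)) := fun a b h =>
      congrFun h 0
    rw [cform, ← hinj.tsum_eq]
    · refine tsum_congr fun m => ?_
      have hΦ : Phi (fun _ : Fin 2 => m) = 0 := by simp [Phi, Fin.sum_univ_two, sg]
      rw [cterm, coef, hΦ, Fin.prod_univ_two, L_one_apply, if_pos rfl, cj_eq_cjs, cj_eq_cjs,
        show sg (0 : Fin 2) = 1 from rfl, show sg (1 : Fin 2) = -1 from rfl, cjs_one, cjs_neg_one,
        Complex.mul_conj, Complex.normSq_eq_norm_sq]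
      push_cast
      simp
      ring
    · intro x hx
      have hL : L s N 1 x ≠ 0 := by
        intro h0
        exact hx (by simp [cterm, coef, h0])
      rw [L_one_apply] at hL
      refine ⟨x 0, ?_⟩
      have h01 : x 0 = x 1 := by
        by_contra h'; simp [h'] at hL
      ext i
      fin_cases i
      · rfl
      · exact h01
  rw [h1, ← Complex.ofReal_tsum, Complex.ofReal_re, tsum_mul_left, normH,
    Real.sq_sqrt (tsum_nonneg fun n => mul_nonneg (weight_nonneg _ _) (sq_nonneg _))]
  ring

/-- The parent phase vanishes on the diagonal, so the region would require a zero increment, which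
non-resonance excludes. -/
theorem graft_L_one_low (s : ℝ) (N : ℕ∞) (y : Fin 4 → ℤ) :
    graft (n := 2) (L s N 1) (low N) y = 0 := by
  refine Finset.sum_eq_zero fun k _ => ?_
  by_cases hx : L s N 1 ((child k).symm y).1 = 0
  · rw [hx, zero_mul]
  · rw [low, if_neg, mul_zero]
    rintro ⟨h1, -, h2⟩
    rw [Phi_eq_zero_of_L_one hx] at h2
    simp only [zero_add, abs_zero, mul_zero] at h2
    have h3 := dph_pos (sg_cases k) h1
    have h4 := abs_nonpos_iff.1 h2
    rw [h4] at h3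
    simp at h3

/-- The term i|v|²v does not change |v_n|: its contributions from v and from its conjugate cancel
already in the kernel. -/
theorem graft_L_one_resn (s : ℝ) (N : ℕ∞) (y : Fin 4 → ℤ) :
    graft (n := 2) (L s N 1) resn y = 0 := by
  have hadd : ∀ k : Fin 2, L s N 1 ((child k).symm y).1 *
      resn k ((child k).symm y).1 ((child k).symm y).2.1 ((child k).symm y).2.2 =
      if y 0 = y 1 ∧ y 2 = y 0 ∧ y 3 = y 0 then -(weight s (y 0) / 2) * (sg k : ℝ) else 0 := by
    intro k
    obtain ⟨⟨x, a, b⟩, rfl⟩ := (child k).surjective y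
    rw [Equiv.symm_apply_apply, child_zero, child_one, L_one_apply, resn,
      show (2 : Fin 4) = Fin.succ (Fin.succ (0 : Fin 2)) from rfl,
      show (3 : Fin 4) = Fin.succ (Fin.succ (1 : Fin 2)) from rfl, child_succ_succ,
      child_succ_succ]
    by_cases hab : a = b
    · subst hab
      simp only [sub_self, mul_zero, sub_zero, Function.update_eq_self, Res, true_and]
      fin_cases k
      · simp only [Fin.zero_eta]
        by_cases h0 : x 0 = a
        · by_cases h1 : x 1 = a
          · simp [h0, h1]
          · simp [h0, h1, Ne.symm h1]
        · simp [h0]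
      · simp only [Fin.mk_one]
        by_cases h0 : x 0 = a
        · by_cases h1 : x 1 = a
          · simp [h0, h1]
          · simp [h1]
        · by_cases h1 : x 1 = a
          · simp [h0, h1]
          · simp [h0, h1]
    · simp [Res, hab]
  rw [graft, Fin.sum_univ_two, hadd, hadd]
  split_ifs
  · simp [sg]
  · simp

theorem cform_add {n : ℕ} {K₁ K₂ : (Fin n → ℤ) → ℝ} {r : ℝ} {C₁ C₂ : ℝ≥0}
    (h₁ : Bdd K₁ (fun _ => r) C₁) (h₂ : Bdd K₂ (fun _ => r) C₂) (t : ℝ) (f : H r) :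
    cform (fun x => K₁ x + K₂ x) t (fun _ => (f : ℤ → ℂ)) =
      cform K₁ t (fun _ => (f : ℤ → ℂ)) + cform K₂ t (fun _ => (f : ℤ → ℂ)) := by
  rw [cform, cform, cform, ← (h₁.summable t fun _ => f.2).tsum_add (h₂.summable t fun _ => f.2)]
  refine tsum_congr fun x => ?_
  simp only [cterm, coef]
  push_cast
  ring

theorem cform_zero {n : ℕ} {K : (Fin n → ℤ) → ℝ} (hK : ∀ x, K x = 0) (t : ℝ)
    (f : Fin n → ℤ → ℂ) : cform K t f = 0 := by
  rw [cform]
  simp [cterm, coef, hK]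

theorem cform_graft_tot {N : ℕ∞} {n : ℕ} {K : (Fin n → ℤ) → ℝ} {r t : ℝ} {C : ℝ≥0}
    (hr : 1 / 2 < r) (ht : t ≤ r) (hK : Bdd K (fun _ => t) C) (τ : ℝ) (f : H r) :
    cform (graft K (tot N)) τ (fun _ => (f : ℤ → ℂ)) =
      cform (graft K (high N)) τ (fun _ => (f : ℤ → ℂ)) +
      cform (graft K (low N)) τ (fun _ => (f : ℤ → ℂ)) +
      cform (graft K resn) τ (fun _ => (f : ℤ → ℂ)) := by
  obtain ⟨B, hB⟩ := exists_bdd_graft hr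
  have h1 := hB n K (high N) t C abs_high_le ht hK
  have h2 := hB n K (low N) t C abs_low_le ht hK
  have h3 := hB n K resn t C abs_resn_le ht hK
  have e1 : graft K (tot N) = fun y => (graft K (high N) y + graft K (low N) y) +
      graft K resn y := by
    ext y
    simp only [graft, ← Finset.sum_add_distrib, ← mul_add, high_add_low_add_resn]
  have h12 : Bdd (fun y => graft K (high N) y + graft K (low N) y) (fun _ => r)
      (n * C * B) := by
    have e2 : (fun y => graft K (high N) y + graft K (low N) y) =
        graft K (fun k x a b => high N k x a b + low N k x a b) := by
      ext y
      simp only [graft, ← Finset.sum_add_distrib, ← mul_add]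
    rw [e2]
    refine hB n K _ t C (fun k x a b => ?_) ht hK
    unfold high low
    by_cases h : 4 * |Phi x| < |Phi x + dph (sg k) (x k) a b|
    · simp only [h, not_le.2 h, and_true, and_false, if_false, add_zero]
      split_ifs <;> simp [abs_sg]
    · simp only [h, not_lt.1 h, and_true, and_false, if_false, zero_add]
      split_ifs <;> simp [abs_sg]
  rw [e1, cform_add h12 h3, cform_add h1 h2]

/-! ### The energy and the boundary terms along classical solutions -/

theorem hasDerivAt_energy {s : ℝ} {N : ℕ∞} {r : ℝ} (hs : s ≤ 1 / 2) (hr : 1 / 2 < r)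
    {v : ℝ → H r} (hv : SolvesIn N r v) (t : ℝ) :
    HasDerivAt (fun τ => 1 / 2 * normH s (v τ) ^ 2)
      (cform (graft (L s N 1) (high N)) t (fun _ => (v t : ℤ → ℂ))).im t := by
  have hK : Bdd (L s N 1) (fun _ => s) 1 := bdd_L_one (by ring)
  have h0 : ∀ x : Fin (2 * 1) → ℤ, L s N 1 x * (Phi x : ℝ) = 0 := fun x => by
    by_cases hx : L s N 1 x = 0
    · rw [hx, zero_mul]
    · rw [show Phi x = 0 from Phi_eq_zero_of_L_one hx, Int.cast_zero, mul_zero]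
  have hΦ : Bdd (fun x => L s N 1 x * (Phi x : ℝ)) (fun _ => r) 1 :=
    hK.mono (fun x => by rw [h0, abs_zero]; exact abs_nonneg _) (fun _ => by linarith) le_rfl
  have h1 := hasDerivAt_cform hr (by linarith : s ≤ r) hK hΦ hv t
  have h2 := (Complex.reCLM.hasFDerivAt.comp_hasDerivAt t h1).neg
  refine (h2.congr_of_eventuallyEq (Eventually.of_forall fun τ => ?_)).congr_deriv ?_
  · have := re_cform_L_one (s := s) (N := N) τ (v := v τ)
    change _ = -(cform (L s N 1) τ (fun _ => (v τ : ℤ → ℂ))).re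
    rw [show (cform (L s N 1) τ (fun _ => (v τ : ℤ → ℂ))).re = _ from this, neg_neg]
  · rw [cform_graft_tot hr (by linarith : s ≤ r) hK, cform_zero h0,
      cform_zero (K := graft (L s N 1) (low N)) (graft_L_one_low s N),
      cform_zero (K := graft (L s N 1) resn) (graft_L_one_resn s N)]
    simp

/-- One step of the recursion. The unreduced `high` terms need only be finite on H^r; they disappear
from the final identity by telescoping. -/
theorem hasDerivAt_boundary {s σ : ℝ} {N : ℕ∞} {r : ℝ} (hr : 1 / 2 < r) (hσ : σ ≤ r) (j : ℕ)
    {C C₁ : ℝ≥0} (hK : Bdd (L s N (j + 2)) (fun _ => σ) C)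
    (hK₁ : Bdd (graft (L s N (j + 1)) (high N)) (fun _ => r) C₁) {v : ℝ → H r}
    (hv : SolvesIn N r v) (t : ℝ) :
    HasDerivAt (fun τ => (cform (L s N (j + 2)) τ (fun _ => (v τ : ℤ → ℂ))).re)
      ((cform (graft (L s N (j + 1)) (high N)) t (fun _ => (v t : ℤ → ℂ))).im -
        (cform (graft (L s N (j + 2)) (high N)) t (fun _ => (v t : ℤ → ℂ))).im -
        (cform (graft (L s N (j + 2)) (low N)) t (fun _ => (v t : ℤ → ℂ))).im -
        (cform (graft (L s N (j + 2)) resn) t (fun _ => (v t : ℤ → ℂ))).im) t := by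
  have e : (fun x : Fin (2 * (j + 1) + 2) → ℤ => L s N (j + 2) x * (Phi x : ℝ)) =
      graft (L s N (j + 1)) (high N) := funext fun y => (graft_high_eq j y).symm
  have h1 := hasDerivAt_cform hr hσ hK (C₁ := C₁) (by rw [← e] at hK₁; exact hK₁) hv t
  refine (Complex.reCLM.hasFDerivAt.comp_hasDerivAt t h1).congr_deriv ?_
  rw [cform_graft_tot hr hσ hK, show cform (fun x => L s N (j + 2) x * (Phi x : ℝ)) t
    (fun _ => (v t : ℤ → ℂ)) = cform (graft (L s N (j + 1)) (high N)) t
      (fun _ => (v t : ℤ → ℂ)) by rw [← e]; rfl]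
  simp only [Complex.reCLM_apply, Complex.add_re, Complex.mul_re, Complex.neg_re, Complex.I_re,
    Complex.neg_im, Complex.I_im, Complex.add_im]
  ring

/-! ### Superexponentially convergent series of forms -/

theorem SuperexpDecay.summable {C : ℕ → ℝ} (h : SuperexpDecay C) (K : ℝ) :
    Summable fun j => C j * K ^ j := by
  obtain ⟨M, hM⟩ := (h.2 (2 * |K|)).bddAbove_range
  refine Summable.of_norm_bounded (g := fun j => M * (1 / 2) ^ j)
    ((summable_geometric_of_lt_one (by norm_num) (by norm_num)).mul_left _) fun j => ?_
  have h1 : C j * (2 * |K|) ^ j ≤ M := hM ⟨j, rfl⟩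
  rw [norm_mul, norm_pow, Real.norm_of_nonneg (h.1 j).le, Real.norm_eq_abs]
  calc C j * |K| ^ j = C j * (2 * |K|) ^ j * (1 / 2) ^ j := by
        rw [mul_assoc, ← mul_pow]; congr 2; ring
    _ ≤ _ := by gcongr

section Series

variable {σ : ℝ} {d : ℕ → ℕ} {A : (j : ℕ) → ℝ → Form σ (d j)} {C : ℕ → ℝ}

theorem BoundedBy.norm_diag_le (hC : SuperexpDecay C) (hb : BoundedBy A C)
    (hd : ∀ j, d j ≤ 2 * j + 2) {R : ℝ} (hR : 1 ≤ R) (t : ℝ) {f : H σ} (hf : normH σ f ≤ R)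
    (k : ℕ) : ‖A (k + 2) t (fun _ => f)‖ ≤ R ^ 2 * (C (k + 2) * (R ^ 2) ^ (k + 2)) := by
  rw [Real.norm_eq_abs]
  refine (hb (k + 2) (by omega) t _).trans ?_
  rw [Finset.prod_const, Finset.card_univ, Fintype.card_fin]
  have h0 := normH_nonneg σ f
  have hC0 := (hC.1 (k + 2)).le
  calc C (k + 2) * normH σ f ^ d (k + 2) ≤ C (k + 2) * R ^ (2 * (k + 2) + 2) := by
        gcongr
        exact (pow_le_pow_left₀ h0 hf _).trans (pow_le_pow_right₀ hR (hd _))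
    _ = _ := by rw [pow_add, pow_mul]; ring

theorem summable_majorant (hC : SuperexpDecay C) (R : ℝ) :
    Summable fun k => R ^ 2 * (C (k + 2) * (R ^ 2) ^ (k + 2)) :=
  ((summable_nat_add_iff 2).2 (hC.summable (R ^ 2))).mul_left _

theorem BoundedBy.summable (hC : SuperexpDecay C) (hb : BoundedBy A C)
    (hd : ∀ j, d j ≤ 2 * j + 2) (t : ℝ) (f : H σ) :
    Summable fun k : ℕ => A (k + 2) t (fun _ => f) :=
  Summable.of_norm_bounded (summable_majorant hC (max 1 (normH σ f)))
    (hb.norm_diag_le hC hd (le_max_left _ _) t (le_max_right _ _))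

theorem BoundedBy.locLip (hC : SuperexpDecay C) (hb : BoundedBy A C) (hd : ∀ j, d j ≤ 2 * j + 2)
    (hc : ∀ j, 2 ≤ j → ∀ f : H σ, Continuous fun t => A j t (fun _ => f)) :
    LocLip (fun t (f : H σ) => diagSum (fun j => A j t) f) where
  lip R := by
    set R' := max 1 R with hR'
    have hR1 : 1 ≤ R' := le_max_left _ _
    have hC' := hC.mul_succ (D := 2) two_pos
    have hs := summable_majorant hC' R'
    refine ⟨∑' k : ℕ, R' ^ 2 * (2 * ((k + 2 : ℕ) + 1) * C (k + 2) * (R' ^ 2) ^ (k + 2)),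
      fun t f g hf hg => ?_⟩
    rw [diagSum, diagSum, ← (hb.summable hC hd t f).tsum_sub (hb.summable hC hd t g),
      ← tsum_mul_right]
    refine tsum_of_norm_bounded (hs.mul_right _).hasSum fun k => ?_
    have hC0 := (hC.1 (k + 2)).le
    refine (norm_diag_sub_le (A (k + 2) t) hC0 (fun f => hb (k + 2) (by omega) t f)
      (hf.trans (le_max_right 1 R)) (hg.trans (le_max_right 1 R))).trans ?_
    refine mul_le_mul_of_nonneg_right ?_ (normH_nonneg _ _)
    have h1 : R' ^ (d (k + 2) - 1) ≤ R' ^ 2 * (R' ^ 2) ^ (k + 2) := by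
      rw [← pow_mul, ← pow_add]
      refine pow_le_pow_right₀ hR1 ?_
      have := hd (k + 2)
      omega
    have h2 : (d (k + 2) : ℝ) ≤ 2 * ((k + 2 : ℕ) + 1) := by
      have := hd (k + 2)
      exact_mod_cast (by omega : d (k + 2) ≤ 2 * ((k + 2) + 1))
    calc _ ≤ C (k + 2) * (2 * ((k + 2 : ℕ) + 1)) * (R' ^ 2 * (R' ^ 2) ^ (k + 2)) := by gcongr
      _ = _ := by ring
  cont f := continuous_tsum (fun k => hc (k + 2) (by omega) f)
    (summable_majorant hC (max 1 (normH σ f)))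
    fun k t => hb.norm_diag_le hC hd (le_max_left _ _) t (le_max_right _ _) k

end Series

/-! ### The real-valued forms -/

section RealForms

variable {σ : ℝ} {n : ℕ} {K : (Fin n → ℤ) → ℝ} {C : ℝ≥0}

open Classical in
/-- The real part of the form with kernel `K`. -/
def reForm (σ : ℝ) (K : (Fin n → ℤ) → ℝ) (t : ℝ) : Form σ n :=
  -- The value 0 for unbounded kernels only makes the definition total; the kernels used for j ≥ 2
  -- are all bounded.
  if h : ∃ C : ℝ≥0, Bdd K (fun _ => σ) C then
    Complex.reLm.compMultilinearMap (mform h.choose_spec t) else 0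

open Classical in
/-- The imaginary part of the form with kernel `K`. -/
def imForm (σ : ℝ) (K : (Fin n → ℤ) → ℝ) (t : ℝ) : Form σ n :=
  if h : ∃ C : ℝ≥0, Bdd K (fun _ => σ) C then
    Complex.imLm.compMultilinearMap (mform h.choose_spec t) else 0

theorem reForm_apply (h : Bdd K (fun _ => σ) C) (t : ℝ) (f : Fin n → H σ) :
    reForm σ K t f = (cform K t (fun k => f k)).re := by
  rw [reForm, dif_pos ⟨C, h⟩]
  rfl

theorem imForm_apply (h : Bdd K (fun _ => σ) C) (t : ℝ) (f : Fin n → H σ) :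
    imForm σ K t f = (cform K t (fun k => f k)).im := by
  rw [imForm, dif_pos ⟨C, h⟩]
  rfl

theorem abs_reForm_le (h : Bdd K (fun _ => σ) C) (t : ℝ) (f : Fin n → H σ) :
    |reForm σ K t f| ≤ C * ∏ k, normH σ (f k) := by
  rw [reForm_apply h]
  exact (Complex.abs_re_le_norm _).trans (h.norm_cform_le t fun k => (f k).2)

theorem abs_imForm_le (h : Bdd K (fun _ => σ) C) (t : ℝ) (f : Fin n → H σ) :
    |imForm σ K t f| ≤ C * ∏ k, normH σ (f k) := by
  rw [imForm_apply h]
  exact (Complex.abs_im_le_norm _).trans (h.norm_cform_le t fun k => (f k).2)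

theorem continuous_reForm (h : Bdd K (fun _ => σ) C) (f : H σ) :
    Continuous fun t => reForm σ K t (fun _ => f) := by
  simp only [reForm_apply h]
  exact Complex.continuous_re.comp (h.locLip.cont f)

theorem continuous_imForm (h : Bdd K (fun _ => σ) C) (f : H σ) :
    Continuous fun t => imForm σ K t (fun _ => f) := by
  simp only [imForm_apply h]
  exact Complex.continuous_im.comp (h.locLip.cont f)

end RealForms

/-! ### The energy identity for classical solutions -/

/-- The boundary series is differentiated termwise on a unit neighbourhood of the given time, with
the superexponential constants as majorants; the derivatives telescope. -/
theorem energyIdentity_of_bounds {s σ : ℝ} {N : ℕ∞} (hs : s ≤ 1 / 2) (hσ : σ ≤ 0)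
    {C₀ C₁ C₂ : ℕ → ℝ≥0} (h₀ : SuperexpDecay (fun j => (C₀ j : ℝ)))
    (h₁ : SuperexpDecay (fun j => (C₁ j : ℝ))) (h₂ : SuperexpDecay (fun j => (C₂ j : ℝ)))
    (hL : ∀ j, Bdd (L s N (j + 2)) (fun _ => σ) (C₀ (j + 2)))
    (hlow : ∀ j, Bdd (graft (L s N (j + 2)) (low N)) (fun _ => σ) (C₁ (j + 2)))
    (hres : ∀ j, Bdd (graft (L s N (j + 2)) resn) (fun _ => σ) (C₂ (j + 2)))
    {v : ℝ → H σ} (hv : IsClassicalSolution N (fun t => (v t : ℤ → ℂ))) :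
    EnergyIdentity s (fun j => reForm σ (L s N j)) (fun j => imForm σ (graft (L s N j) (low N)))
      (fun j => imForm σ (graft (L s N j) resn)) v := by
  obtain ⟨r, hr, u, hu, huv⟩ := hv.exists_solvesIn
  have hσr : σ ≤ r := by linarith
  obtain ⟨B, hB⟩ := exists_bdd_graft hr
  refine ⟨fun t => by rw [← huv]; exact MemH.mono (by linarith) (u t).2, fun t₀ => ?_⟩
  set a : ℕ → ℝ → ℝ := fun j t =>
    (cform (graft (L s N (j + 1)) (high N)) t (fun _ => (u t : ℤ → ℂ))).im with ha
  set b : ℕ → ℝ → ℝ := fun j t =>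
    (cform (graft (L s N (j + 2)) (low N)) t (fun _ => (u t : ℤ → ℂ))).im with hb
  set c : ℕ → ℝ → ℝ := fun j t =>
    (cform (graft (L s N (j + 2)) resn) t (fun _ => (u t : ℤ → ℂ))).im with hc
  obtain ⟨M, hM⟩ := (isCompact_Icc (a := t₀ - 1) (b := t₀ + 1)).bddAbove_image
    hu.cont.continuous_normH.continuousOn
  set R : ℝ := max 1 M with hR
  have hR1 : 1 ≤ R := le_max_left _ _
  have huR : ∀ t ∈ Set.Ioo (t₀ - 1) (t₀ + 1), normH r (u t) ≤ R := fun t ht =>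
    (hM ⟨t, ⟨ht.1.le, ht.2.le⟩, rfl⟩).trans (le_max_right _ _)
  have hgb : ∀ (j : ℕ) (K : (Fin (2 * j + 2) → ℤ) → ℝ) (C : ℝ≥0), Bdd K (fun _ => r) C →
      ∀ t ∈ Set.Ioo (t₀ - 1) (t₀ + 1), |(cform K t (fun _ => (u t : ℤ → ℂ))).im| ≤
        R ^ 2 * (C * (R ^ 2) ^ j) := by
    intro j K C hK t ht
    refine (Complex.abs_im_le_norm _).trans ((hK.norm_cform_le t fun _ => (u t).2).trans ?_)
    rw [Finset.prod_const, Finset.card_univ, Fintype.card_fin]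
    calc (C : ℝ) * normH r (u t) ^ (2 * j + 2) ≤ C * R ^ (2 * j + 2) := by
          gcongr
          · exact normH_nonneg _ _
          · exact huR t ht
      _ = _ := by rw [pow_add, pow_mul]; ring
  have hA₀ : Bdd (graft (L s N 1) (high N)) (fun _ => r) ((2 * 1 : ℕ) * 1 * B) :=
    hB _ (L s N 1) (high N) s 1 abs_high_le (by linarith) (bdd_L_one (by ring))
  have hA₁ : ∀ j, Bdd (graft (L s N (j + 2)) (high N)) (fun _ => r)
      ((2 * (j + 2) : ℕ) * C₀ (j + 2) * B) := fun j =>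
    hB _ _ (high N) σ _ abs_high_le hσr (hL j)
  have hA : ∀ j, ∃ C : ℝ≥0, Bdd (graft (L s N (j + 1)) (high N)) (fun _ => r) C := by
    rintro (_ | j)
    · exact ⟨_, hA₀⟩
    · exact ⟨_, hA₁ j⟩
  set ua : ℕ → ℝ := fun j => R ^ 2 * (2 * ((j + 2 : ℕ) + 1) * C₀ (j + 2) * (R ^ 2) ^ (j + 2)) * B
    with hua
  have hua_sum : Summable ua :=
    (summable_majorant (h₀.mul_succ (D := 2) two_pos) R).mul_right _
  have hab : ∀ j, ∀ t ∈ Set.Ioo (t₀ - 1) (t₀ + 1), |a (j + 1) t| ≤ ua j := by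
    intro j t ht
    refine (hgb (j + 2) _ _ (hA₁ j) t ht).trans ?_
    have hB0 : (0 : ℝ) ≤ B := B.2
    have hC0 : (0 : ℝ) ≤ C₀ (j + 2) := (C₀ (j + 2)).2
    rw [hua]
    push_cast
    have hj : 2 * ((j : ℝ) + 2) ≤ 2 * ((j : ℝ) + 2 + 1) := by linarith
    have := mul_le_mul_of_nonneg_right (mul_le_mul_of_nonneg_right
      (mul_le_mul_of_nonneg_right hj hC0) hB0) (by positivity : 0 ≤ (R ^ 2) ^ (j + 2))
    nlinarith [mul_le_mul_of_nonneg_left this (sq_nonneg R)]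
  -- The term with index 0 comes from `L 1`, which is bounded on H^s rather than H^σ, and has its
  -- own majorant.
  set va : ℕ → ℝ := fun j => Nat.casesOn j (R ^ 2 * (((2 * 1 : ℕ) * 1 * B : ℝ≥0) * (R ^ 2) ^ 1)) ua
    with hva
  have hva_sum : Summable va := (summable_nat_add_iff 1).1 hua_sum
  have hav : ∀ j, ∀ t ∈ Set.Ioo (t₀ - 1) (t₀ + 1), |a j t| ≤ va j := by
    rintro (_ | j) t ht
    · exact hgb 1 _ _ hA₀ t ht
    · exact hab j t ht
  set ub : ℕ → ℝ := fun j => R ^ 2 * (C₁ (j + 2) * (R ^ 2) ^ (j + 2)) with hub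
  set uc : ℕ → ℝ := fun j => R ^ 2 * (C₂ (j + 2) * (R ^ 2) ^ (j + 2)) with huc
  have hub_sum : Summable ub := summable_majorant h₁ R
  have huc_sum : Summable uc := summable_majorant h₂ R
  have hbb : ∀ j, ∀ t ∈ Set.Ioo (t₀ - 1) (t₀ + 1), |b j t| ≤ ub j := fun j t ht =>
    hgb (j + 2) _ _ ((hlow j).mono (fun _ => le_rfl) (fun _ => hσr) le_rfl) t ht
  have hcb : ∀ j, ∀ t ∈ Set.Ioo (t₀ - 1) (t₀ + 1), |c j t| ≤ uc j := fun j t ht =>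
    hgb (j + 2) _ _ ((hres j).mono (fun _ => le_rfl) (fun _ => hσr) le_rfl) t ht
  have ht₀ : t₀ ∈ Set.Ioo (t₀ - 1) (t₀ + 1) := by constructor <;> linarith
  have hder : HasDerivAt (fun t => ∑' j, (cform (L s N (j + 2)) t (fun _ => (u t : ℤ → ℂ))).re)
      (∑' j, (a j t₀ - a (j + 1) t₀ - b j t₀ - c j t₀)) t₀ := by
    refine hasDerivAt_tsum_of_isPreconnected (u := fun j => va j + va (j + 1) + ub j + uc j)
      (((hva_sum.add ((summable_nat_add_iff 1).2 hva_sum)).add hub_sum).add huc_sum)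
      isOpen_Ioo isPreconnected_Ioo
      (g' := fun j t => a j t - a (j + 1) t - b j t - c j t)
      (fun j t _ => hasDerivAt_boundary hr hσr j (hL j) (hA j).choose_spec hu t) (fun j t ht => ?_)
      ht₀ ?_ ht₀
    · rw [Real.norm_eq_abs]
      have e1 := abs_le.1 (hav j t ht)
      have e2 := abs_le.1 (hav (j + 1) t ht)
      have e3 := abs_le.1 (hbb j t ht)
      have e4 := abs_le.1 (hcb j t ht)
      exact abs_le.2 ⟨by linarith [e1.1, e2.2, e3.2, e4.2], by linarith [e1.2, e2.1, e3.1, e4.1]⟩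
    · refine Summable.of_norm_bounded
        (g := fun j => R ^ 2 * (C₀ (j + 2) * (R ^ 2) ^ (j + 2))) (summable_majorant h₀ R)
        fun j => ?_
      refine (Complex.abs_re_le_norm _).trans (((hL j).norm_cform_le t₀ fun _ =>
        (MemH.mono hσr (u t₀).2)).trans ?_)
      rw [Finset.prod_const, Finset.card_univ, Fintype.card_fin]
      have h4 : normH σ (u t₀) ≤ R := (normH_mono hσr (u t₀).2).trans (huR t₀ ht₀)
      calc (C₀ (j + 2) : ℝ) * normH σ (u t₀) ^ (2 * (j + 2)) ≤
            C₀ (j + 2) * (R ^ 2) ^ (j + 2) := by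
            rw [← pow_mul]
            gcongr
            exact normH_nonneg _ _
        _ ≤ _ := by
            refine le_mul_of_one_le_left (mul_nonneg (C₀ (j + 2)).2 (by positivity)) ?_
            exact one_le_pow₀ hR1
  have hsa : Summable fun j => a j t₀ := Summable.of_norm_bounded hva_sum fun j => hav j t₀ ht₀
  have hsb : Summable fun j => b j t₀ := Summable.of_norm_bounded hub_sum fun j => hbb j t₀ ht₀
  have hsc : Summable fun j => c j t₀ := Summable.of_norm_bounded huc_sum fun j => hcb j t₀ ht₀
  have hsa' : Summable fun j => a (j + 1) t₀ := (summable_nat_add_iff 1).2 hsa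
  -- No boundary term at infinity survives, since the `high` terms are summable.
  have htel : ∑' j, (a j t₀ - a (j + 1) t₀ - b j t₀ - c j t₀) =
      a 0 t₀ - ∑' j, b j t₀ - ∑' j, c j t₀ := by
    rw [((hsa.sub hsa').sub hsb).tsum_sub hsc, (hsa.sub hsa').tsum_sub hsb, hsa.tsum_sub hsa',
      hsa.tsum_eq_zero_add]
    ring
  rw [htel] at hder
  refine ⟨a 0 t₀ - ∑' j, b j t₀ - ∑' j, c j t₀, ?_, ?_⟩
  · refine hder.congr_of_eventuallyEq (Eventually.of_forall fun t => ?_)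
    refine tsum_congr fun j => ?_
    rw [reForm_apply (hL j), huv]
  · have h5 := hasDerivAt_energy hs hr hu t₀
    have e1 : diagSum (fun j => imForm σ (graft (L s N j) (low N)) t₀) (v t₀) = ∑' j, b j t₀ :=
      tsum_congr fun j => by rw [imForm_apply (hlow j), ← huv]
    have e2 : diagSum (fun j => imForm σ (graft (L s N j) resn) t₀) (v t₀) = ∑' j, c j t₀ :=
      tsum_congr fun j => by rw [imForm_apply (hres j), ← huv]
    rw [e1, e2, show a 0 t₀ - ∑' j, b j t₀ - ∑' j, c j t₀ + ∑' j, b j t₀ + ∑' j, c j t₀ = a 0 t₀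
      by ring]
    simp only [huv] at h5
    refine h5.congr_deriv ?_
    simp only [ha, huv]

/-! ### The energy identity for rough solutions -/

theorem IsClassicalSolution.contH {N : ℕ∞} {σ : ℝ} (hσ : σ ≤ 1 / 2) {v : ℝ → ℤ → ℂ}
    (hv : IsClassicalSolution N v) : ContH σ v := by
  obtain ⟨r, hr, u, hu, huv⟩ := hv.exists_solvesIn
  have h1 := hu.cont.mono (by linarith : σ ≤ r)
  simpa only [huv] using h1

/-- The identity integrated in time expresses the energy increment through functionals that are
continuous on H^σ, so the limit exists and depends only on v. -/
theorem limitEnergyIdentity_of_locLip {s σ : ℝ} {N : ℕ∞} (hσ : σ ≤ 1 / 2)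
    {N₀ : (j : ℕ) → ℝ → Form σ (2 * j)} {N₁ R : (j : ℕ) → ℝ → Form σ (2 * j + 2)}
    (h₀ : LocLip (fun t (f : H σ) => diagSum (fun j => N₀ j t) f))
    (h₁ : LocLip (fun t (f : H σ) => diagSum (fun j => N₁ j t) f))
    (h₂ : LocLip (fun t (f : H σ) => diagSum (fun j => R j t) f))
    (hcl : ∀ v : ℝ → H σ, IsClassicalSolution N (fun t => (v t : ℤ → ℂ)) →
      EnergyIdentity s N₀ N₁ R v)
    {v : ℝ → H σ} (hv : IsSolution N v) : LimitEnergyIdentity s N N₀ N₁ R v := by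
  set F : ℝ → H σ → ℝ := fun t f => diagSum (fun j => N₀ j t) f with hF
  set G : ℝ → H σ → ℝ := fun t f => diagSum (fun j => N₁ j t) f + diagSum (fun j => R j t) f
    with hG
  have hGlip : LocLip G := by
    refine ⟨fun ρ => ?_, fun f => (h₁.cont f).add (h₂.cont f)⟩
    obtain ⟨l₁, hl₁⟩ := h₁.lip ρ
    obtain ⟨l₂, hl₂⟩ := h₂.lip ρ
    refine ⟨l₁ + l₂, fun t f g hf hg => ?_⟩
    rw [hG]
    simp only
    rw [add_sub_add_comm, add_mul]
    exact (norm_add_le _ _).trans (add_le_add (hl₁ t f g hf hg) (hl₂ t f g hf hg))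
  have hcont : ∀ w : ℝ → H σ, ContH σ (fun t => (w t : ℤ → ℂ)) → Continuous fun t => G t (w t) :=
    fun w hw => hGlip.continuous hw
  refine ⟨fun t => F t (v t) - F 0 (v 0) + ∫ τ in (0 : ℝ)..t, G τ (v τ), ?_, fun t => ?_⟩
  · intro w hw
    have hwid : ∀ k t, 1 / 2 * normH s (w k t) ^ 2 - 1 / 2 * normH s (w k 0) ^ 2 =
        F t (w k t) - F 0 (w k 0) + ∫ τ in (0 : ℝ)..t, G τ (w k τ) := by
      intro k t
      have hw' := hw.1 k
      have hd : ∀ τ, HasDerivAt (fun τ => 1 / 2 * normH s (w k τ) ^ 2 - F τ (w k τ))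
          (G τ (w k τ)) τ := fun τ => by
        obtain ⟨D, hD1, hD2⟩ := (hcl _ hw').2 τ
        exact (hD2.sub hD1).congr_deriv (by rw [hG]; ring)
      rw [intervalIntegral.integral_eq_sub_of_hasDerivAt (fun τ _ => hd τ)
        ((hcont _ (hw'.contH hσ)).intervalIntegrable _ _)]
      ring
    rw [Metric.tendstoLocallyUniformly_iff]
    intro η hη x
    set T := |x| + 1 with hT
    have hT0 : 0 < T := by positivity
    refine ⟨Set.Icc (-T) T, Icc_mem_nhds ?_ ?_, ?_⟩
    · have := neg_abs_le x; linarith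
    · have := le_abs_self x; linarith
    obtain ⟨M, hM⟩ := (isCompact_Icc (a := -T) (b := T)).bddAbove_image
      hv.1.continuous_normH.continuousOn
    obtain ⟨l, hl⟩ := h₀.lip (M + 1)
    obtain ⟨m, hm⟩ := hGlip.lip (M + 1)
    -- The bound 1 keeps the approximations in the ball of radius M + 1. The denominator accounts
    -- for the two boundary values and for an integral of length at most T, and leaves an error
    -- below η.
    set δ := min 1 (η / (2 * (2 * |l| + T * |m| + 1))) with hδ
    have hden : 0 < 2 * (2 * |l| + T * |m| + 1) := by positivity
    have hδ0 : 0 < δ := lt_min one_pos (div_pos hη hden)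
    filter_upwards [hw.2 T δ hδ0] with k hk t ht
    have hδ1 : δ ≤ 1 := min_le_left _ _
    have hvM : ∀ τ ∈ Set.Icc (-T) T, normH σ (v τ) ≤ M + 1 := fun τ hτ => by
      linarith [hM ⟨τ, hτ, rfl⟩]
    have hwM : ∀ τ ∈ Set.Icc (-T) T, normH σ (w k τ) ≤ M + 1 := fun τ hτ => by
      have h3 : normH σ (v τ) ≤ M := hM ⟨τ, hτ, rfl⟩
      linarith [normH_le_add_sub (w k τ) (v τ), hk τ hτ]
    have hFd : ∀ τ ∈ Set.Icc (-T) T, |F τ (v τ) - F τ (w k τ)| ≤ |l| * δ := fun τ hτ => by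
      refine (hl τ _ _ (hvM τ hτ) (hwM τ hτ)).trans ?_
      rw [normH_sub_comm]
      exact mul_le_mul (le_abs_self _) (hk τ hτ) (normH_nonneg _ _) (abs_nonneg _)
    have hGd : ∀ τ ∈ Set.Icc (-T) T, ‖G τ (v τ) - G τ (w k τ)‖ ≤ |m| * δ := fun τ hτ => by
      refine (hm τ _ _ (hvM τ hτ) (hwM τ hτ)).trans ?_
      rw [normH_sub_comm]
      exact mul_le_mul (le_abs_self _) (hk τ hτ) (normH_nonneg _ _) (abs_nonneg _)
    have h0T : (0 : ℝ) ∈ Set.Icc (-T) T := ⟨by linarith, hT0.le⟩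
    have hint : |(∫ τ in (0 : ℝ)..t, G τ (v τ)) - ∫ τ in (0 : ℝ)..t, G τ (w k τ)| ≤
        |m| * δ * T := by
      rw [← intervalIntegral.integral_sub ((hcont _ hv.1).intervalIntegrable _ _)
        ((hcont _ ((hw.1 k).contH hσ)).intervalIntegrable _ _), ← Real.norm_eq_abs]
      refine (intervalIntegral.norm_integral_le_of_norm_le_const (C := |m| * δ) fun τ hτ => ?_).trans
        ?_
      · exact hGd τ (Set.uIcc_subset_Icc h0T ht (Set.uIoc_subset_uIcc hτ))
      · rw [sub_zero]
        have : |t| ≤ T := abs_le.2 ht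
        gcongr
    rw [Real.dist_eq, hwid]
    have e1 := hFd t ht
    have e2 := hFd 0 h0T
    have hfin : (2 * |l| + T * |m| + 1) * δ ≤ η / 2 := by
      calc _ ≤ (2 * |l| + T * |m| + 1) * (η / (2 * (2 * |l| + T * |m| + 1))) := by
            gcongr
            exact min_le_right _ _
        _ = η / 2 := by field_simp
    rw [abs_le] at e1 e2 hint
    rw [abs_lt]
    constructor <;> nlinarith [e1.1, e1.2, e2.1, e2.2, hint.1, hint.2]
  · have h3 : HasDerivAt (fun τ => -F 0 (v 0) + ∫ τ in (0 : ℝ)..τ, G τ (v τ)) (G t (v t)) t :=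
      ((hcont _ hv.1).integral_hasStrictDerivAt 0 t).hasDerivAt.const_add _
    refine h3.congr_of_eventuallyEq (Eventually.of_forall fun τ => ?_)
    rw [hF]
    ring

/-! ### The forms of the normal form expansion -/

section Expansion

variable (s σ : ℝ) (N : ℕ∞)

/-- The boundary terms of the normal form expansion. -/
def boundaryForm (j : ℕ) (t : ℝ) : Form σ (2 * j) := reForm σ (L s N j) t

/-- The terms of the expansion in which the nonlinearity acts nearly resonantly. -/
def lowForm (j : ℕ) (t : ℝ) : Form σ (2 * j + 2) := imForm σ (graft (L s N j) (low N)) t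

/-- The terms of the expansion that come from the resonant part of the nonlinearity. -/
def resonantForm (j : ℕ) (t : ℝ) : Form σ (2 * j + 2) := imForm σ (graft (L s N j) resn) t

variable {s σ N} {C : ℕ → ℝ≥0}

theorem boundedBy_boundaryForm (h : ∀ j, Bdd (L s N (j + 2)) (fun _ => σ) (C (j + 2))) :
    BoundedBy (d := fun j => 2 * j) (boundaryForm s σ N) (fun j => (C j : ℝ))
  | j + 2, _, t, f => abs_reForm_le (h j) t f

theorem boundedBy_lowForm (h : ∀ j, Bdd (graft (L s N (j + 2)) (low N)) (fun _ => σ) (C (j + 2))) :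
    BoundedBy (d := fun j => 2 * j + 2) (lowForm s σ N) (fun j => (C j : ℝ))
  | j + 2, _, t, f => abs_imForm_le (h j) t f

theorem boundedBy_resonantForm
    (h : ∀ j, Bdd (graft (L s N (j + 2)) resn) (fun _ => σ) (C (j + 2))) :
    BoundedBy (d := fun j => 2 * j + 2) (resonantForm s σ N) (fun j => (C j : ℝ))
  | j + 2, _, t, f => abs_imForm_le (h j) t f

theorem continuous_boundaryForm (h : ∀ j, Bdd (L s N (j + 2)) (fun _ => σ) (C (j + 2))) :
    ∀ j, 2 ≤ j → ∀ f : H σ, Continuous fun t => boundaryForm s σ N j t (fun _ => f)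
  | j + 2, _, f => continuous_reForm (h j) f

theorem continuous_lowForm
    (h : ∀ j, Bdd (graft (L s N (j + 2)) (low N)) (fun _ => σ) (C (j + 2))) :
    ∀ j, 2 ≤ j → ∀ f : H σ, Continuous fun t => lowForm s σ N j t (fun _ => f)
  | j + 2, _, f => continuous_imForm (h j) f

theorem continuous_resonantForm
    (h : ∀ j, Bdd (graft (L s N (j + 2)) resn) (fun _ => σ) (C (j + 2))) :
    ∀ j, 2 ≤ j → ∀ f : H σ, Continuous fun t => resonantForm s σ N j t (fun _ => f)
  | j + 2, _, f => continuous_imForm (h j) f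

end Expansion

end FourthNLS

end

theorem proposition5p1 (s : ℝ) (hs : 3 / 10 < s) (hs' : s ≤ 1 / 2) :
    ∃ ε₀ : ℝ, 0 < ε₀ ∧ ∀ ε : ℝ, 0 < ε → ε < ε₀ → ∀ σ : ℝ, σ = s - 1 / 2 - ε →
      ∃ C₀ C₁ C₂ : ℕ → ℝ, SuperexpDecay C₀ ∧ SuperexpDecay C₁ ∧ SuperexpDecay C₂ ∧
        ∀ N : ℕ∞,
          ∃ (N₀ : (j : ℕ) → ℝ → Form σ (2 * j))
            (N₁ R : (j : ℕ) → ℝ → Form σ (2 * j + 2)),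
            (BoundedBy N₀ C₀ ∧ BoundedBy N₁ C₁ ∧ BoundedBy R C₂) ∧
            (SeriesConverge N₀ ∧ SeriesConverge N₁ ∧ SeriesConverge R) ∧
            (∀ v : ℝ → H σ, IsClassicalSolution N (fun t => (v t : ℤ → ℂ)) →
              EnergyIdentity s N₀ N₁ R v) ∧
            (∀ v : ℝ → H σ, IsSolution N v → LimitEnergyIdentity s N N₀ N₁ R v) := by
  -- The `low` estimate requires ε < (5/9)(s - 3/10); one half is a convenient smaller factor.
  refine ⟨(s - 3 / 10) / 2, by linarith, fun ε hε hε' σ hσ => ?_⟩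
  obtain ⟨C₀, C₁, C₂, h₀, h₁, h₂, hB⟩ := exists_bounds hs' hε hε' hσ
  have hσ0 : σ ≤ 0 := by linarith
  refine ⟨fun j => C₀ j, fun j => C₁ j, fun j => C₂ j, h₀, h₁, h₂, fun N => ?_⟩
  have hL := fun j => (hB N j).1
  have hlow := fun j => (hB N j).2.1
  have hres := fun j => (hB N j).2.2
  have b₀ := boundedBy_boundaryForm hL
  have b₁ := boundedBy_lowForm hlow
  have b₂ := boundedBy_resonantForm hres
  have hcl : ∀ v : ℝ → H σ, IsClassicalSolution N (fun t => (v t : ℤ → ℂ)) →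
      EnergyIdentity s (boundaryForm s σ N) (lowForm s σ N) (resonantForm s σ N) v :=
    fun v hv => energyIdentity_of_bounds hs' hσ0 h₀ h₁ h₂ hL hlow hres hv
  exact ⟨boundaryForm s σ N, lowForm s σ N, resonantForm s σ N, ⟨b₀, b₁, b₂⟩,
    ⟨b₀.summable h₀ fun j => by simp, b₁.summable h₁ fun j => le_rfl,
      b₂.summable h₂ fun j => le_rfl⟩, hcl, fun v hv =>
    limitEnergyIdentity_of_locLip (by linarith)
      (b₀.locLip h₀ (fun j => by simp) (continuous_boundaryForm hL))
      (b₁.locLip h₁ (fun j => le_rfl) (continuous_lowForm hlow))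
      (b₂.locLip h₂ (fun j => le_rfl) (continuous_resonantForm hres)) hcl hv⟩
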